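/- Let $\mathbb K=\mathbb R$ or $\mathbb C$; manifolds, bundles and tensor fields are smooth if $\mathbb K=\mathbb R$ and holomorphic if $\mathbb K=\mathbb C$, metrics are non-degenerate symmetric $\mathbb K$-bilinear forms, and vector fields and sections may be local. An *almost Frobenius structure* $(\circ,e,g)$ on a manifold consists of a commutative, associative multiplication $\circ$ on its tangent bundle with unit field $e$ and a metric $g$ with $g(X\circ Y,Z)=g(X,Y\circ Z)$. The multiplication defines an *$F$-manifold* if $L_{X\circ Y}(\circ)=X\circ L_Y(\circ)+Y\circ L_X(\circ)$ for all vector fields $X,Y$; the metric is *admissible* if $e$ is parallel for the Levi-Civita connection of $g$; the structure is *Frobenius* if it is an $F$-manifold with admissible and flat metric. Let $(M,\circ_M,e_M,g_M)$ be a Frobenius manifold of dimension $n$ with Levi-Civita connection $\nabla^M$. Let $\pi:V\to M$ be a $\mathbb K$-vector bundle of rank $r$ with a connection $D$, a commutative, associative multiplication $\circ_V$ on its fibres with unit section $e_V$, a $\circ_V$-invariant metric $g_V$ on its fibres, and a bundle morphism $\alpha:V\to TM$ such that $\alpha(e_V)=e_M$ and $\alpha(v_1\circ_V v_2)=\alpha(v_1)\circ_M\alpha(v_2)$.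 Using the decomposition $T_vV=T_pM\oplus V_p$ ($p=\pi(v)$) into $D$-horizontal and vertical vectors, and writing $\tilde X$ for the horizontal lift of $X$, define on the manifold $V$ the multiplication $$\tilde X\circ\tilde Y=\widetilde{X\circ_M Y},\qquad v_1\circ v_2=v_1\circ_V v_2,\qquad v\circ\tilde X=\tilde X\circ v=\widetilde{\alpha(v)\circ_M X}$$ and the symmetric bilinear form $$g(\tilde X,\tilde Y)=g_M(X,Y),\qquad g(v_1,v_2)=g_V(v_1,v_2),\qquad g(v,\tilde X)=g_M(\alpha(v),X).$$ Assume that $g$ is non-degenerate and that $(V,\circ,e_V,g)$ is an $F$-manifold with admissible metric. For an open set $U\subset M$, let $\{v_1,\dots,v_r\}$ be a frame of $V$ over $U$, orthonormal with respect to $g_V-\alpha^*g_M$, and $\{X_1,\dots,X_n\}$ a frame of $TM$ over $U$, orthonormal with respect to $g_M$ (orthonormal: distinct members are orthogonal and $\epsilon_i:=(g_V-\alpha^*g_M)(v_i,v_i)$, $\tilde\epsilon_j:=g_M(X_j,X_j)$ are $\pm1$). Put $(\nabla^{M,D}_X\alpha)(s)=\nabla^M_X(\alpha(s))-\alpha(D_Xs)$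 and $\alpha(s)^\flat=g_M(\alpha(s),\cdot)$. Consider the following conditions on $U$. 1) For all vector fields $X,Y,Z,T$ the expression $$S_1(X,Y,Z,T)=\sum_{i=1}^r\epsilon_i\bigl(g_M((\nabla^{M,D}_Y\alpha)(v_i),Z)+g_M((\nabla^{M,D}_Z\alpha)(v_i),Y)\bigr)\bigl(g_M((\nabla^{M,D}_X\alpha)(v_i),T)+g_M((\nabla^{M,D}_T\alpha)(v_i),X)\bigr)$$ is symmetric in $X$ and $Y$. 2) For all $\nabla^M$-parallel vector fields $X,Y,Z$ and all $D$-parallel sections $s$, the expression $$S_2(X,Y,Z,s)=\sum_{i=1}^r\epsilon_i\,d(\alpha(s)^\flat)(\alpha(v_i),Y)\bigl(g_M((\nabla^{M,D}_X\alpha)(v_i),Z)+g_M((\nabla^{M,D}_Z\alpha)(v_i),X)\bigr)$$ satisfies $$S_2(X,Y,Z,s)-S_2(Y,X,Z,s)=2\bigl(g_M(\nabla^M_Y\nabla^M_Z(\alpha(s)),X)-g_M(\nabla^M_X\nabla^M_Z(\alpha(s)),Y)\bigr).$$ 3) For all vector fields $X,Y$ and all $D$-parallel sections $s,\tilde s$,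 $$\sum_{j=1}^n\tilde\epsilon_j\,d(\alpha(s)^\flat)(Y,X_j)\,d(\alpha(\tilde s)^\flat)(X,X_j)+\sum_{i=1}^r\epsilon_i\,d(\alpha(s)^\flat)(Y,\alpha(v_i))\,d(\alpha(\tilde s)^\flat)(X,\alpha(v_i))=0.$$ Then, for every such $U$ and all such frames over $U$, the metric $g$ is flat on $\pi^{-1}(U)$ if and only if 1), 2), 3) hold on $U$. Consequently $g$ is flat on $V$ if and only if 1), 2), 3) hold for all such $U$ and all such frames. Moreover $(V,\circ,e_V,g)$ is Frobenius if and only if $g$ is flat. -/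

import Mathlib

open Bundle Set
open scoped Manifold ContDiff Topology

set_option linter.unusedSectionVars false

noncomputable section

namespace BundleFrobenius

/-! ### Tensor fields on vector bundles

A `𝕜`-manifold (`𝕜 = ℝ` or `ℂ`) is of class `∞` over `𝕜`: smooth over `ℝ`, holomorphic over `ℂ`.
Sections, fields, ... are functions defined at every point of the base; a *local* object on an
open set `U` is such a function that is smooth on `U` (its values elsewhere play no role). -/

section Algebra

variable {𝕜 : Type*} [RCLike 𝕜]
  {E : Type*} [NormedAddCommGroup E] [NormedSpace 𝕜 E]
  {H : Type*} [TopologicalSpace H] (I : ModelWithCorners 𝕜 E H)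
  {M : Type*} [TopologicalSpace M] [ChartedSpace H M]
  (F : Type*) [NormedAddCommGroup F] [NormedSpace 𝕜 F]
  {V : M → Type*} [TopologicalSpace (TotalSpace F V)]
  [∀ x, AddCommGroup (V x)] [∀ x, Module 𝕜 (V x)] [∀ x, TopologicalSpace (V x)]
  [∀ x, IsTopologicalAddGroup (V x)] [∀ x, ContinuousSMul 𝕜 (V x)]
  [FiberBundle F V] [VectorBundle 𝕜 F V]

/-- The section `s` of the vector bundle `V` is smooth (holomorphic if `𝕜 = ℂ`) on `U`. -/
def SmoothSectionOn (s : Π x : M, V x) (U : Set M) : Prop :=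
  ContMDiffOn I (I.prod 𝓘(𝕜, F)) ∞ (fun x ↦ TotalSpace.mk' F x (s x)) U

/-- `mul` is a smooth, fibrewise bilinear, commutative, associative multiplication on the vector
bundle `V`, with the smooth section `one` as unit. -/
structure IsCommAlgebraBundle (mul : ∀ x : M, V x →L[𝕜] V x →L[𝕜] V x) (one : Π x : M, V x) :
    Prop where
  smooth_mul : ContMDiff I (I.prod 𝓘(𝕜, F →L[𝕜] F →L[𝕜] F)) ∞
    (fun x ↦ TotalSpace.mk' (F →L[𝕜] F →L[𝕜] F) (E := fun x : M ↦ V x →L[𝕜] V x →L[𝕜] V x)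
      x (mul x))
  smooth_one : SmoothSectionOn I F one univ
  mul_comm : ∀ x (a b : V x), mul x a b = mul x b a
  mul_assoc : ∀ x (a b c : V x), mul x (mul x a b) c = mul x a (mul x b c)
  one_mul : ∀ x (a : V x), mul x (one x) a = a

/-- `g` is a metric on the vector bundle `V` (a smooth field of non-degenerate symmetric
`𝕜`-bilinear forms) which is invariant with respect to the multiplication `mul`. -/
structure IsInvariantMetric (mul : ∀ x : M, V x →L[𝕜] V x →L[𝕜] V x)
    (g : ∀ x : M, V x →L[𝕜] V x →L[𝕜] 𝕜) : Prop where
  smooth : ContMDiff I (I.prod 𝓘(𝕜, F →L[𝕜] F →L[𝕜] 𝕜)) ∞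
    (fun x ↦ TotalSpace.mk' (F →L[𝕜] F →L[𝕜] 𝕜) (E := fun x : M ↦ V x →L[𝕜] V x →L[𝕜] 𝕜)
      x (g x))
  symm : ∀ x (a b : V x), g x a b = g x b a
  nondegenerate : ∀ x (a : V x), (∀ b, g x a b = 0) → a = 0
  invariant : ∀ x (a b c : V x), g x (mul x a b) c = g x a (mul x b c)

/-- The curvature `R(X, Y)s = ∇_X ∇_Y s - ∇_Y ∇_X s - ∇_{[X, Y]} s` of a connection at `x`. -/
def curvature (nabla : CovariantDerivative I F V) (X Y : Π x : M, TangentSpace I x)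
    (s : Π x : M, V x) (x : M) : V x :=
  nabla (fun y ↦ nabla s y (Y y)) x (X x) - nabla (fun y ↦ nabla s y (X y)) x (Y x)
    - nabla s x (VectorField.mlieBracket I X Y x)

/-- The curvature of the connection `nabla` vanishes on the open set `O`. -/
def IsFlatConnectionOn [IsManifold I 1 M] (nabla : CovariantDerivative I F V) (O : Set M) : Prop :=
  ∀ U : Set M, IsOpen U → U ⊆ O → ∀ (X Y : Π x : M, TangentSpace I x) (s : Π x : M, V x),
    SmoothSectionOn I E X U → SmoothSectionOn I E Y U → SmoothSectionOn I F s U →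
    ∀ x ∈ U, curvature I F nabla X Y s x = 0

/-- The local section `s` is parallel on `U`. -/
def IsParallelOn (nabla : CovariantDerivative I F V) (s : Π x : M, V x) (U : Set M) : Prop :=
  ∀ x ∈ U, nabla s x = 0

end Algebra

/-! ### `F`-manifolds and Frobenius manifolds -/

section Manifolds

variable {𝕜 : Type*} [RCLike 𝕜]
  {E : Type*} [NormedAddCommGroup E] [NormedSpace 𝕜 E]
  {H : Type*} [TopologicalSpace H] (I : ModelWithCorners 𝕜 E H)
  {N : Type*} [TopologicalSpace N] [ChartedSpace H N]

/-- The Lie derivative of a multiplication on the tangent bundle: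
`L_X(∘)(Z, T) = [X, Z ∘ T] - [X, Z] ∘ T - Z ∘ [X, T]`. -/
def lieDerivMul
    (mul : ∀ x : N, TangentSpace I x →L[𝕜] TangentSpace I x →L[𝕜] TangentSpace I x)
    (X Z T : Π x : N, TangentSpace I x) (x : N) : TangentSpace I x :=
  VectorField.mlieBracket I X (fun y ↦ mul y (Z y) (T y)) x
    - mul x (VectorField.mlieBracket I X Z x) (T x)
    - mul x (Z x) (VectorField.mlieBracket I X T x)

/-- `(N, mul, e)` is an `F`-manifold:
`L_{X ∘ Y}(∘) = X ∘ L_Y(∘) + Y ∘ L_X(∘)` for all local vector fields. -/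
structure IsFManifold [IsManifold I 1 N]
    (mul : ∀ x : N, TangentSpace I x →L[𝕜] TangentSpace I x →L[𝕜] TangentSpace I x)
    (e : Π x : N, TangentSpace I x) : Prop where
  algebra : IsCommAlgebraBundle I E mul e
  lie_mul : ∀ U : Set N, IsOpen U → ∀ X Y Z T : Π x : N, TangentSpace I x,
    SmoothSectionOn I E X U → SmoothSectionOn I E Y U →
    SmoothSectionOn I E Z U → SmoothSectionOn I E T U → ∀ x ∈ U,
    lieDerivMul I mul (fun y ↦ mul y (X y) (Y y)) Z T x =
      mul x (X x) (lieDerivMul I mul Y Z T x) + mul x (Y x) (lieDerivMul I mul X Z T x)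

/-- `nabla` is the Levi-Civita connection of `g`: it is torsion-free and `∇g = 0`. -/
structure IsLeviCivita [IsManifold I 1 N]
    (g : ∀ x : N, TangentSpace I x →L[𝕜] TangentSpace I x →L[𝕜] 𝕜)
    (nabla : CovariantDerivative I E (TangentSpace I : N → Type _)) : Prop where
  torsion_free : ∀ (X Y : Π x : N, TangentSpace I x) (x : N),
    MDifferentiableAt I (I.prod 𝓘(𝕜, E)) (fun y ↦ TotalSpace.mk' E y (X y)) x →
    MDifferentiableAt I (I.prod 𝓘(𝕜, E)) (fun y ↦ TotalSpace.mk' E y (Y y)) x →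
    nabla Y x (X x) - nabla X x (Y x) = VectorField.mlieBracket I X Y x
  metric : ∀ (Y Z : Π x : N, TangentSpace I x) (x : N) (u : TangentSpace I x),
    MDifferentiableAt I (I.prod 𝓘(𝕜, E)) (fun y ↦ TotalSpace.mk' E y (Y y)) x →
    MDifferentiableAt I (I.prod 𝓘(𝕜, E)) (fun y ↦ TotalSpace.mk' E y (Z y)) x →
    mvfderiv I (fun y ↦ g y (Y y) (Z y)) x u =
      g x (nabla Y x u) (Z x) + g x (Y x) (nabla Z x u)

/-- The metric `g` is admissible: the unit field `e` is parallel for its Levi-Civita connection. -/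
def IsAdmissible [IsManifold I 1 N]
    (g : ∀ x : N, TangentSpace I x →L[𝕜] TangentSpace I x →L[𝕜] 𝕜)
    (e : Π x : N, TangentSpace I x) : Prop :=
  ∃ nabla : CovariantDerivative I E (TangentSpace I : N → Type _),
    IsLeviCivita I g nabla ∧ IsParallelOn I E nabla e univ

/-- The metric `g` is flat on the open set `O`: its Levi-Civita connection has zero curvature
there. -/
def IsFlatMetricOn [IsManifold I 1 N]
    (g : ∀ x : N, TangentSpace I x →L[𝕜] TangentSpace I x →L[𝕜] 𝕜)
    (O : Set N) : Prop :=
  ∃ nabla : CovariantDerivative I E (TangentSpace I : N → Type _),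
    IsLeviCivita I g nabla ∧ IsFlatConnectionOn I E nabla O

/-- `(N, mul, e, g)` is a Frobenius manifold: an `F`-manifold with an invariant metric which is
admissible and flat. -/
structure IsFrobenius [IsManifold I 1 N]
    (mul : ∀ x : N, TangentSpace I x →L[𝕜] TangentSpace I x →L[𝕜] TangentSpace I x)
    (e : Π x : N, TangentSpace I x)
    (g : ∀ x : N, TangentSpace I x →L[𝕜] TangentSpace I x →L[𝕜] 𝕜) : Prop where
  fManifold : IsFManifold I mul e
  metric : IsInvariantMetric I E mul g
  admissible : IsAdmissible I g e
  flat : IsFlatMetricOn I g univ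

/-- The exterior derivative of a `1`-form, evaluated on local vector fields:
`dη(A, B) = A(η(B)) - B(η(A)) - η([A, B])`. -/
def dOneForm (η : ∀ x : N, TangentSpace I x →L[𝕜] 𝕜) (A B : Π x : N, TangentSpace I x) (x : N) :
    𝕜 :=
  mvfderiv I (fun y ↦ η y (B y)) x (A x) - mvfderiv I (fun y ↦ η y (A y)) x (B x)
    - η x (VectorField.mlieBracket I A B x)

end Manifolds

/-! ### The multiplication and the metric on the total space of a vector bundle -/

section Total

variable {𝕜 : Type*} [RCLike 𝕜]
  {E : Type*} [NormedAddCommGroup E] [NormedSpace 𝕜 E] [FiniteDimensional 𝕜 E]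
  {M : Type*} [TopologicalSpace M] [ChartedSpace E M] [IsManifold 𝓘(𝕜, E) ∞ M]
  {F : Type*} [NormedAddCommGroup F] [NormedSpace 𝕜 F] [FiniteDimensional 𝕜 F]
  {V : M → Type*} [TopologicalSpace (TotalSpace F V)]
  [∀ x, AddCommGroup (V x)] [∀ x, Module 𝕜 (V x)] [∀ x, TopologicalSpace (V x)]
  [∀ x, IsTopologicalAddGroup (V x)] [∀ x, ContinuousSMul 𝕜 (V x)]
  [FiberBundle F V] [VectorBundle 𝕜 F V] [ContMDiffVectorBundle ∞ F V 𝓘(𝕜, E)]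

/-- The tangent space of the manifold `V` at the vector `v`. -/
abbrev TotalTangent (𝕜 : Type*) [RCLike 𝕜] {E : Type*} [NormedAddCommGroup E] [NormedSpace 𝕜 E]
    {M : Type*} [TopologicalSpace M] [ChartedSpace E M]
    {F : Type*} [NormedAddCommGroup F] [NormedSpace 𝕜 F]
    {V : M → Type*} [TopologicalSpace (TotalSpace F V)] [∀ x, TopologicalSpace (V x)]
    [FiberBundle F V] (v : TotalSpace F V) :=
  TangentSpace (𝓘(𝕜, E).prod 𝓘(𝕜, F)) v

/-- The differential `T_v V → T_p M` of the bundle projection, `p = π(v)`. -/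
def projDeriv (v : TotalSpace F V) :
    TotalTangent 𝕜 (E := E) v →L[𝕜] TangentSpace 𝓘(𝕜, E) v.proj :=
  mfderiv (𝓘(𝕜, E).prod 𝓘(𝕜, F)) 𝓘(𝕜, E) (TotalSpace.proj : TotalSpace F V → M) v

/-- The differential at `v` of the second component of the trivialization around `π(v)`. -/
def fiberCoordDeriv (v : TotalSpace F V) : TotalTangent 𝕜 (E := E) v →L[𝕜] F :=
  mvfderiv (𝓘(𝕜, E).prod 𝓘(𝕜, F))
    (fun w : TotalSpace F V ↦ (trivializationAt F V v.proj w).2) v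

/-- The connection map `K_v : T_v V → V_p` of `D`. In the trivialization around `p`, with `σ`
the local section through `v` which is constant in it (`FiberBundle.extend F v.2`),
`K_v(W)` is the fibre component of `W` plus `D_{dπ(W)} σ`, so that `K(ds(X)) = D_X s` for all
sections `s`. Its kernel is the horizontal subspace of `D`. -/
def connectionMap (D : CovariantDerivative 𝓘(𝕜, E) F V) (v : TotalSpace F V) :
    TotalTangent 𝕜 (E := E) v →L[𝕜] V v.proj :=
  (trivializationAt F V v.proj).symmL 𝕜 v.proj ∘L fiberCoordDeriv v
    + D (FiberBundle.extend F v.2) v.proj ∘L projDeriv v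

/-- `W ↦ (dπ(W), K_v(W))` as a linear map `T_v V → T_p M × V_p`. -/
def splitMap (D : CovariantDerivative 𝓘(𝕜, E) F V) (v : TotalSpace F V) :
    TotalTangent 𝕜 (E := E) v →L[𝕜] TangentSpace 𝓘(𝕜, E) v.proj × V v.proj :=
  (projDeriv v).prod (connectionMap D v)

theorem tangent_eq_zero (v : TotalSpace F V) (W : TotalTangent 𝕜 (E := E) v)
    (h1 : projDeriv v W = 0) (h2 : fiberCoordDeriv v W = 0) : W = 0 := by
  set e := trivializationAt F V v.proj with he
  have hv : v ∈ e.source := by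
    rw [e.mem_source]; exact FiberBundle.mem_baseSet_trivializationAt' v.proj
  have hmd := e.mdifferentiable (I := 𝓘(𝕜, E))
  have hinj := hmd.mfderiv_injective hv
  have hvb : v.proj ∈ e.baseSet := FiberBundle.mem_baseSet_trivializationAt' v.proj
  have hsnd : MDifferentiableAt (𝓘(𝕜, E).prod 𝓘(𝕜, F)) 𝓘(𝕜, F) (fun w ↦ (e w).2) v :=
    (mdifferentiableAt_snd).comp v (hmd.mdifferentiableAt hv)
  have hproj : MDifferentiableAt (𝓘(𝕜, E).prod 𝓘(𝕜, F)) 𝓘(𝕜, E)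
      (TotalSpace.proj : TotalSpace F V → M) v :=
    (Bundle.contMDiffAt_proj (n := 1) V).mdifferentiableAt (by simp)
  have heq : (e : TotalSpace F V → M × F) =ᶠ[𝓝 v] fun w ↦ (w.proj, (e w).2) := by
    filter_upwards [e.open_source.mem_nhds hv] with w hw
    exact Prod.ext (e.coe_fst hw) rfl
  apply hinj
  rw [map_zero]
  have : mfderiv (𝓘(𝕜, E).prod 𝓘(𝕜, F)) (𝓘(𝕜, E).prod 𝓘(𝕜, F)) e v W = 0 := by
    rw [heq.mfderiv_eq, mfderiv_prodMk hproj hsnd]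
    exact Prod.ext h1 h2
  exact this

theorem splitMap_injective (D : CovariantDerivative 𝓘(𝕜, E) F V) (v : TotalSpace F V) :
    Function.Injective (splitMap D v) := by
  rw [injective_iff_map_eq_zero]
  intro W hW
  have h1 : projDeriv v W = 0 := congrArg Prod.fst hW
  have h2 : connectionMap D v W = 0 := congrArg Prod.snd hW
  refine tangent_eq_zero v W h1 ?_
  have hvb : v.proj ∈ (trivializationAt F V v.proj).baseSet :=
    FiberBundle.mem_baseSet_trivializationAt' v.proj
  simp only [connectionMap, add_apply, ContinuousLinearMap.comp_apply, h1,
    map_zero, add_zero] at h2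
  have := congrArg ((trivializationAt F V v.proj).continuousLinearMapAt 𝕜 v.proj) h2
  rwa [Trivialization.continuousLinearMapAt_symmL _ hvb, map_zero] at this

theorem splitMap_bijective (D : CovariantDerivative 𝓘(𝕜, E) F V) (v : TotalSpace F V) :
    Function.Bijective (splitMap D v) := by
  let φ : V v.proj ≃L[𝕜] F := (trivializationAt F V v.proj).continuousLinearEquivAt 𝕜 v.proj
    (FiberBundle.mem_baseSet_trivializationAt' v.proj)
  have : FiniteDimensional 𝕜 (V v.proj) := φ.symm.toLinearEquiv.finiteDimensional
  have : FiniteDimensional 𝕜 (TangentSpace 𝓘(𝕜, E) v.proj) :=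
    inferInstanceAs (FiniteDimensional 𝕜 E)
  have : FiniteDimensional 𝕜 (TotalTangent 𝕜 (E := E) v) :=
    inferInstanceAs (FiniteDimensional 𝕜 (E × F))
  have hdim : Module.finrank 𝕜 (TotalTangent 𝕜 (E := E) v)
      = Module.finrank 𝕜 (TangentSpace 𝓘(𝕜, E) v.proj × V v.proj) := by
    rw [Module.finrank_prod, φ.toLinearEquiv.finrank_eq]
    exact Module.finrank_prod (R := 𝕜) (M := E) (M' := F)
  exact ⟨splitMap_injective D v,
    (LinearMap.injective_iff_surjective_of_finrank_eq_finrank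
      (f := (splitMap D v).toLinearMap) hdim).1 (splitMap_injective D v)⟩

/-- The decomposition `T_v V = T_p M ⊕ V_p` into horizontal and vertical vectors (`p = π(v)`). -/
def splitting (D : CovariantDerivative 𝓘(𝕜, E) F V) (v : TotalSpace F V) :
    TotalTangent 𝕜 (E := E) v ≃L[𝕜] TangentSpace 𝓘(𝕜, E) v.proj × V v.proj :=
  haveI : FiniteDimensional 𝕜 (TotalTangent 𝕜 (E := E) v) :=
    inferInstanceAs (FiniteDimensional 𝕜 (E × F))
  haveI : T2Space (TotalTangent 𝕜 (E := E) v) := inferInstanceAs (T2Space (E × F))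
  haveI : T2Space (TangentSpace 𝓘(𝕜, E) v.proj) := inferInstanceAs (T2Space E)
  haveI : T2Space (V v.proj) := ((trivializationAt F V v.proj).continuousLinearEquivAt 𝕜 v.proj
    (FiberBundle.mem_baseSet_trivializationAt' v.proj)).toHomeomorph.symm.t2Space
  (LinearEquiv.ofBijective (splitMap D v).toLinearMap
    (splitMap_bijective D v)).toContinuousLinearEquiv

/-- The `D`-horizontal lift `X̃_v` of `X ∈ T_p M`: the vector with `dπ(X̃) = X`, `K_v(X̃) = 0`. -/
def horLift (D : CovariantDerivative 𝓘(𝕜, E) F V) (v : TotalSpace F V) :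
    TangentSpace 𝓘(𝕜, E) v.proj →L[𝕜] TotalTangent 𝕜 (E := E) v :=
  (splitting D v).symm.toContinuousLinearMap ∘L ContinuousLinearMap.inl 𝕜 _ _

/-- The vector `w ∈ V_p`, viewed as a vertical vector at `v`: `dπ(w) = 0`, `K_v(w) = w`. -/
def vertLift (D : CovariantDerivative 𝓘(𝕜, E) F V) (v : TotalSpace F V) :
    V v.proj →L[𝕜] TotalTangent 𝕜 (E := E) v :=
  (splitting D v).symm.toContinuousLinearMap ∘L ContinuousLinearMap.inr 𝕜 _ _

theorem splitting_apply (D : CovariantDerivative 𝓘(𝕜, E) F V) (v : TotalSpace F V)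
    (W : TotalTangent 𝕜 (E := E) v) :
    splitting D v W = (projDeriv v W, connectionMap D v W) := rfl

theorem projDeriv_horLift (D : CovariantDerivative 𝓘(𝕜, E) F V) (v : TotalSpace F V)
    (X : TangentSpace 𝓘(𝕜, E) v.proj) : projDeriv v (horLift D v X) = X :=
  congrArg Prod.fst ((splitting D v).apply_symm_apply (X, 0))

theorem connectionMap_horLift (D : CovariantDerivative 𝓘(𝕜, E) F V) (v : TotalSpace F V)
    (X : TangentSpace 𝓘(𝕜, E) v.proj) : connectionMap D v (horLift D v X) = 0 :=
  congrArg Prod.snd ((splitting D v).apply_symm_apply (X, 0))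

theorem projDeriv_vertLift (D : CovariantDerivative 𝓘(𝕜, E) F V) (v : TotalSpace F V)
    (w : V v.proj) : projDeriv (𝕜 := 𝕜) (E := E) v (vertLift D v w) = 0 :=
  congrArg Prod.fst ((splitting D v).apply_symm_apply (0, w))

theorem connectionMap_vertLift (D : CovariantDerivative 𝓘(𝕜, E) F V) (v : TotalSpace F V)
    (w : V v.proj) : connectionMap D v (vertLift D v w) = w :=
  congrArg Prod.snd ((splitting D v).apply_symm_apply (0, w))

/-- The multiplication on the tangent bundle of the manifold `V`:
`X̃ ∘ Ỹ = (X ∘_M Y)~`, `v₁ ∘ v₂ = v₁ ∘_V v₂`, `v ∘ X̃ = X̃ ∘ v = (α(v) ∘_M X)~`. -/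
def totalMul (D : CovariantDerivative 𝓘(𝕜, E) F V)
    (mulM : ∀ x : M,
      TangentSpace 𝓘(𝕜, E) x →L[𝕜] TangentSpace 𝓘(𝕜, E) x →L[𝕜] TangentSpace 𝓘(𝕜, E) x)
    (mulV : ∀ x : M, V x →L[𝕜] V x →L[𝕜] V x)
    (α : ∀ x : M, V x →L[𝕜] TangentSpace 𝓘(𝕜, E) x) (v : TotalSpace F V) :
    TotalTangent 𝕜 (E := E) v →L[𝕜] TotalTangent 𝕜 (E := E) v →L[𝕜] TotalTangent 𝕜 (E := E) v :=
  let P := projDeriv (𝕜 := 𝕜) (E := E) v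
  let K := connectionMap D v
  let A := α v.proj ∘L K
  ContinuousLinearMap.postcomp _ (horLift D v) ∘L
      (ContinuousLinearMap.precomp _ P ∘L mulM v.proj ∘L (P + A)
        + ContinuousLinearMap.precomp _ A ∘L mulM v.proj ∘L P)
    + ContinuousLinearMap.postcomp _ (vertLift D v) ∘L
        ContinuousLinearMap.precomp _ K ∘L mulV v.proj ∘L K

theorem totalMul_apply (D : CovariantDerivative 𝓘(𝕜, E) F V)
    (mulM : ∀ x : M,
      TangentSpace 𝓘(𝕜, E) x →L[𝕜] TangentSpace 𝓘(𝕜, E) x →L[𝕜] TangentSpace 𝓘(𝕜, E) x)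
    (mulV : ∀ x : M, V x →L[𝕜] V x →L[𝕜] V x)
    (α : ∀ x : M, V x →L[𝕜] TangentSpace 𝓘(𝕜, E) x) (v : TotalSpace F V)
    (W₁ W₂ : TotalTangent 𝕜 (E := E) v) :
    totalMul D mulM mulV α v W₁ W₂ =
      horLift D v (mulM v.proj (projDeriv v W₁) (projDeriv v W₂)
        + mulM v.proj (α v.proj (connectionMap D v W₁)) (projDeriv v W₂)
        + mulM v.proj (projDeriv v W₁) (α v.proj (connectionMap D v W₂)))
      + vertLift D v (mulV v.proj (connectionMap D v W₁) (connectionMap D v W₂)) := by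
  simp [totalMul]

/-- The metric on the manifold `V`:
`g(X̃, Ỹ) = g_M(X, Y)`, `g(v₁, v₂) = g_V(v₁, v₂)`, `g(v, X̃) = g(X̃, v) = g_M(α(v), X)`. -/
def totalMetric (D : CovariantDerivative 𝓘(𝕜, E) F V)
    (gM : ∀ x : M, TangentSpace 𝓘(𝕜, E) x →L[𝕜] TangentSpace 𝓘(𝕜, E) x →L[𝕜] 𝕜)
    (gV : ∀ x : M, V x →L[𝕜] V x →L[𝕜] 𝕜)
    (α : ∀ x : M, V x →L[𝕜] TangentSpace 𝓘(𝕜, E) x) (v : TotalSpace F V) :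
    TotalTangent 𝕜 (E := E) v →L[𝕜] TotalTangent 𝕜 (E := E) v →L[𝕜] 𝕜 :=
  let P := projDeriv (𝕜 := 𝕜) (E := E) v
  let K := connectionMap D v
  let A := α v.proj ∘L K
  ContinuousLinearMap.precomp _ P ∘L gM v.proj ∘L (P + A)
    + ContinuousLinearMap.precomp _ A ∘L gM v.proj ∘L P
    + ContinuousLinearMap.precomp _ K ∘L gV v.proj ∘L K

theorem totalMetric_apply (D : CovariantDerivative 𝓘(𝕜, E) F V)
    (gM : ∀ x : M, TangentSpace 𝓘(𝕜, E) x →L[𝕜] TangentSpace 𝓘(𝕜, E) x →L[𝕜] 𝕜)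
    (gV : ∀ x : M, V x →L[𝕜] V x →L[𝕜] 𝕜)
    (α : ∀ x : M, V x →L[𝕜] TangentSpace 𝓘(𝕜, E) x) (v : TotalSpace F V)
    (W₁ W₂ : TotalTangent 𝕜 (E := E) v) :
    totalMetric D gM gV α v W₁ W₂ =
      gM v.proj (projDeriv v W₁) (projDeriv v W₂)
        + gM v.proj (α v.proj (connectionMap D v W₁)) (projDeriv v W₂)
        + gM v.proj (projDeriv v W₁) (α v.proj (connectionMap D v W₂))
        + gV v.proj (connectionMap D v W₁) (connectionMap D v W₂) := by
  simp [totalMetric]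

/-- The unit section `e_V`, viewed as a vertical vector field on the manifold `V`. -/
def totalUnit (D : CovariantDerivative 𝓘(𝕜, E) F V) (eV : Π x : M, V x) (v : TotalSpace F V) :
    TotalTangent 𝕜 (E := E) v :=
  vertLift D v (eV v.proj)

/-! ### The conditions on the morphism `α` -/

/-- The connection `D` on `V` is smooth: it maps smooth local sections to smooth local
`V`-valued `1`-forms. -/
def IsSmoothConnection (D : CovariantDerivative 𝓘(𝕜, E) F V) : Prop :=
  ∀ U : Set M, IsOpen U → ContMDiffCovariantDerivativeOn F ∞ D.toFun U

/-- The vector bundle morphism `α : V → TM` is smooth. -/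
def IsSmoothMorphism (α : ∀ x : M, V x →L[𝕜] TangentSpace 𝓘(𝕜, E) x) : Prop :=
  ContMDiff 𝓘(𝕜, E) (𝓘(𝕜, E).prod 𝓘(𝕜, F →L[𝕜] E)) ∞
    (fun x ↦ TotalSpace.mk' (F →L[𝕜] E) (E := fun x : M ↦ V x →L[𝕜] TangentSpace 𝓘(𝕜, E) x)
      x (α x))

/-- The bilinear form `g_V - α^* g_M` on `V_x`. -/
def reducedMetric (gM : ∀ x : M, TangentSpace 𝓘(𝕜, E) x →L[𝕜] TangentSpace 𝓘(𝕜, E) x →L[𝕜] 𝕜)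
    (gV : ∀ x : M, V x →L[𝕜] V x →L[𝕜] 𝕜)
    (α : ∀ x : M, V x →L[𝕜] TangentSpace 𝓘(𝕜, E) x) (x : M) (a b : V x) : 𝕜 :=
  gV x a b - gM x (α x a) (α x b)

/-- The sections `f i` form a local frame on `U` which is orthonormal for the fibrewise bilinear
form `b`: `b(f i, f j) = 0` for `i ≠ j` and `b(f i, f i) = ±1`. -/
structure IsOrthonormalFrameOn {ι : Type*} (F : Type*) [NormedAddCommGroup F] [NormedSpace 𝕜 F]
    {V : M → Type*} [TopologicalSpace (TotalSpace F V)]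
    [∀ x, AddCommGroup (V x)] [∀ x, Module 𝕜 (V x)] [∀ x, TopologicalSpace (V x)]
    [FiberBundle F V] [VectorBundle 𝕜 F V]
    (b : ∀ x : M, V x → V x → 𝕜) (f : ι → Π x : M, V x) (U : Set M) : Prop where
  frame : IsLocalFrameOn 𝓘(𝕜, E) F ∞ f U
  orthogonal : ∀ x ∈ U, ∀ i j, i ≠ j → b x (f i x) (f j x) = 0
  normalized : ∀ x ∈ U, ∀ i, b x (f i x) (f i x) = 1 ∨ b x (f i x) (f i x) = -1

/-- The covariant derivative of `α` for the product connection `∇^M ⊗ D` on `TM ⊗ V^*`: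
`(∇^{M,D}_X α)(s) = ∇^M_X (α(s)) - α(D_X s)`. -/
def nablaAlpha (nablaM : CovariantDerivative 𝓘(𝕜, E) E (TangentSpace 𝓘(𝕜, E) : M → Type _))
    (D : CovariantDerivative 𝓘(𝕜, E) F V) (α : ∀ x : M, V x →L[𝕜] TangentSpace 𝓘(𝕜, E) x)
    (X : Π x : M, TangentSpace 𝓘(𝕜, E) x) (s : Π x : M, V x) (x : M) : TangentSpace 𝓘(𝕜, E) x :=
  nablaM (fun y ↦ α y (s y)) x (X x) - α x (D s x (X x))

/-- The `1`-form `α(s)^♭ = g_M(α(s), ·)`. -/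
def alphaFlat (gM : ∀ x : M, TangentSpace 𝓘(𝕜, E) x →L[𝕜] TangentSpace 𝓘(𝕜, E) x →L[𝕜] 𝕜)
    (α : ∀ x : M, V x →L[𝕜] TangentSpace 𝓘(𝕜, E) x) (s : Π x : M, V x) (x : M) :
    TangentSpace 𝓘(𝕜, E) x →L[𝕜] 𝕜 :=
  gM x (α x (s x))

/-- `g_M((∇^{M,D}_X α)(s), Z) + g_M((∇^{M,D}_Z α)(s), X)`. -/
def symNablaAlpha
    (nablaM : CovariantDerivative 𝓘(𝕜, E) E (TangentSpace 𝓘(𝕜, E) : M → Type _))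
    (D : CovariantDerivative 𝓘(𝕜, E) F V)
    (gM : ∀ x : M, TangentSpace 𝓘(𝕜, E) x →L[𝕜] TangentSpace 𝓘(𝕜, E) x →L[𝕜] 𝕜)
    (α : ∀ x : M, V x →L[𝕜] TangentSpace 𝓘(𝕜, E) x)
    (X Z : Π x : M, TangentSpace 𝓘(𝕜, E) x) (s : Π x : M, V x) (x : M) : 𝕜 :=
  gM x (nablaAlpha nablaM D α X s x) (Z x) + gM x (nablaAlpha nablaM D α Z s x) (X x)

/-- `S₁(X, Y, Z, T)`, for the local frame `v` and `ε_i = (g_V - α^* g_M)(v_i, v_i)`. -/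
def S₁ {ι : Type*} [Fintype ι]
    (nablaM : CovariantDerivative 𝓘(𝕜, E) E (TangentSpace 𝓘(𝕜, E) : M → Type _))
    (D : CovariantDerivative 𝓘(𝕜, E) F V)
    (gM : ∀ x : M, TangentSpace 𝓘(𝕜, E) x →L[𝕜] TangentSpace 𝓘(𝕜, E) x →L[𝕜] 𝕜)
    (gV : ∀ x : M, V x →L[𝕜] V x →L[𝕜] 𝕜)
    (α : ∀ x : M, V x →L[𝕜] TangentSpace 𝓘(𝕜, E) x) (v : ι → Π x : M, V x)
    (X Y Z T : Π x : M, TangentSpace 𝓘(𝕜, E) x) (x : M) : 𝕜 :=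
  ∑ i, reducedMetric gM gV α x (v i x) (v i x) *
    (symNablaAlpha nablaM D gM α Y Z (v i) x * symNablaAlpha nablaM D gM α X T (v i) x)

/-- `S₂(X, Y, Z, s)`, for the local frame `v` and `ε_i = (g_V - α^* g_M)(v_i, v_i)`. -/
def S₂ {ι : Type*} [Fintype ι]
    (nablaM : CovariantDerivative 𝓘(𝕜, E) E (TangentSpace 𝓘(𝕜, E) : M → Type _))
    (D : CovariantDerivative 𝓘(𝕜, E) F V)
    (gM : ∀ x : M, TangentSpace 𝓘(𝕜, E) x →L[𝕜] TangentSpace 𝓘(𝕜, E) x →L[𝕜] 𝕜)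
    (gV : ∀ x : M, V x →L[𝕜] V x →L[𝕜] 𝕜)
    (α : ∀ x : M, V x →L[𝕜] TangentSpace 𝓘(𝕜, E) x) (v : ι → Π x : M, V x)
    (X Y Z : Π x : M, TangentSpace 𝓘(𝕜, E) x) (s : Π x : M, V x) (x : M) : 𝕜 :=
  ∑ i, reducedMetric gM gV α x (v i x) (v i x) *
    (dOneForm 𝓘(𝕜, E) (alphaFlat gM α s) (fun y ↦ α y (v i y)) Y x *
      symNablaAlpha nablaM D gM α X Z (v i) x)

/-- The three conditions on `α` over the open set `U`, in terms of a local frame `v` of `V` and a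
local frame `Xf` of `TM`. -/
structure FlatnessConditionsOn {ι κ : Type*} [Fintype ι] [Fintype κ]
    (nablaM : CovariantDerivative 𝓘(𝕜, E) E (TangentSpace 𝓘(𝕜, E) : M → Type _))
    (D : CovariantDerivative 𝓘(𝕜, E) F V)
    (gM : ∀ x : M, TangentSpace 𝓘(𝕜, E) x →L[𝕜] TangentSpace 𝓘(𝕜, E) x →L[𝕜] 𝕜)
    (gV : ∀ x : M, V x →L[𝕜] V x →L[𝕜] 𝕜)
    (α : ∀ x : M, V x →L[𝕜] TangentSpace 𝓘(𝕜, E) x)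
    (v : ι → Π x : M, V x) (Xf : κ → Π x : M, TangentSpace 𝓘(𝕜, E) x) (U : Set M) : Prop where
  symm_S₁ : ∀ W : Set M, IsOpen W → W ⊆ U → ∀ X Y Z T : Π x : M, TangentSpace 𝓘(𝕜, E) x,
    SmoothSectionOn 𝓘(𝕜, E) E X W → SmoothSectionOn 𝓘(𝕜, E) E Y W →
    SmoothSectionOn 𝓘(𝕜, E) E Z W → SmoothSectionOn 𝓘(𝕜, E) E T W → ∀ x ∈ W,
    S₁ nablaM D gM gV α v X Y Z T x = S₁ nablaM D gM gV α v Y X Z T x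
  skew_S₂ : ∀ W : Set M, IsOpen W → W ⊆ U →
    ∀ (X Y Z : Π x : M, TangentSpace 𝓘(𝕜, E) x) (s : Π x : M, V x),
    SmoothSectionOn 𝓘(𝕜, E) E X W → IsParallelOn 𝓘(𝕜, E) E nablaM X W →
    SmoothSectionOn 𝓘(𝕜, E) E Y W → IsParallelOn 𝓘(𝕜, E) E nablaM Y W →
    SmoothSectionOn 𝓘(𝕜, E) E Z W → IsParallelOn 𝓘(𝕜, E) E nablaM Z W →
    SmoothSectionOn 𝓘(𝕜, E) F s W → IsParallelOn 𝓘(𝕜, E) F D s W → ∀ x ∈ W,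
    S₂ nablaM D gM gV α v X Y Z s x - S₂ nablaM D gM gV α v Y X Z s x =
      2 * (gM x (nablaM (fun y ↦ nablaM (fun z ↦ α z (s z)) y (Z y)) x (Y x)) (X x)
        - gM x (nablaM (fun y ↦ nablaM (fun z ↦ α z (s z)) y (Z y)) x (X x)) (Y x))
  quadratic : ∀ W : Set M, IsOpen W → W ⊆ U →
    ∀ (X Y : Π x : M, TangentSpace 𝓘(𝕜, E) x) (s s' : Π x : M, V x),
    SmoothSectionOn 𝓘(𝕜, E) E X W → SmoothSectionOn 𝓘(𝕜, E) E Y W →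
    SmoothSectionOn 𝓘(𝕜, E) F s W → IsParallelOn 𝓘(𝕜, E) F D s W →
    SmoothSectionOn 𝓘(𝕜, E) F s' W → IsParallelOn 𝓘(𝕜, E) F D s' W → ∀ x ∈ W,
    ∑ j, gM x (Xf j x) (Xf j x) *
        (dOneForm 𝓘(𝕜, E) (alphaFlat gM α s) Y (Xf j) x *
          dOneForm 𝓘(𝕜, E) (alphaFlat gM α s') X (Xf j) x)
      + ∑ i, reducedMetric gM gV α x (v i x) (v i x) *
        (dOneForm 𝓘(𝕜, E) (alphaFlat gM α s) Y (fun y ↦ α y (v i y)) x *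
          dOneForm 𝓘(𝕜, E) (alphaFlat gM α s') X (fun y ↦ α y (v i y)) x) = 0

end Total

end BundleFrobenius

end

open BundleFrobenius

noncomputable section

namespace BundleFrobenius

set_option linter.unusedSimpArgs false

section ParallelTransport

open Set Filter Topology Metric
open scoped ContDiff NNReal

section ODE

variable {F : Type*} [NormedAddCommGroup F] [NormedSpace ℝ F]

theorem norm_le_of_norm_deriv_le_half {u u' : ℝ → F} {ε : ℝ} (hε : 0 ≤ ε)
    (hu : ∀ t ∈ Icc (0 : ℝ) 1, HasDerivWithinAt u (u' t) (Icc 0 1) t) (h0 : u 0 = 0)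
    (bound : ∀ t ∈ Icc (0 : ℝ) 1, ‖u' t‖ ≤ 1 / 2 * ‖u t‖ + ε) :
    ∀ t ∈ Icc (0 : ℝ) 1, ‖u t‖ ≤ 2 * ε := by
  intro t ht
  have h1 := norm_le_gronwallBound_of_norm_deriv_right_le (f := u) (f' := u') (δ := 0)
    (K := 1 / 2) (ε := ε) (a := 0) (b := 1) (fun t ht ↦ (hu t ht).continuousWithinAt)
    (fun t ht ↦ (hu t ⟨ht.1, ht.2.le⟩).mono_of_mem_nhdsWithin (Icc_mem_nhdsGE_of_mem ht))
    (by simp [h0]) (fun t ht ↦ bound t ⟨ht.1, ht.2.le⟩) t ht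
  refine h1.trans ?_
  rw [gronwallBound_of_K_ne_0 (by norm_num)]
  have h2 : Real.exp (1 / 2 * (t - 0)) ≤ 2 := by
    have h3 : Real.exp (1 / 2 * (t - 0)) ≤ Real.exp (1 / 2) := by
      apply Real.exp_le_exp.2; linarith [ht.2]
    have h4 : Real.exp (1 / 2) ^ 2 ≤ 2 ^ 2 := by
      rw [← Real.exp_nat_mul]
      norm_num
      linarith [Real.exp_one_lt_d9]
    exact h3.trans ((pow_le_pow_iff_left₀ (Real.exp_pos _).le (by norm_num) two_ne_zero).1 h4)
  simp only [zero_mul, zero_add]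
  have : ε / (1 / 2) = 2 * ε := by ring
  rw [this]
  nlinarith

theorem norm_le_of_norm_deriv_le_half' {u u' : ℝ → F} {c : ℝ} (hc : ‖u 0‖ ≤ c)
    (hu : ∀ t ∈ Icc (0 : ℝ) 1, HasDerivWithinAt u (u' t) (Icc 0 1) t)
    (bound : ∀ t ∈ Icc (0 : ℝ) 1, ‖u' t‖ ≤ 1 / 2 * ‖u t‖) :
    ∀ t ∈ Icc (0 : ℝ) 1, ‖u t‖ ≤ 2 * c := by
  intro t ht
  have h1 := norm_le_of_norm_deriv_le_half (u := fun t ↦ u t - u 0) (u' := u') (ε := c / 2)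
    (by linarith [norm_nonneg (u 0)]) (fun t ht ↦ (hu t ht).sub_const _) (by simp)
    (fun t ht ↦ by
      have h2 : ‖u t‖ ≤ ‖u t - u 0‖ + ‖u 0‖ := by
        simpa using norm_add_le (u t - u 0) (u 0)
      have := bound t ht
      linarith) t ht
  have h2 : ‖u t‖ ≤ ‖u t - u 0‖ + ‖u 0‖ := by
    simpa using norm_add_le (u t - u 0) (u 0)
  linarith

theorem exists_linear_ode_solution [CompleteSpace F] (A : ℝ → F → F)
    (hA : ∀ y, ContinuousOn (fun t ↦ A t y) (Icc 0 1))
    (hsub : ∀ t ∈ Icc (0 : ℝ) 1, ∀ y z, A t y - A t z = A t (y - z))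
    (hA2 : ∀ t ∈ Icc (0 : ℝ) 1, ∀ y, ‖A t y‖ ≤ 1 / 2 * ‖y‖) (f₀ : F) :
    ∃ u : ℝ → F, u 0 = f₀ ∧ ∀ t ∈ Icc (0 : ℝ) 1, HasDerivWithinAt u (A t (u t)) (Icc 0 1) t := by
  let a : ℝ≥0 := ‖f₀‖₊ + 1
  have ha : (a : ℝ) = ‖f₀‖ + 1 := by simp [a]
  have hPL : IsPicardLindelof A (tmin := 0) (tmax := 1) ⟨0, by simp⟩ f₀ a 0 a (1 / 2) := by
    refine ⟨fun t ht ↦ ?_, fun y _ ↦ hA y, fun t ht y hy ↦ ?_, by simp⟩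
    · refine LipschitzOnWith.of_dist_le_mul fun y _ z _ ↦ ?_
      rw [dist_eq_norm, dist_eq_norm, hsub t ht]
      simpa using hA2 t ht (y - z)
    · refine (hA2 t ht y).trans ?_
      rw [mem_closedBall, dist_eq_norm] at hy
      have : ‖y‖ ≤ ‖y - f₀‖ + ‖f₀‖ := by simpa using norm_add_le (y - f₀) f₀
      rw [ha] at hy ⊢
      linarith
  obtain ⟨u, hu0, hu⟩ := hPL.exists_eq_forall_mem_Icc_hasDerivWithinAt₀
  exact ⟨u, hu0, hu⟩

end ODE


section Flat

set_option maxSynthPendingDepth 3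

variable {𝕜 : Type*} [RCLike 𝕜]
  {E : Type*} [NormedAddCommGroup E] [NormedSpace 𝕜 E]
  {F : Type*} [NormedAddCommGroup F] [NormedSpace 𝕜 F]

set_option maxHeartbeats 1000000 in
theorem hasFDerivAt_of_flat_radial [NormedSpace ℝ E] [IsScalarTower ℝ 𝕜 E]
    [NormedSpace ℝ F] [IsScalarTower ℝ 𝕜 F]
    {B : E → E →L[𝕜] F →L[𝕜] F} {B' : E → E →L[𝕜] E →L[𝕜] F →L[𝕜] F} {z₀ : E} {ρ C K : ℝ}
    (hρ1 : ρ ≤ 1) (hC0 : 0 ≤ C) (hCρ : C * ρ ≤ 1 / 2)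
    (hd : ∀ p ∈ ball z₀ ρ, HasFDerivAt B (B' p) p)
    (hB : ∀ p ∈ ball z₀ ρ, ‖B p‖ ≤ C) (hB' : ∀ p ∈ ball z₀ ρ, ‖B' p‖ ≤ C)
    (hL : ∀ p ∈ ball z₀ ρ, ∀ q ∈ ball z₀ ρ, ‖B' q - B' p‖ ≤ C * ‖q - p‖)
    (hflat : ∀ p ∈ ball z₀ ρ, ∀ h k : E, ∀ y : F,
      B' p h k y - B' p k h y + B p h (B p k y) - B p k (B p h y) = 0)
    {φ : E → ℝ → F} {f₀ : F} (hφ0 : ∀ z ∈ ball z₀ ρ, φ z 0 = f₀) (hK0 : 0 ≤ K)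
    (hK : ∀ z ∈ ball z₀ ρ, ∀ t ∈ Icc (0 : ℝ) 1, ‖φ z t‖ ≤ K)
    (hφ : ∀ z ∈ ball z₀ ρ, ∀ t ∈ Icc (0 : ℝ) 1,
      HasDerivWithinAt (φ z) (-(B (z₀ + t • (z - z₀)) (z - z₀) (φ z t))) (Icc 0 1) t)
    {z : E} (hz : z ∈ ball z₀ ρ) :
    HasFDerivAt (fun z ↦ φ z 1) (-(B z).flip (φ z 1)) z := by
  have hmem : ∀ z ∈ ball z₀ ρ, ∀ t ∈ Icc (0 : ℝ) 1, z₀ + t • (z - z₀) ∈ ball z₀ ρ := by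
    intro z hz t ht
    rw [mem_ball, dist_eq_norm] at hz ⊢
    rw [add_sub_cancel_left, norm_smul, Real.norm_of_nonneg ht.1]
    nlinarith [norm_nonneg (z - z₀), ht.2]
  have hnorm : ∀ z ∈ ball z₀ ρ, ‖z - z₀‖ ≤ ρ := fun z hz ↦ by
    rw [mem_ball, dist_eq_norm] at hz; exact hz.le
  have hBlip : ∀ p ∈ ball z₀ ρ, ∀ q ∈ ball z₀ ρ, ‖B q - B p‖ ≤ C * ‖q - p‖ :=
    fun p hp q hq ↦ (convex_ball z₀ ρ).norm_image_sub_le_of_norm_hasFDerivWithin_le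
      (fun x hx ↦ (hd x hx).hasFDerivWithinAt) hB' hp hq
  have hTay : ∀ p ∈ ball z₀ ρ, ∀ q ∈ ball z₀ ρ,
      ‖B q - B p - B' p (q - p)‖ ≤ C * ‖q - p‖ * ‖q - p‖ := by
    intro p hp q hq
    have hseg : segment ℝ p q ⊆ ball z₀ ρ := (convex_ball z₀ ρ).segment_subset hp hq
    refine (convex_segment p q).norm_image_sub_le_of_norm_hasFDerivWithin_le'
      (fun x hx ↦ (hd x (hseg hx)).hasFDerivWithinAt) (fun x hx ↦ ?_)
      (left_mem_segment ℝ p q) (right_mem_segment ℝ p q)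
    refine (hL p hp x (hseg hx)).trans ?_
    gcongr
    rw [← dist_eq_norm, ← dist_eq_norm]
    obtain ⟨a, b, ha, hb, hab, rfl⟩ := hx
    have : a • p + b • q - p = b • (q - p) := by
      rw [eq_sub_of_add_eq hab]; module
    rw [dist_eq_norm, dist_eq_norm, this, norm_smul, Real.norm_of_nonneg hb]
    nlinarith [norm_nonneg (q - p)]
  set M : ℝ := 2 * (2 * (C * K) + 8 * (C * C * K)) with hM
  have hM0 : 0 ≤ M := by positivity
  have key : ∀ w ∈ ball z₀ ρ, ‖φ w 1 - φ z 1 + B z (w - z) (φ z 1)‖ ≤ M * ‖w - z‖ ^ 2 := by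
    intro w hw
    set x := z - z₀ with hx
    set h := w - z with hh
    have hxh : w - z₀ = x + h := by rw [hx, hh]; abel
    have hφw := hφ w hw
    have hφz := hφ z hz
    rw [hxh] at hφw
    have hpm : ∀ t ∈ Icc (0 : ℝ) 1, z₀ + t • x ∈ ball z₀ ρ := hmem z hz
    have hqm : ∀ t ∈ Icc (0 : ℝ) 1, z₀ + t • (x + h) ∈ ball z₀ ρ := by
      rw [← hxh]; exact hmem w hw
    have hnx : ‖x‖ ≤ ρ := hnorm z hz
    have hnxh : ‖x + h‖ ≤ ρ := by rw [← hxh]; exact hnorm w hw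
    have hqp : ∀ t : ℝ, z₀ + t • (x + h) - (z₀ + t • x) = t • h := by
      intro t; rw [smul_add]; abel
    have hth : ∀ t ∈ Icc (0 : ℝ) 1, ‖t • h‖ ≤ ‖h‖ := by
      intro t ht
      rw [norm_smul, Real.norm_of_nonneg ht.1]
      nlinarith [norm_nonneg h, ht.2]
    have hhalf : ∀ t ∈ Icc (0 : ℝ) 1, ∀ y : F, ‖B (z₀ + t • x) x y‖ ≤ 1 / 2 * ‖y‖ := by
      intro t ht y
      refine ((B (z₀ + t • x)).le_opNorm₂ x y).trans ?_
      gcongr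
      refine le_trans ?_ hCρ
      exact mul_le_mul (hB _ (hpm t ht)) hnx (norm_nonneg _) hC0
    have hρ0 : 0 ≤ ρ := (norm_nonneg _).trans hnx
    have e1 : ∀ t ∈ Icc (0 : ℝ) 1, ‖φ w t - φ z t‖ ≤ 2 * (2 * (C * K) * ‖h‖) := by
      apply norm_le_of_norm_deriv_le_half (by positivity)
        (fun t ht ↦ (hφw t ht).sub (hφz t ht)) (by simp [hφ0 w hw, hφ0 z hz])
      intro t ht
      set p := z₀ + t • x
      set q := z₀ + t • (x + h)
      have : -(B q (x + h) (φ w t)) - -(B p x (φ z t)) = -(B p x (φ w t - φ z t))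
          - (B q - B p) (x + h) (φ w t) - B p h (φ w t) := by
        simp only [map_add, map_sub, add_apply, sub_apply]
        abel
      rw [this]
      have n1 := hhalf t ht (φ w t - φ z t)
      have n2 : ‖(B q - B p) (x + h) (φ w t)‖ ≤ (C * ‖h‖) * 1 * K := by
        refine ((B q - B p).le_opNorm₂ _ _).trans ?_
        gcongr
        · refine (hBlip p (hpm t ht) q (hqm t ht)).trans ?_
          rw [hqp]; gcongr; exact hth t ht
        · exact hnxh.trans hρ1
        · exact hK w hw t ht
      have n3 : ‖B p h (φ w t)‖ ≤ C * ‖h‖ * K := by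
        refine ((B p).le_opNorm₂ _ _).trans ?_
        gcongr
        · exact hB p (hpm t ht)
        · exact hK w hw t ht
      have n4 := norm_sub_le (-(B p x (φ w t - φ z t)) - (B q - B p) (x + h) (φ w t))
        (B p h (φ w t))
      have n5 := norm_sub_le (-(B p x (φ w t - φ z t))) ((B q - B p) (x + h) (φ w t))
      rw [norm_neg] at n5
      simp only [Pi.sub_apply]
      linarith
    have hcorr : ∀ t ∈ Icc (0 : ℝ) 1, HasDerivWithinAt
        (fun t : ℝ ↦ t • B (z₀ + t • x) h (φ z t))
        (t • (B' (z₀ + t • x) x h (φ z t) - B (z₀ + t • x) h (B (z₀ + t • x) x (φ z t)))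
          + B (z₀ + t • x) h (φ z t)) (Icc 0 1) t := by
      intro t ht
      have c1 : HasDerivAt (fun t : ℝ ↦ z₀ + t • x) x t := by
        simpa using ((hasDerivAt_id t).smul_const x).const_add z₀
      have c2 : HasFDerivAt B ((B' (z₀ + t • x)).restrictScalars ℝ) (z₀ + t • x) :=
        (hd _ (hpm t ht)).restrictScalars ℝ
      have c3 := (c2.comp_hasDerivAt t c1).hasDerivWithinAt (s := Icc 0 1)
      have c4 : HasFDerivAt (fun A : E →L[𝕜] F →L[𝕜] F ↦ A h)
          ((ContinuousLinearMap.apply 𝕜 (F →L[𝕜] F) h).restrictScalars ℝ) (B (z₀ + t • x)) :=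
        (ContinuousLinearMap.apply 𝕜 (F →L[𝕜] F) h).hasFDerivAt.restrictScalars ℝ
      have c5 := c4.comp_hasDerivWithinAt t c3
      have c6 := ((isBoundedBilinearMap_apply (𝕜 := 𝕜) (E := F) (F := F)).hasFDerivAt
        (B (z₀ + t • x) h, φ z t)).restrictScalars ℝ
      have c7 := HasFDerivAt.comp_hasDerivWithinAt (f := fun t : ℝ ↦ (B (z₀ + t • x) h, φ z t)) t c6
        (c5.prodMk (hφz t ht))
      have c8 := (hasDerivAt_id t).hasDerivWithinAt (s := Icc 0 1).smul c7
      refine HasDerivWithinAt.congr_deriv c8 ?_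
      change t • (B (z₀ + t • x) h (-(B (z₀ + t • x) x (φ z t))) + B' (z₀ + t • x) x h (φ z t))
        + (1 : ℝ) • (B (z₀ + t • x) h (φ z t)) = _
      rw [map_neg, one_smul, sub_eq_add_neg, add_comm (-(B (z₀ + t • x) h _))]
    have e2 := norm_le_of_norm_deriv_le_half (ε := (2 * (C * K) + 8 * (C * C * K)) * ‖h‖ ^ 2)
      (by positivity) (fun t ht ↦ ((hφw t ht).sub (hφz t ht)).add (hcorr t ht))
      (by simp [hφ0 w hw, hφ0 z hz]) (fun t ht ↦ by
        simp only [Pi.add_apply, Pi.sub_apply]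
        set p := z₀ + t • x
        set q := z₀ + t • (x + h)
        set χ := φ w t - φ z t + t • B p h (φ z t) with hχ
        have hfl : B' p x h (φ z t) = B' p h x (φ z t) - B p x (B p h (φ z t))
            + B p h (B p x (φ z t)) := by
          have := hflat p (hpm t ht) x h (φ z t)
          rw [← sub_eq_zero, ← this]; abel
        have hsm : ∀ y, B' p (t • h) (x + h) y = t • B' p h (x + h) y := by
          intro y
          rw [← algebraMap_smul 𝕜 t h, map_smul]
          simp
        have id1 : -(B q (x + h) (φ w t)) - -(B p x (φ z t))
            + (t • (B' p x h (φ z t) - B p h (B p x (φ z t))) + B p h (φ z t))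
            = -(B p x χ) - (B q - B p - B' p (t • h)) (x + h) (φ w t)
              - B p h (φ w t - φ z t) - t • B' p h h (φ w t)
              - t • B' p h x (φ w t - φ z t) := by
          have hsm2 : B p x (t • B p h (φ z t)) = t • B p x (B p h (φ z t)) := by
            rw [← algebraMap_smul 𝕜 t, map_smul]
            simp
          rw [hfl, hχ]
          rw [sub_apply, sub_apply, sub_apply, sub_apply, hsm]
          simp only [map_add, map_sub, add_apply, smul_add, smul_sub, hsm2]
          abel
        rw [id1]
        have n1 := hhalf t ht χ
        have n2 : ‖(B q - B p - B' p (t • h)) (x + h) (φ w t)‖ ≤ (C * ‖h‖ * ‖h‖) * 1 * K := by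
          refine ((B q - B p - B' p (t • h)).le_opNorm₂ _ _).trans ?_
          have := hTay p (hpm t ht) q (hqm t ht)
          rw [hqp] at this
          gcongr
          · refine this.trans ?_
            gcongr <;> exact hth t ht
          · exact hnxh.trans hρ1
          · exact hK w hw t ht
        have n3 : ‖B p h (φ w t - φ z t)‖ ≤ C * ‖h‖ * (2 * (2 * (C * K) * ‖h‖)) := by
          refine ((B p).le_opNorm₂ _ _).trans ?_
          gcongr
          · exact hB p (hpm t ht)
          · exact e1 t ht
        have ht1 : ∀ y : F, ‖t • y‖ ≤ ‖y‖ := by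
          intro y
          rw [norm_smul, Real.norm_of_nonneg ht.1]
          nlinarith [norm_nonneg y, ht.2]
        have n4 : ‖t • B' p h h (φ w t)‖ ≤ C * ‖h‖ * ‖h‖ * K := by
          refine (ht1 _).trans (((B' p h).le_opNorm₂ _ _).trans ?_)
          gcongr
          · exact ((B' p).le_opNorm h).trans (by gcongr; exact hB' p (hpm t ht))
          · exact hK w hw t ht
        have n5 : ‖t • B' p h x (φ w t - φ z t)‖ ≤
            C * ‖h‖ * 1 * (2 * (2 * (C * K) * ‖h‖)) := by
          refine (ht1 _).trans (((B' p h).le_opNorm₂ _ _).trans ?_)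
          gcongr
          · exact ((B' p).le_opNorm h).trans (by gcongr; exact hB' p (hpm t ht))
          · exact hnx.trans hρ1
          · exact e1 t ht
        refine (norm_sub_le _ _).trans ?_
        have m1 := norm_sub_le (-(B p x χ) - (B q - B p - B' p (t • h)) (x + h) (φ w t)
              - B p h (φ w t - φ z t)) (t • B' p h h (φ w t))
        have m2 := norm_sub_le (-(B p x χ) - (B q - B p - B' p (t • h)) (x + h) (φ w t))
          (B p h (φ w t - φ z t))
        have m3 := norm_sub_le (-(B p x χ)) ((B q - B p - B' p (t • h)) (x + h) (φ w t))
        rw [norm_neg] at m3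
        linarith) 1 (by simp)
    have hz1 : z₀ + (1 : ℝ) • x = z := by rw [one_smul, hx]; abel
    simp only [Pi.add_apply, Pi.sub_apply, hz1] at e2
    rw [one_smul] at e2
    refine e2.trans (le_of_eq ?_)
    rw [hM]; ring
  rw [hasFDerivAt_iff_isLittleO]
  have hO : (fun w ↦ φ w 1 - φ z 1 - (-(B z).flip (φ z 1)) (w - z)) =O[𝓝 z]
      fun w ↦ ‖w - z‖ ^ 2 := by
    refine Asymptotics.IsBigO.of_bound M ?_
    filter_upwards [isOpen_ball.mem_nhds hz] with w hw
    have := key w hw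
    rw [neg_apply, ContinuousLinearMap.flip_apply, sub_neg_eq_add]
    simpa only [norm_pow, norm_norm] using this
  refine hO.trans_isLittleO ?_
  have := Asymptotics.isLittleO_norm_pow_id (E' := E) (n := 2) one_lt_two
  have h2 : Tendsto (fun w ↦ w - z) (𝓝 z) (𝓝 0) := by
    simpa using (continuous_id.sub continuous_const).tendsto z (f := fun w : E ↦ w - z)
  exact this.comp_tendsto h2

theorem contDiffOn_of_hasFDerivAt_flip {B : E → E →L[𝕜] F →L[𝕜] F} {O : Set E} (hO : IsOpen O)
    (hB : ContDiffOn 𝕜 ∞ B O) {f : E → F} (hf : ∀ z ∈ O, HasFDerivAt f (-(B z).flip (f z)) z) :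
    ContDiffOn 𝕜 ∞ f O := by
  have hn : ∀ n : ℕ, ContDiffOn 𝕜 n f O := by
    intro n
    induction n with
    | zero => exact contDiffOn_zero.2 fun z hz ↦ (hf z hz).continuousAt.continuousWithinAt
    | succ n ih =>
      rw [Nat.cast_add, Nat.cast_one, contDiffOn_succ_iff_fderiv_of_isOpen hO]
      refine ⟨fun z hz ↦ (hf z hz).differentiableAt.differentiableWithinAt, by simp, ?_⟩
      have h1 : ContDiffOn 𝕜 n (fun z ↦ -(B z).flip (f z)) O := by
        have h2 : ContDiffOn 𝕜 n (fun z ↦ (B z).flip) O :=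
          (ContinuousLinearMap.flipₗᵢ 𝕜 E F F).contDiff.comp_contDiffOn
            (hB.of_le (mod_cast le_top))
        exact (h2.clm_apply ih).neg
      exact h1.congr fun z hz ↦ (hf z hz).fderiv
  exact contDiffOn_infty.2 hn

/-- A flat connection form `B` on an open subset of a vector space has local parallel sections
with any prescribed value. -/
theorem exists_parallel_of_flat [CompleteSpace F]
    {B : E → E →L[𝕜] F →L[𝕜] F} {O : Set E} (hO : IsOpen O) (hB : ContDiffOn 𝕜 ∞ B O)
    (hflat : ∀ p ∈ O, ∀ h k : E, ∀ y : F,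
      fderiv 𝕜 B p h k y - fderiv 𝕜 B p k h y + B p h (B p k y) - B p k (B p h y) = 0)
    {z₀ : E} (hz₀ : z₀ ∈ O) (f₀ : F) :
    ∃ W, IsOpen W ∧ z₀ ∈ W ∧ W ⊆ O ∧ ∃ f : E → F, ContDiffOn 𝕜 ∞ f W ∧ f z₀ = f₀ ∧
      ∀ z ∈ W, HasFDerivAt f (-(B z).flip (f z)) z := by
  let _ : NormedSpace ℝ E := NormedSpace.restrictScalars ℝ 𝕜 E
  let _ : NormedSpace ℝ F := NormedSpace.restrictScalars ℝ 𝕜 F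
  have _ : IsScalarTower ℝ 𝕜 E := RestrictScalars.isScalarTower ℝ 𝕜 E
  have _ : IsScalarTower ℝ 𝕜 F := RestrictScalars.isScalarTower ℝ 𝕜 F
  have hBz := (hB z₀ hz₀).contDiffAt (hO.mem_nhds hz₀)
  have hB'z : ContDiffAt 𝕜 1 (fderiv 𝕜 B) z₀ := hBz.fderiv_right (m := 1) (by norm_cast)
  obtain ⟨L, s, hs, hL⟩ := hB'z.exists_lipschitzOnWith
  set C : ℝ := max (max (‖B z₀‖ + 1) (‖fderiv 𝕜 B z₀‖ + 1)) L with hC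
  have hC1 : 1 ≤ C := by
    have : ‖B z₀‖ + 1 ≤ C := (le_max_left _ _).trans (le_max_left _ _)
    linarith [norm_nonneg (B z₀)]
  have ev1 : ∀ᶠ p in 𝓝 z₀, ‖B p‖ < ‖B z₀‖ + 1 :=
    hBz.continuousAt.norm.eventually (gt_mem_nhds (by linarith))
  have ev2 : ∀ᶠ p in 𝓝 z₀, ‖fderiv 𝕜 B p‖ < ‖fderiv 𝕜 B z₀‖ + 1 :=
    hB'z.continuousAt.norm.eventually (gt_mem_nhds (by linarith))
  obtain ⟨r, hr, hball⟩ := Metric.eventually_nhds_iff_ball.1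
    ((ev1.and ev2).and ((hO.eventually_mem hz₀).and hs))
  set ρ : ℝ := min (min r 1) (1 / (2 * C)) with hρ
  have hρ0 : 0 < ρ := by positivity
  have hρr : ball z₀ ρ ⊆ ball z₀ r := ball_subset_ball ((min_le_left _ _).trans (min_le_left _ _))
  have hρ1 : ρ ≤ 1 := (min_le_left _ _).trans (min_le_right _ _)
  have hCρ : C * ρ ≤ 1 / 2 := by
    calc C * ρ ≤ C * (1 / (2 * C)) := by gcongr; exact min_le_right _ _
      _ = 1 / 2 := by field_simp
  have hWO : ball z₀ ρ ⊆ O := fun p hp ↦ (hball p (hρr hp)).2.1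
  have hB1 : ∀ p ∈ ball z₀ ρ, ‖B p‖ ≤ C := fun p hp ↦
    (hball p (hρr hp)).1.1.le.trans ((le_max_left _ _).trans (le_max_left _ _))
  have hB2 : ∀ p ∈ ball z₀ ρ, ‖fderiv 𝕜 B p‖ ≤ C := fun p hp ↦
    (hball p (hρr hp)).1.2.le.trans ((le_max_right _ _).trans (le_max_left _ _))
  have hB3 : ∀ p ∈ ball z₀ ρ, ∀ q ∈ ball z₀ ρ, ‖fderiv 𝕜 B q - fderiv 𝕜 B p‖ ≤ C * ‖q - p‖ := by
    intro p hp q hq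
    refine (hL.norm_sub_le (hball q (hρr hq)).2.2 (hball p (hρr hp)).2.2).trans ?_
    gcongr
    exact le_max_right _ _
  have hd : ∀ p ∈ ball z₀ ρ, HasFDerivAt B (fderiv 𝕜 B p) p := fun p hp ↦
    (((hB p (hWO hp)).contDiffAt (hO.mem_nhds (hWO hp))).differentiableAt (by simp)).hasFDerivAt
  have hmem : ∀ z ∈ ball z₀ ρ, ∀ t ∈ Icc (0 : ℝ) 1, z₀ + t • (z - z₀) ∈ ball z₀ ρ := by
    intro z hz t ht
    rw [mem_ball, dist_eq_norm] at hz ⊢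
    rw [add_sub_cancel_left, norm_smul, Real.norm_of_nonneg ht.1]
    nlinarith [norm_nonneg (z - z₀), ht.2]
  have hhalf : ∀ z ∈ ball z₀ ρ, ∀ t ∈ Icc (0 : ℝ) 1, ∀ y : F,
      ‖-(B (z₀ + t • (z - z₀)) (z - z₀) y)‖ ≤ 1 / 2 * ‖y‖ := by
    intro z hz t ht y
    rw [norm_neg]
    refine ((B (z₀ + t • (z - z₀))).le_opNorm₂ _ y).trans ?_
    gcongr
    refine le_trans ?_ hCρ
    have : ‖z - z₀‖ ≤ ρ := by rw [mem_ball, dist_eq_norm] at hz; exact hz.le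
    exact mul_le_mul (hB1 _ (hmem z hz t ht)) this (norm_nonneg _) (by linarith)
  have hsol : ∀ z ∈ ball z₀ ρ, ∃ u : ℝ → F, u 0 = f₀ ∧ ∀ t ∈ Icc (0 : ℝ) 1,
      HasDerivWithinAt u (-(B (z₀ + t • (z - z₀)) (z - z₀) (u t))) (Icc 0 1) t := by
    intro z hz
    refine exists_linear_ode_solution (fun t y ↦ -(B (z₀ + t • (z - z₀)) (z - z₀) y))
      (fun y ↦ ?_) (fun t _ y y' ↦ ?_) (hhalf z hz) f₀
    · have h1 : ContinuousOn (fun t : ℝ ↦ B (z₀ + t • (z - z₀))) (Icc 0 1) :=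
        hB.continuousOn.comp (by fun_prop) (fun t ht ↦ hWO (hmem z hz t ht))
      exact ((h1.clm_apply continuousOn_const).clm_apply continuousOn_const).neg
    · simp only [map_sub]; abel
  choose! φ hφ0 hφ using hsol
  have hφz₀ : φ z₀ 1 = f₀ := by
    have h0 := norm_le_of_norm_deriv_le_half' (u := fun t ↦ φ z₀ t - f₀) (c := 0)
      (u' := fun t ↦ -(B (z₀ + t • (z₀ - z₀)) (z₀ - z₀) (φ z₀ t)))
      (by simp [hφ0 z₀ (mem_ball_self hρ0)])
      (fun t ht ↦ (hφ z₀ (mem_ball_self hρ0) t ht).sub_const _)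
      (fun t ht ↦ by simp) 1 (by simp)
    rw [mul_zero, norm_le_zero_iff, sub_eq_zero] at h0
    exact h0
  have hfd : ∀ z ∈ ball z₀ ρ, HasFDerivAt (fun z ↦ φ z 1) (-(B z).flip (φ z 1)) z := by
    intro z hz
    refine hasFDerivAt_of_flat_radial (K := 2 * ‖f₀‖) hρ1 (by linarith) hCρ hd hB1 hB2 hB3
      (fun p hp ↦ hflat p (hWO hp)) hφ0 (by positivity) (fun z hz ↦ ?_) hφ hz
    exact norm_le_of_norm_deriv_le_half' (by rw [hφ0 z hz]) (hφ z hz)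
      (fun t ht ↦ hhalf z hz t ht _)
  exact ⟨ball z₀ ρ, isOpen_ball, mem_ball_self hρ0, hWO, fun z ↦ φ z 1,
    contDiffOn_of_hasFDerivAt_flip isOpen_ball (hB.mono hWO) hfd, hφz₀, hfd⟩

end Flat

end ParallelTransport

section Geometry

open Bundle Set Filter Topology VectorField
open scoped Manifold ContDiff

section VectorFields

set_option maxSynthPendingDepth 3

variable {𝕜 : Type*} [RCLike 𝕜]
  {E : Type*} [NormedAddCommGroup E] [NormedSpace 𝕜 E]
  {H : Type*} [TopologicalSpace H] {I : ModelWithCorners 𝕜 E H} [I.Boundaryless]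
  {N : Type*} [TopologicalSpace N] [ChartedSpace H N] [IsManifold I ∞ N]
  {G : Type*} [NormedAddCommGroup G] [NormedSpace 𝕜 G]

theorem mvfderiv_congr {f g : N → G} {x : N} (h : f =ᶠ[𝓝 x] g) (u : TangentSpace I x) :
    mvfderiv I f x u = mvfderiv I g x u := by
  change mfderiv I 𝓘(𝕜, G) f x u = mfderiv I 𝓘(𝕜, G) g x u
  rw [h.mfderiv_eq]; rfl

theorem mvfderiv_eq_fderiv_extChartAt {f : N → G} {x y : N} (hy : y ∈ (extChartAt I x).source)
    (hf : MDifferentiableAt I 𝓘(𝕜, G) f y) (u : TangentSpace I y) :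
    mvfderiv I f y u = fderiv 𝕜 (f ∘ (extChartAt I x).symm) (extChartAt I x y)
      (mvfderiv I (extChartAt I x) y u) := by
  have _ : IsManifold I 1 N := .of_le (n := ∞) (by norm_cast)
  have hyt : extChartAt I x y ∈ (extChartAt I x).target := (extChartAt I x).map_source hy
  have hφ : MDifferentiableAt I 𝓘(𝕜, E) (extChartAt I x) y :=
    mdifferentiableAt_extChartAt (by simpa using hy)
  have hsymm : MDifferentiableAt 𝓘(𝕜, E) I (extChartAt I x).symm (extChartAt I x y) := by
    have := mdifferentiableWithinAt_extChartAt_symm (I := I) hyt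
    rwa [I.range_eq_univ, mdifferentiableWithinAt_univ] at this
  have hg : MDifferentiableAt 𝓘(𝕜, E) 𝓘(𝕜, G) (f ∘ (extChartAt I x).symm) (extChartAt I x y) := by
    refine MDifferentiableAt.comp (I' := I) _ ?_ hsymm
    rwa [(extChartAt I x).left_inv hy]
  have heq : f =ᶠ[𝓝 y] (f ∘ (extChartAt I x).symm) ∘ (extChartAt I x) := by
    filter_upwards [(isOpen_extChartAt_source x).mem_nhds hy] with z hz
    rw [Function.comp_apply, Function.comp_apply, (extChartAt I x).left_inv hz]
  rw [mvfderiv_congr heq]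
  change mfderiv I 𝓘(𝕜, G) ((f ∘ (extChartAt I x).symm) ∘ (extChartAt I x)) y u = _
  rw [mfderiv_comp y hg hφ, mfderiv_eq_fderiv]
  rfl

theorem mpullbackWithin_extChartAt_symm {x : N} (X : Π y : N, TangentSpace I y) {z : E}
    (hz : z ∈ (extChartAt I x).target) :
    mpullbackWithin 𝓘(𝕜, E) I (extChartAt I x).symm X (range I) z =
      mvfderiv I (extChartAt I x) ((extChartAt I x).symm z) (X ((extChartAt I x).symm z)) := by
  have _ : IsManifold I 1 N := .of_le (n := ∞) (by norm_cast)
  have hinv := isInvertible_mfderivWithin_extChartAt_symm (I := I) hz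
  have h1 := mfderiv_extChartAt_comp_mfderivWithin_extChartAt_symm (I := I) hz
  rw [mpullbackWithin_apply]
  set A := mfderivWithin 𝓘(𝕜, E) I (extChartAt I x).symm (range I) z
  have h2 := congrArg (fun L ↦ L (A.inverse (X ((extChartAt I x).symm z)))) h1
  have h3 := hinv.self_apply_inverse (X ((extChartAt I x).symm z))
  change mfderiv I 𝓘(𝕜, E) (extChartAt I x) ((extChartAt I x).symm z)
    (A (A.inverse (X ((extChartAt I x).symm z)))) = A.inverse (X ((extChartAt I x).symm z)) at h2
  rw [h3] at h2
  exact h2.symm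

theorem contMDiffAt_vectorField_iff {n : ℕ∞} {Z : Π y : N, TangentSpace I y} {x x₀ : N}
    (hx : x ∈ (extChartAt I x₀).source) :
    ContMDiffAt I (I.prod 𝓘(𝕜, E)) n (fun y ↦ TotalSpace.mk' E y (Z y)) x ↔
      ContMDiffAt I 𝓘(𝕜, E) n (fun y ↦ mvfderiv I (extChartAt I x₀) y (Z y)) x := by
  have _ : IsManifold I 1 N := .of_le (n := ∞) (by norm_cast)
  have _ : IsManifold I (n + 1) N := .of_le (n := ∞) (by norm_cast; exact le_top)
  have _ : ContMDiffVectorBundle n E (TangentSpace I : N → Type _) I := inferInstance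
  have hx' : x ∈ (chartAt H x₀).source := by simpa using hx
  rw [Trivialization.contMDiffAt_section_iff (trivializationAt E (TangentSpace I) x₀)
    (by simpa using hx')]
  apply Filter.EventuallyEq.contMDiffAt_iff
  filter_upwards [(isOpen_extChartAt_source (I := I) x₀).mem_nhds hx] with y hy
  have hy' : y ∈ (chartAt H x₀).source := by simpa using hy
  have h1 := TangentBundle.continuousLinearMapAt_trivializationAt (I := I) hy'
  have h2 := congrArg (fun L ↦ L (Z y)) h1
  simp only [Trivialization.continuousLinearMapAt_apply] at h2
  rw [Trivialization.coe_linearMapAt_of_mem _ (by simpa using hy')] at h2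
  exact h2

theorem contDiffAt_comp_extChartAt_symm {n : ℕ∞ω} {f : N → G} {x : N} (hn : n ≤ ∞)
    (hf : ContMDiffAt I 𝓘(𝕜, G) n f x) :
    ContDiffAt 𝕜 n (f ∘ (extChartAt I x).symm) (extChartAt I x x) := by
  have _ : IsManifold I n N := .of_le hn
  rw [← contMDiffAt_iff_contDiffAt]
  have h1 : ContMDiffAt 𝓘(𝕜, E) I n (extChartAt I x).symm (extChartAt I x x) := by
    have := contMDiffOn_extChartAt_symm (I := I) (n := n) x
    refine this.contMDiffAt (extChartAt_target_mem_nhds x)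
  refine ContMDiffAt.comp (I' := I) _ ?_ h1
  rwa [(extChartAt I x).left_inv (mem_extChartAt_source x)]

theorem contMDiffAt_mvfderiv_apply {f : N → G} {X : Π y : N, TangentSpace I y} {x : N}
    (hf : ContMDiffAt I 𝓘(𝕜, G) ∞ f x)
    (hX : ContMDiffAt I (I.prod 𝓘(𝕜, E)) ∞ (fun y ↦ TotalSpace.mk' E y (X y)) x) :
    ContMDiffAt I 𝓘(𝕜, G) ∞ (fun y ↦ mvfderiv I f y (X y)) x := by
  have hX' := (contMDiffAt_vectorField_iff (mem_extChartAt_source x)).1 hX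
  have h1 : ContDiffAt 𝕜 ∞ (fderiv 𝕜 (f ∘ (extChartAt I x).symm)) (extChartAt I x x) :=
    (contDiffAt_comp_extChartAt_symm le_rfl hf).fderiv_right (by norm_cast)
  have h2 : ContMDiffAt I 𝓘(𝕜, E →L[𝕜] G) ∞
      (fun y ↦ fderiv 𝕜 (f ∘ (extChartAt I x).symm) (extChartAt I x y)) x :=
    h1.contMDiffAt.comp (I' := 𝓘(𝕜, E)) x contMDiffAt_extChartAt
  refine (h2.clm_apply hX').congr_of_eventuallyEq ?_
  have h3 : ∀ᶠ y in 𝓝 x, ContMDiffAt I 𝓘(𝕜, G) 1 f y :=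
    (contMDiffAt_iff_contMDiffAt_nhds (by simp)).1 (hf.of_le (by norm_cast))
  filter_upwards [h3, (isOpen_extChartAt_source (I := I) x).mem_nhds (mem_extChartAt_source x)]
    with y hy hys
  exact mvfderiv_eq_fderiv_extChartAt hys (hy.mdifferentiableAt one_ne_zero) _

/-- The derivative along a Lie bracket is the commutator of derivatives. -/
theorem mvfderiv_mlieBracket [CompleteSpace E] {f : N → G} {X Y : Π y : N, TangentSpace I y} {x : N}
    (hf : ContMDiffAt I 𝓘(𝕜, G) 2 f x)
    (hX : MDifferentiableAt I (I.prod 𝓘(𝕜, E)) (fun y ↦ TotalSpace.mk' E y (X y)) x)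
    (hY : MDifferentiableAt I (I.prod 𝓘(𝕜, E)) (fun y ↦ TotalSpace.mk' E y (Y y)) x) :
    mvfderiv I f x (mlieBracket I X Y x) =
      mvfderiv I (fun y ↦ mvfderiv I f y (Y y)) x (X x)
        - mvfderiv I (fun y ↦ mvfderiv I f y (X y)) x (Y x) := by
  have _ : IsManifold I 1 N := .of_le (n := ∞) (by norm_cast)
  have _ : IsManifold I 2 N := .of_le (n := ∞) (by norm_cast)
  set φ := extChartAt I x with hφ
  set f' := f ∘ φ.symm with hf'
  have hxs : x ∈ φ.source := mem_extChartAt_source x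
  have hxt : φ x ∈ φ.target := φ.map_source hxs
  have hft : ContDiffAt 𝕜 2 f' (φ x) :=
    contDiffAt_comp_extChartAt_symm (by norm_cast) hf
  have ev : ∀ᶠ y in 𝓝 x, ContMDiffAt I 𝓘(𝕜, G) 1 f y :=
    (contMDiffAt_iff_contMDiffAt_nhds (by simp)).1 (hf.of_le (by norm_cast))
  have hxx : φ.symm (φ x) = x := φ.left_inv hxs
  have ev' : ∀ᶠ z in 𝓝 (φ x), ContMDiffAt I 𝓘(𝕜, G) 1 f (φ.symm z) := by
    have h := continuousAt_extChartAt_symm (I := I) x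
    rw [ContinuousAt, ← hφ, hxx] at h
    exact h.eventually ev
  set X' : E → E := mpullbackWithin 𝓘(𝕜, E) I φ.symm X (range I) with hX'
  set Y' : E → E := mpullbackWithin 𝓘(𝕜, E) I φ.symm Y (range I) with hY'
  have dX : ∀ Z : Π y : N, TangentSpace I y,
      MDifferentiableAt I (I.prod 𝓘(𝕜, E)) (fun y ↦ TotalSpace.mk' E y (Z y)) x →
      DifferentiableAt 𝕜 (mpullbackWithin 𝓘(𝕜, E) I φ.symm Z (range I) : E → E) (φ x) := by
    intro Z hZ
    have := (mdifferentiableWithinAt_univ.2 hZ).differentiableWithinAt_mpullbackWithin_vectorField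
    rw [I.range_eq_univ] at this
    rw [I.range_eq_univ]
    rw [preimage_univ, univ_inter] at this
    exact differentiableWithinAt_univ.1 this
  have hcomp : ∀ Z : Π y : N, TangentSpace I y,
      MDifferentiableAt I (I.prod 𝓘(𝕜, E)) (fun y ↦ TotalSpace.mk' E y (Z y)) x → ∀ u,
      mvfderiv I (fun y ↦ mvfderiv I f y (Z y)) x u =
        fderiv 𝕜 (fun z ↦ fderiv 𝕜 f' z
          ((mpullbackWithin 𝓘(𝕜, E) I φ.symm Z (range I) : E → E) z)) (φ x)
          (mvfderiv I φ x u) := by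
    intro Z hZ u
    have hev : (fun y ↦ mvfderiv I f y (Z y)) ∘ φ.symm =ᶠ[𝓝 (φ x)] fun z ↦ fderiv 𝕜 f' z
        ((mpullbackWithin 𝓘(𝕜, E) I φ.symm Z (range I) : E → E) z) := by
      filter_upwards [ev', extChartAt_target_mem_nhds (I := I) x] with z hz hzt
      have h1 := mvfderiv_eq_fderiv_extChartAt (I := I) (φ.map_target hzt)
        (hz.mdifferentiableAt one_ne_zero) (Z (φ.symm z))
      rw [← hφ, φ.right_inv hzt] at h1
      have h2 := mpullbackWithin_extChartAt_symm (I := I) (x := x) Z hzt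
      simp only [Function.comp_apply]
      rw [h1]
      congr 1
      exact h2.symm
    have hdiff : DifferentiableAt 𝕜 ((fun y ↦ mvfderiv I f y (Z y)) ∘ φ.symm) (φ x) := by
      refine DifferentiableAt.congr_of_eventuallyEq ?_ hev
      have := (hft.fderiv_right (m := 1) (by norm_cast)).differentiableAt one_ne_zero
      exact this.clm_apply (dX Z hZ)
    have hmd : MDifferentiableAt I 𝓘(𝕜, G) (fun y ↦ mvfderiv I f y (Z y)) x := by
      have h1 : MDifferentiableAt I 𝓘(𝕜, G)
          (((fun y ↦ mvfderiv I f y (Z y)) ∘ φ.symm) ∘ φ) x :=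
        hdiff.mdifferentiableAt.comp x (mdifferentiableAt_extChartAt (by simp))
      refine h1.congr_of_eventuallyEq ?_
      filter_upwards [(isOpen_extChartAt_source (I := I) x).mem_nhds hxs] with y hy
      simp only [Function.comp_apply]
      rw [← hφ] at hy
      rw [φ.left_inv hy]
    rw [mvfderiv_eq_fderiv_extChartAt hxs hmd, ← hφ, hev.fderiv_eq]
  have hval : ∀ Z : Π y : N, TangentSpace I y,
      mvfderiv I φ x (Z x) = (mpullbackWithin 𝓘(𝕜, E) I φ.symm Z (range I) : E → E) (φ x) := by
    intro Z
    have h2 := mpullbackWithin_extChartAt_symm (I := I) (x := x) Z hxt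
    rw [← hφ, hxx] at h2
    exact h2.symm
  rw [hcomp X hX, hcomp Y hY, hval X, hval Y, ← fderiv_apply_lieBracket hft (by simp)
    (dX Y hY) (dX X hX), mvfderiv_eq_fderiv_extChartAt hxs
      ((hf.of_le (n := 2) (m := 1) (by norm_cast)).mdifferentiableAt one_ne_zero)]
  congr 1
  have hinv := isInvertible_mfderiv_extChartAt (I := I) hxs
  have h3 : ∀ u : E, mfderiv I 𝓘(𝕜, E) φ x ((mfderiv I 𝓘(𝕜, E) φ x).inverse u) = u :=
    hinv.self_apply_inverse
  have h4 : mlieBracket I X Y x = (mfderiv I 𝓘(𝕜, E) φ x).inverse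
      (lieBracket 𝕜 X' Y' (φ x) : E) := by
    rw [← mlieBracketWithin_univ, mlieBracketWithin_apply]
    congr 1
    have h5 : φ.symm ⁻¹' univ ∩ range I = univ := by
      rw [I.range_eq_univ, preimage_univ, univ_inter]
    rw [← hφ, h5]
    exact congrFun (lieBracketWithin_univ (V := X') (W := Y')) (φ x)
  rw [h4]
  exact h3 _

end VectorFields

section Connections

set_option maxSynthPendingDepth 3

variable {𝕜 : Type*} [RCLike 𝕜]
  {E : Type*} [NormedAddCommGroup E] [NormedSpace 𝕜 E]
  {H : Type*} [TopologicalSpace H] {I : ModelWithCorners 𝕜 E H}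
  {N : Type*} [TopologicalSpace N] [ChartedSpace H N]
  {F : Type*} [NormedAddCommGroup F] [NormedSpace 𝕜 F]
  {V : N → Type*} [TopologicalSpace (TotalSpace F V)]
  [∀ x, AddCommGroup (V x)] [∀ x, Module 𝕜 (V x)] [∀ x, TopologicalSpace (V x)]
  [∀ x, IsTopologicalAddGroup (V x)] [∀ x, ContinuousSMul 𝕜 (V x)]
  [FiberBundle F V] [VectorBundle 𝕜 F V]

/-- A vector-valued function is smooth if it solves a linear system with smooth coefficients which
is regular at the point. -/
theorem contMDiffAt_of_clm_apply_eq {G G' : Type*} [NormedAddCommGroup G] [NormedSpace 𝕜 G]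
    [NormedAddCommGroup G'] [NormedSpace 𝕜 G'] [CompleteSpace G] {n : ℕ∞ω} {T : N → G →L[𝕜] G'}
    {b : N → G'} {c : N → G} {x : N} (L : G ≃L[𝕜] G') (hL : (L : G →L[𝕜] G') = T x)
    (hT : ContMDiffAt I 𝓘(𝕜, G →L[𝕜] G') n T x) (hb : ContMDiffAt I 𝓘(𝕜, G') n b x)
    (h : ∀ᶠ y in 𝓝 x, T y (c y) = b y) : ContMDiffAt I 𝓘(𝕜, G) n c x := by
  have h1 : ContDiffAt 𝕜 n (ContinuousLinearMap.inverse : (G →L[𝕜] G') → G' →L[𝕜] G) (T x) := by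
    rw [← hL]; exact contDiffAt_map_inverse L
  have h2 : ContMDiffAt I 𝓘(𝕜, G' →L[𝕜] G) n (fun y ↦ (T y).inverse) x :=
    h1.contMDiffAt.comp (I' := 𝓘(𝕜, G →L[𝕜] G')) x hT
  refine (h2.clm_apply hb).congr_of_eventuallyEq ?_
  have h3 : ∀ᶠ y in 𝓝 x, T y ∈ range ((↑) : (G ≃L[𝕜] G') → G →L[𝕜] G') := by
    refine hT.continuousAt.eventually ?_
    rw [← hL]
    exact ContinuousLinearEquiv.nhds L
  filter_upwards [h, h3] with y hy hy3
  obtain ⟨L', hL'⟩ := hy3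
  rw [← hy, ← hL', ContinuousLinearMap.inverse_equiv]
  simp

theorem nabla_add_apply (nabla : CovariantDerivative I F V) {s t : Π x, V x} {x : N}
    (hs : MDiffAt (T% s) x) (ht : MDiffAt (T% t) x) (u : TangentSpace I x) :
    nabla (fun y ↦ s y + t y) x u = nabla s x u + nabla t x u := by
  have := nabla.isCovariantDerivativeOnUniv.add hs ht
  exact congrArg (fun L ↦ L u) this

theorem nabla_smul_apply (nabla : CovariantDerivative I F V) {c : N → 𝕜} {s : Π x, V x} {x : N}
    (hc : MDiffAt c x) (hs : MDiffAt (T% s) x) (u : TangentSpace I x) :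
    nabla (fun y ↦ c y • s y) x u = c x • nabla s x u + mvfderiv I c x u • s x := by
  have := nabla.isCovariantDerivativeOnUniv.leibniz hs hc
  exact congrArg (fun L ↦ L u) this

theorem nabla_zero_apply (nabla : CovariantDerivative I F V) (x : N) (u : TangentSpace I x) :
    nabla (fun _ ↦ 0) x u = 0 := by
  have := nabla.isCovariantDerivativeOnUniv.zero (x := x)
  exact congrArg (fun L ↦ L u) this

theorem nabla_sum_smul_apply (nabla : CovariantDerivative I F V) {ι : Type*} (A : Finset ι)
    {c : ι → N → 𝕜} {s : ι → Π x, V x} {x : N} (hc : ∀ i, MDiffAt (c i) x)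
    (hs : ∀ i, MDiffAt (T% (s i)) x) (u : TangentSpace I x) :
    nabla (fun y ↦ ∑ i ∈ A, c i y • s i y) x u =
      ∑ i ∈ A, (c i x • nabla (s i) x u + mvfderiv I (c i) x u • s i x) := by
  classical
  induction A using Finset.induction_on with
  | empty => simpa using nabla_zero_apply nabla x u
  | insert i A hi ih =>
    simp only [Finset.sum_insert hi]
    rw [nabla_add_apply nabla (s := fun y ↦ c i y • s i y) (t := fun y ↦ ∑ j ∈ A, c j y • s j y)
      (MDifferentiableAt.smul_section (hc i) (hs i))
      (MDifferentiableAt.sum_section fun j _ ↦ MDifferentiableAt.smul_section (hc j) (hs j)), ih,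
      nabla_smul_apply nabla (hc i) (hs i)]

theorem nabla_congr (nabla : CovariantDerivative I F V) {s t : Π x, V x} {x : N}
    (hs : MDiffAt (T% s) x) (h : ∀ᶠ y in 𝓝 x, s y = t y) : nabla s x = nabla t x := by
  have ht : MDiffAt (T% t) x := by
    refine hs.congr_of_eventuallyEq ?_
    filter_upwards [h] with y hy
    simp only [hy]
  exact nabla.isCovariantDerivativeOnUniv.congr_of_eventuallyEq hs ht univ_mem h

theorem SmoothSectionOn.contMDiffAt {s : Π x, V x} {U : Set N} (hs : SmoothSectionOn I F s U)
    (hU : IsOpen U) {x : N} (hx : x ∈ U) : CMDiffAt ∞ (T% s) x :=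
  ContMDiffOn.contMDiffAt hs (hU.mem_nhds hx)

theorem SmoothSectionOn.mdiffAt {s : Π x, V x} {U : Set N} (hs : SmoothSectionOn I F s U)
    (hU : IsOpen U) {x : N} (hx : x ∈ U) : MDiffAt (T% s) x :=
  (hs.contMDiffAt hU hx).mdifferentiableAt (by simp)

theorem SmoothSectionOn.mono' {s : Π x, V x} {U W : Set N} (hs : SmoothSectionOn I F s U)
    (h : W ⊆ U) : SmoothSectionOn I F s W :=
  ContMDiffOn.mono hs h

theorem contMDiffAt_fun_mdiffAt {G : Type*} [NormedAddCommGroup G] [NormedSpace 𝕜 G] {f : N → G}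
    {x : N} (h : ContMDiffAt I 𝓘(𝕜, G) ∞ f x) : MDiffAt f x :=
  h.mdifferentiableAt (by simp)

section Coeff

variable {ι : Type*} [Fintype ι] {S : ι → Π x, V x} {U : Set N} [IsManifold I ∞ N]
  [ContMDiffVectorBundle ∞ F V I]

/-- A section is smooth if it has smooth pairings with a frame, for a non-degenerate smooth
pairing. -/
theorem contMDiffAt_of_pairing [FiniteDimensional 𝕜 F] (hS : IsLocalFrameOn I F ∞ S U)
    (hU : IsOpen U) {x : N} (hx : x ∈ U) (g : ∀ y, V y →L[𝕜] V y →L[𝕜] 𝕜)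
    (hsm : ∀ i j, ContMDiffAt I 𝓘(𝕜, 𝕜) ∞ (fun y ↦ g y (S i y) (S j y)) x)
    (hnd : ∀ a, (∀ b, g x a b = 0) → a = 0) {t : Π y, V y}
    (ht : ∀ j, ContMDiffAt I 𝓘(𝕜, 𝕜) ∞ (fun y ↦ g y (t y) (S j y)) x) :
    CMDiffAt ∞ (T% t) x := by
  classical
  let T : N → (ι → 𝕜) →L[𝕜] (ι → 𝕜) := fun y ↦ ContinuousLinearMap.pi fun j ↦
    ∑ i, g y (S i y) (S j y) • ContinuousLinearMap.proj i
  have hTa : ∀ y c j, T y c j = g y (∑ i, c i • S i y) (S j y) := by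
    intro y c j
    simp [T, sum_apply, mul_comm]
  have hT : ContMDiffAt I 𝓘(𝕜, (ι → 𝕜) →L[𝕜] (ι → 𝕜)) ∞ T x := by
    have h0 : T = fun y ↦ ∑ j, ∑ i, g y (S i y) (S j y) •
        (ContinuousLinearMap.single 𝕜 (fun _ : ι ↦ 𝕜) j ∘L
          (ContinuousLinearMap.proj i : (ι → 𝕜) →L[𝕜] 𝕜)) := by
      funext y
      ext c j
      rw [Finset.sum_comm]
      simp [T, sum_apply, Finset.sum_apply, Pi.single_apply]
    rw [h0]
    refine ContMDiffAt.sum fun j _ ↦ ContMDiffAt.sum fun i _ ↦ ?_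
    exact (hsm i j).smul contMDiffAt_const
  have hinj : Function.Injective (T x) := by
    rw [injective_iff_map_eq_zero]
    intro c hc
    have h1 : ∑ i, c i • S i x = 0 := by
      apply hnd
      intro b
      have hb : b = ∑ j, (hS.toBasisAt hx).repr b j • S j x := by
        simpa using ((hS.toBasisAt hx).sum_repr b).symm
      rw [hb, map_sum]
      refine Finset.sum_eq_zero fun j _ ↦ ?_
      rw [map_smul, ← hTa, hc]
      simp
    funext i
    exact Fintype.linearIndependent_iff.1 (hS.linearIndependent hx) c h1 i
  let L : (ι → 𝕜) ≃L[𝕜] (ι → 𝕜) :=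
    (LinearEquiv.ofInjectiveEndo (T x).toLinearMap hinj).toContinuousLinearEquiv
  have hc : ContMDiffAt I 𝓘(𝕜, ι → 𝕜) ∞ (fun y i ↦ hS.coeff i y (t y)) x := by
    refine contMDiffAt_of_clm_apply_eq (T := T) (b := fun y j ↦ g y (t y) (S j y)) L
      (by ext1 c; rfl) hT ?_ ?_
    · exact contMDiffAt_pi_space.2 ht
    · filter_upwards [hU.mem_nhds hx] with y hy
      funext j
      rw [hTa, ← hS.coeff_sum_eq t hy]
  exact hS.contMDiffAt_of_coeff (fun i ↦ contMDiffAt_pi_space.1 hc i) (hU.mem_nhds hx)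

/-- The coefficients of a smooth section in a smooth frame are smooth. -/
theorem contMDiffAt_coeff [FiniteDimensional 𝕜 F] (hS : IsLocalFrameOn I F ∞ S U)
    (hU : IsOpen U) {x : N} (hx : x ∈ U) {t : Π y, V y} (ht : CMDiffAt ∞ (T% t) x) (i : ι) :
    ContMDiffAt I 𝓘(𝕜, 𝕜) ∞ (fun y ↦ hS.coeff i y (t y)) x := by
  classical
  set e := trivializationAt F V x with he
  have hxe : x ∈ e.baseSet := FiberBundle.mem_baseSet_trivializationAt' x
  have hs : ∀ {s : Π y, V y}, CMDiffAt ∞ (T% s) x →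
      ContMDiffAt I 𝓘(𝕜, F) ∞ (fun y ↦ (e ⟨y, s y⟩).2) x :=
    fun h ↦ (e.contMDiffAt_section_iff hxe).1 h
  let T : N → (ι → 𝕜) →L[𝕜] F := fun y ↦
    ∑ i, (ContinuousLinearMap.proj i : (ι → 𝕜) →L[𝕜] 𝕜).smulRight (e ⟨y, S i y⟩).2
  have hT : ContMDiffAt I 𝓘(𝕜, (ι → 𝕜) →L[𝕜] F) ∞ T x := by
    refine ContMDiffAt.sum fun i _ ↦ ?_
    exact (ContinuousLinearMap.smulRightL 𝕜 (ι → 𝕜) F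
      (ContinuousLinearMap.proj i)).contMDiff.contMDiffAt.comp (I' := 𝓘(𝕜, F)) x
      (hs (hS.contMDiffAt hU hx i))
  have hlin : ∀ y (hy : y ∈ e.baseSet) (a : V y), (e ⟨y, a⟩).2 = e.linearEquivAt 𝕜 y hy a :=
    fun y hy a ↦ rfl
  have hTa : ∀ y ∈ e.baseSet, ∀ c, T y c = (e ⟨y, ∑ i, c i • S i y⟩).2 := by
    intro y hy c
    rw [hlin y hy, map_sum]
    simp only [T, sum_apply, ContinuousLinearMap.smulRight_apply, map_smul,
      hlin y hy]
    rfl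
  have hbij : Function.Bijective (T x) := by
    let L := (hS.toBasisAt hx).equivFun.symm.trans (e.linearEquivAt 𝕜 x hxe)
    have : ∀ c, T x c = L c := by
      intro c
      rw [hTa x hxe, hlin x hxe]
      simp [L, Module.Basis.equivFun_symm_apply]
    have h2 : (T x : (ι → 𝕜) → F) = L := funext this
    rw [h2]
    exact L.bijective
  let L : (ι → 𝕜) ≃L[𝕜] F :=
    (LinearEquiv.ofBijective (T x).toLinearMap hbij).toContinuousLinearEquiv
  have hc : ContMDiffAt I 𝓘(𝕜, ι → 𝕜) ∞ (fun y i ↦ hS.coeff i y (t y)) x := by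
    refine contMDiffAt_of_clm_apply_eq (T := T) (b := fun y ↦ (e ⟨y, t y⟩).2) L
      (by ext1 c; rfl) hT (hs ht) ?_
    filter_upwards [hU.mem_nhds hx, e.open_baseSet.mem_nhds hxe] with y hy hye
    rw [hTa y hye, ← hS.coeff_sum_eq t hy]
  exact contMDiffAt_pi_space.1 hc i

end Coeff

end Connections

section LeviCivita

set_option maxSynthPendingDepth 3

variable {𝕜 : Type*} [RCLike 𝕜]
  {E : Type*} [NormedAddCommGroup E] [NormedSpace 𝕜 E]
  {H : Type*} [TopologicalSpace H] {I : ModelWithCorners 𝕜 E H}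
  {N : Type*} [TopologicalSpace N] [ChartedSpace H N]

/-- Local existence of a smooth section with a prescribed value. -/
theorem exists_smooth_extension [IsManifold I ∞ N] {F : Type*} [NormedAddCommGroup F]
    [NormedSpace 𝕜 F] {V : N → Type*}
    [TopologicalSpace (TotalSpace F V)]
    [∀ x, AddCommGroup (V x)] [∀ x, Module 𝕜 (V x)] [∀ x, TopologicalSpace (V x)]
    [FiberBundle F V] [VectorBundle 𝕜 F V] [ContMDiffVectorBundle ∞ F V I] (x : N) (a : V x) :
    ∃ s : Π y, V y, s x = a ∧ SmoothSectionOn I F s (trivializationAt F V x).baseSet := by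
  set e := trivializationAt F V x
  refine ⟨fun y ↦ e.symm y (e ⟨x, a⟩).2, ?_, ?_⟩
  · exact e.symm_apply_apply_mk (FiberBundle.mem_baseSet_trivializationAt' x) a
  · rw [SmoothSectionOn, e.contMDiffOn_section_baseSet_iff]
    refine (contMDiffOn_const (c := (e ⟨x, a⟩).2)).congr fun y hy ↦ ?_
    exact (congrArg Prod.snd (e.apply_mk_symm hy (e ⟨x, a⟩).2) :)

variable [IsManifold I 1 N] {g : ∀ x : N, TangentSpace I x →L[𝕜] TangentSpace I x →L[𝕜] 𝕜}
  {nabla : CovariantDerivative I E (TangentSpace I : N → Type _)}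

theorem IsLeviCivita.koszul (h : IsLeviCivita I g nabla)
    (hsymm : ∀ x (a b : TangentSpace I x), g x a b = g x b a)
    {X Y Z : Π x : N, TangentSpace I x} {x : N}
    (hX : MDiffAt (T% X) x) (hY : MDiffAt (T% Y) x) (hZ : MDiffAt (T% Z) x) :
    2 * g x (nabla Y x (X x)) (Z x) =
      mvfderiv I (fun y ↦ g y (Y y) (Z y)) x (X x) + mvfderiv I (fun y ↦ g y (X y) (Z y)) x (Y x)
        - mvfderiv I (fun y ↦ g y (X y) (Y y)) x (Z x)
        + g x (mlieBracket I X Y x) (Z x) - g x (mlieBracket I X Z x) (Y x)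
        - g x (mlieBracket I Y Z x) (X x) := by
  rw [h.metric _ _ _ _ hY hZ, h.metric _ _ _ _ hX hZ, h.metric _ _ _ _ hX hY,
    ← h.torsion_free _ _ _ hX hY, ← h.torsion_free _ _ _ hX hZ, ← h.torsion_free _ _ _ hY hZ]
  simp only [map_sub, sub_apply]
  rw [hsymm x (X x) (nabla Z x (Y x)), hsymm x (Y x) (nabla Z x (X x)),
    hsymm x (X x) (nabla Y x (Z x))]
  ring

theorem IsLeviCivita.unique [IsManifold I ∞ N]
    (h : IsLeviCivita I g nabla) (hsymm : ∀ x (a b : TangentSpace I x), g x a b = g x b a)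
    (hnd : ∀ x (a : TangentSpace I x), (∀ b, g x a b = 0) → a = 0)
    {nabla' : CovariantDerivative I E (TangentSpace I : N → Type _)} (h' : IsLeviCivita I g nabla')
    {Y : Π x : N, TangentSpace I x} {x : N} (hY : MDiffAt (T% Y) x) : nabla Y x = nabla' Y x := by
  ext u
  rw [← sub_eq_zero]
  apply hnd
  intro b
  obtain ⟨X, rfl, hX⟩ := exists_smooth_extension (I := I) (F := E) x u
  obtain ⟨Z, rfl, hZ⟩ := exists_smooth_extension (I := I) (F := E) x b
  have hx := FiberBundle.mem_baseSet_trivializationAt' (F := E) (E := TangentSpace I) x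
  have hX := hX.mdiffAt (trivializationAt E (TangentSpace I) x).open_baseSet hx
  have hZ := hZ.mdiffAt (trivializationAt E (TangentSpace I) x).open_baseSet hx
  have h1 := h.koszul hsymm hX hY hZ
  rw [← h'.koszul hsymm hX hY hZ] at h1
  rw [map_sub, sub_apply, sub_eq_zero]
  exact mul_left_cancel₀ two_ne_zero h1

theorem contMDiffAt_lieBracket [IsManifold I ∞ N] [CompleteSpace E] {X Y : Π x : N, TangentSpace I x}
    {x : N} (hX : CMDiffAt ∞ (T% X) x) (hY : CMDiffAt ∞ (T% Y) x) :
    CMDiffAt ∞ (T% (mlieBracket I X Y)) x := by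
  have _ : IsManifold I ((⊤ : ℕ∞) + 1) N := .of_le (n := ∞) (by norm_cast)
  have _ : IsManifold I (minSmoothness 𝕜 2) N := by
    rw [minSmoothness_of_isRCLikeNormedField]
    infer_instance
  exact ContMDiffAt.mlieBracket_vectorField (m := ⊤) (n := ⊤) hX hY (by
    rw [minSmoothness_of_isRCLikeNormedField]; norm_cast)

/-- A metric evaluated on two smooth fields. -/
def SmoothPairing (I : ModelWithCorners 𝕜 E H) [IsManifold I 1 N]
    (g : ∀ x : N, TangentSpace I x →L[𝕜] TangentSpace I x →L[𝕜] 𝕜) : Prop :=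
  ∀ (X Y : Π x : N, TangentSpace I x) (x : N), CMDiffAt ∞ (T% X) x → CMDiffAt ∞ (T% Y) x →
    ContMDiffAt I 𝓘(𝕜, 𝕜) ∞ (fun y ↦ g y (X y) (Y y)) x

/-- The Levi-Civita connection of a smooth metric is smooth. -/
theorem IsLeviCivita.contMDiffAt [I.Boundaryless] [IsManifold I ∞ N] [FiniteDimensional 𝕜 E]
    (h : IsLeviCivita I g nabla) (hsymm : ∀ x (a b : TangentSpace I x), g x a b = g x b a)
    (hnd : ∀ x (a : TangentSpace I x), (∀ b, g x a b = 0) → a = 0) (hg : SmoothPairing I g)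
    {U : Set N} (hU : IsOpen U) {X Y : Π x : N, TangentSpace I x} (hX : SmoothSectionOn I E X U)
    (hY : SmoothSectionOn I E Y U) {x : N} (hx : x ∈ U) :
    CMDiffAt ∞ (T% fun y ↦ nabla Y y (X y)) x := by
  have _ : CompleteSpace E := FiniteDimensional.complete 𝕜 E
  set e := trivializationAt E (TangentSpace I : N → Type _) x
  have hxe : x ∈ e.baseSet := FiberBundle.mem_baseSet_trivializationAt' x
  let b := Module.finBasis 𝕜 E
  have hS := e.isLocalFrameOn_localFrame_baseSet I ∞ b
  refine contMDiffAt_of_pairing hS e.open_baseSet hxe g (fun i j ↦ hg _ _ _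
    (hS.contMDiffAt e.open_baseSet hxe i) (hS.contMDiffAt e.open_baseSet hxe j)) (hnd x) ?_
  intro j
  set Z := e.localFrame b j
  have hZ : SmoothSectionOn I E Z e.baseSet := hS.contMDiffOn j
  have hX' := hX.contMDiffAt hU hx
  have hY' := hY.contMDiffAt hU hx
  have hZ' := hZ.contMDiffAt e.open_baseSet hxe
  have key : ContMDiffAt I 𝓘(𝕜, 𝕜) ∞ (fun x ↦ (2 : 𝕜)⁻¹ *
      (mvfderiv I (fun y ↦ g y (Y y) (Z y)) x (X x) + mvfderiv I (fun y ↦ g y (X y) (Z y)) x (Y x)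
        - mvfderiv I (fun y ↦ g y (X y) (Y y)) x (Z x)
        + g x (mlieBracket I X Y x) (Z x) - g x (mlieBracket I X Z x) (Y x)
        - g x (mlieBracket I Y Z x) (X x))) x := by
    refine contMDiffAt_const.mul ?_
    refine ContMDiffAt.sub (ContMDiffAt.sub (ContMDiffAt.add (ContMDiffAt.sub (ContMDiffAt.add
      ?_ ?_) ?_) ?_) ?_) ?_
    · exact contMDiffAt_mvfderiv_apply (hg _ _ _ hY' hZ') hX'
    · exact contMDiffAt_mvfderiv_apply (hg _ _ _ hX' hZ') hY'
    · exact contMDiffAt_mvfderiv_apply (hg _ _ _ hX' hY') hZ'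
    · exact hg _ _ _ (contMDiffAt_lieBracket hX' hY') hZ'
    · exact hg _ _ _ (contMDiffAt_lieBracket hX' hZ') hY'
    · exact hg _ _ _ (contMDiffAt_lieBracket hY' hZ') hX'
  refine key.congr_of_eventuallyEq ?_
  filter_upwards [hU.mem_nhds hx, e.open_baseSet.mem_nhds hxe] with y hy hye
  rw [← h.koszul hsymm (hX.mdiffAt hU hy) (hY.mdiffAt hU hy) (hZ.mdiffAt e.open_baseSet hye)]
  simp

end LeviCivita

section Curvature

set_option maxSynthPendingDepth 3

variable {𝕜 : Type*} [RCLike 𝕜]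
  {E : Type*} [NormedAddCommGroup E] [NormedSpace 𝕜 E]
  {H : Type*} [TopologicalSpace H] {I : ModelWithCorners 𝕜 E H} [I.Boundaryless]
  {N : Type*} [TopologicalSpace N] [ChartedSpace H N] [IsManifold I ∞ N]
  {F : Type*} [NormedAddCommGroup F] [NormedSpace 𝕜 F]
  {V : N → Type*} [TopologicalSpace (TotalSpace F V)]
  [∀ x, AddCommGroup (V x)] [∀ x, Module 𝕜 (V x)] [∀ x, TopologicalSpace (V x)]
  [∀ x, IsTopologicalAddGroup (V x)] [∀ x, ContinuousSMul 𝕜 (V x)]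
  [FiberBundle F V] [VectorBundle 𝕜 F V] [ContMDiffVectorBundle ∞ F V I]

/-- The connection maps smooth local sections and fields to smooth local sections. -/
def PreservesSmooth (nabla : CovariantDerivative I F V) : Prop :=
  ∀ (U : Set N) (X : Π x : N, TangentSpace I x) (s : Π x : N, V x), IsOpen U →
    SmoothSectionOn I E X U → SmoothSectionOn I F s U →
    SmoothSectionOn I F (fun y ↦ nabla s y (X y)) U

variable {nabla : CovariantDerivative I F V}

theorem curvature_swap (X Y : Π x : N, TangentSpace I x) (s : Π x : N, V x) (x : N) :
    curvature I F nabla X Y s x = - curvature I F nabla Y X s x := by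
  rw [curvature, curvature, mlieBracket_swap_apply, map_neg]
  abel

theorem curvature_congr (hn : PreservesSmooth nabla) {U : Set N} (hU : IsOpen U)
    {X Y X' Y' : Π x : N, TangentSpace I x} {s s' : Π x : N, V x}
    (hX : SmoothSectionOn I E X U) (hY : SmoothSectionOn I E Y U) (hs : SmoothSectionOn I F s U)
    (hXX : ∀ x ∈ U, X x = X' x) (hYY : ∀ x ∈ U, Y x = Y' x) (hss : ∀ x ∈ U, s x = s' x)
    {x : N} (hx : x ∈ U) : curvature I F nabla X Y s x = curvature I F nabla X' Y' s' x := by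
  have h1 : ∀ y ∈ U, nabla s y = nabla s' y := fun y hy ↦
    nabla_congr nabla (hs.mdiffAt hU hy) (eventually_of_mem (hU.mem_nhds hy) hss)
  have h2 : ∀ {A A' : Π x : N, TangentSpace I x}, SmoothSectionOn I E A U →
      (∀ x ∈ U, A x = A' x) →
      nabla (fun y ↦ nabla s y (A y)) x = nabla (fun y ↦ nabla s' y (A' y)) x := by
    intro A A' hA hAA
    refine nabla_congr nabla ((hn U A s hU hA hs).mdiffAt hU hx)
      (eventually_of_mem (hU.mem_nhds hx) fun y hy ↦ ?_)
    rw [h1 y hy, hAA y hy]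
  rw [curvature, curvature, h2 hX hXX, h2 hY hYY, h1 x hx, hXX x hx, hYY x hx,
    Filter.EventuallyEq.mlieBracket_vectorField_eq (eventually_of_mem (hU.mem_nhds hx) hXX)
      (eventually_of_mem (hU.mem_nhds hx) hYY)]

variable {ι : Type*} [Fintype ι] {U : Set N}

theorem curvature_sum_smul [CompleteSpace E] (hn : PreservesSmooth nabla) (hU : IsOpen U)
    {X Y : Π x : N, TangentSpace I x} {S : ι → Π x : N, V x} {c : ι → N → 𝕜}
    (hX : SmoothSectionOn I E X U) (hY : SmoothSectionOn I E Y U)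
    (hS : ∀ i, SmoothSectionOn I F (S i) U) (hc : ∀ i, ∀ x ∈ U, ContMDiffAt I 𝓘(𝕜, 𝕜) ∞ (c i) x)
    {x : N} (hx : x ∈ U) :
    curvature I F nabla X Y (fun y ↦ ∑ i, c i y • S i y) x =
      ∑ i, c i x • curvature I F nabla X Y (S i) x := by
  have h1 : ∀ y ∈ U, ∀ u, nabla (fun y ↦ ∑ i, c i y • S i y) y u =
      ∑ i, (c i y • nabla (S i) y u + mvfderiv I (c i) y u • S i y) := fun y hy u ↦
    nabla_sum_smul_apply nabla Finset.univ (fun i ↦ contMDiffAt_fun_mdiffAt (hc i y hy))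
      (fun i ↦ (hS i).mdiffAt hU hy) u
  have hd : ∀ {A : Π x : N, TangentSpace I x}, SmoothSectionOn I E A U → ∀ i, ∀ y ∈ U,
      ContMDiffAt I 𝓘(𝕜, 𝕜) ∞ (fun y ↦ mvfderiv I (c i) y (A y)) y := fun hA i y hy ↦
    contMDiffAt_mvfderiv_apply (hc i y hy) (hA.contMDiffAt hU hy)
  have hss : SmoothSectionOn I F (fun y ↦ ∑ i, c i y • S i y) U := fun y hy ↦
    (ContMDiffAt.sum_section fun i _ ↦ (hc i y hy).smul_section
      ((hS i).contMDiffAt hU hy)).contMDiffWithinAt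
  have h2 : ∀ {A B : Π x : N, TangentSpace I x}, SmoothSectionOn I E A U →
      nabla (fun y ↦ nabla (fun y ↦ ∑ i, c i y • S i y) y (A y)) x (B x) =
        ∑ i, (c i x • nabla (fun y ↦ nabla (S i) y (A y)) x (B x)
          + mvfderiv I (c i) x (B x) • nabla (S i) x (A x)
          + mvfderiv I (c i) x (A x) • nabla (S i) x (B x)
          + mvfderiv I (fun y ↦ mvfderiv I (c i) y (A y)) x (B x) • S i x) := by
    intro A B hA
    rw [nabla_congr nabla (t := fun y ↦ (∑ i, c i y • nabla (S i) y (A y))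
      + ∑ i, mvfderiv I (c i) y (A y) • S i y) ((hn U A _ hU hA hss).mdiffAt hU hx)
      (eventually_of_mem (hU.mem_nhds hx) fun y hy ↦ by
        rw [h1 y hy, Finset.sum_add_distrib])]
    have hSA := fun i ↦ (hn U A _ hU hA (hS i))
    rw [nabla_add_apply nabla (s := fun y ↦ ∑ i, c i y • nabla (S i) y (A y))
        (t := fun y ↦ ∑ i, mvfderiv I (c i) y (A y) • S i y)
      (MDifferentiableAt.sum_section fun i _ ↦ (contMDiffAt_fun_mdiffAt (hc i x hx)).smul_section
        ((hSA i).mdiffAt hU hx))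
      (MDifferentiableAt.sum_section fun i _ ↦
        (contMDiffAt_fun_mdiffAt (hd hA i x hx)).smul_section ((hS i).mdiffAt hU hx)),
      nabla_sum_smul_apply nabla Finset.univ (s := fun i y ↦ nabla (S i) y (A y))
        (fun i ↦ contMDiffAt_fun_mdiffAt (hc i x hx)) (fun i ↦ (hSA i).mdiffAt hU hx),
      nabla_sum_smul_apply nabla Finset.univ (c := fun i y ↦ mvfderiv I (c i) y (A y))
        (fun i ↦ contMDiffAt_fun_mdiffAt (hd hA i x hx)) (fun i ↦ (hS i).mdiffAt hU hx),
      ← Finset.sum_add_distrib]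
    refine Finset.sum_congr rfl fun i _ ↦ ?_
    abel
  rw [curvature, h2 hY, h2 hX, h1 x hx, ← Finset.sum_sub_distrib, ← Finset.sum_sub_distrib]
  refine Finset.sum_congr rfl fun i _ ↦ ?_
  rw [mvfderiv_mlieBracket ((hc i x hx).of_le (by norm_cast)) (hX.mdiffAt hU hx)
    (hY.mdiffAt hU hx), curvature]
  module

theorem curvature_sum_smul_left [CompleteSpace E] (hn : PreservesSmooth nabla) (hU : IsOpen U)
    {Y : Π x : N, TangentSpace I x} {A : ι → Π x : N, TangentSpace I x} {s : Π x : N, V x}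
    {c : ι → N → 𝕜}
    (hA : ∀ i, SmoothSectionOn I E (A i) U)
    (hs : SmoothSectionOn I F s U) (hc : ∀ i, ∀ x ∈ U, ContMDiffAt I 𝓘(𝕜, 𝕜) ∞ (c i) x)
    {x : N} (hx : x ∈ U) :
    curvature I F nabla (fun y ↦ ∑ i, c i y • A i y) Y s x =
      ∑ i, c i x • curvature I F nabla (A i) Y s x := by
  have hb : ∀ B : Finset ι, mlieBracket I (fun y ↦ ∑ i ∈ B, c i y • A i y) Y x =
      ∑ i ∈ B, (c i x • mlieBracket I (A i) Y x - mvfderiv I (c i) x (Y x) • A i x) := by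
    classical
    intro B
    induction B using Finset.induction_on with
    | empty =>
      simp only [Finset.sum_empty]
      exact congrFun (mlieBracket_zero_left (I := I) (W := Y)) x
    | insert i B hi ih =>
      simp only [Finset.sum_insert hi]
      have h1 := mlieBracket_add_left (I := I) (W := Y) (V := fun y ↦ c i y • A i y)
        (V₁ := fun y ↦ ∑ i ∈ B, c i y • A i y) (x := x)
        ((contMDiffAt_fun_mdiffAt (hc i x hx)).smul_section ((hA i).mdiffAt hU hx))
        (MDifferentiableAt.sum_section fun j _ ↦
          (contMDiffAt_fun_mdiffAt (hc j x hx)).smul_section ((hA j).mdiffAt hU hx))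
      have h2 := mlieBracket_smul_left (I := I) (W := Y) (f := c i) (V := A i) (x := x)
        (contMDiffAt_fun_mdiffAt (hc i x hx)) ((hA i).mdiffAt hU hx)
      refine h1.trans ?_
      rw [ih]
      refine congrArg (· + _) (h2.trans ?_)
      rw [neg_smul]
      abel
  have h2 : nabla (fun y ↦ nabla s y (∑ i, c i y • A i y)) x (Y x) =
      ∑ i, (c i x • nabla (fun y ↦ nabla s y (A i y)) x (Y x)
        + mvfderiv I (c i) x (Y x) • nabla s x (A i x)) := by
    rw [← nabla_sum_smul_apply nabla Finset.univ (s := fun i y ↦ nabla s y (A i y))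
        (fun i ↦ contMDiffAt_fun_mdiffAt (hc i x hx))
        (fun i ↦ (hn U _ _ hU (hA i) hs).mdiffAt hU hx)]
    simp only [map_sum, map_smul]
  rw [curvature, h2, hb, map_sum, map_sum, ← Finset.sum_sub_distrib, ← Finset.sum_sub_distrib]
  refine Finset.sum_congr rfl fun i _ ↦ ?_
  rw [map_sub, map_smul, map_smul, map_smul, curvature]
  module

/-- The curvature vanishes if it vanishes on frames. -/
theorem curvature_eq_zero_of_frame [FiniteDimensional 𝕜 E] [FiniteDimensional 𝕜 F]
    (hn : PreservesSmooth nabla) (hU : IsOpen U) {κ : Type*} [Fintype κ]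
    {A : κ → Π x : N, TangentSpace I x} {S : ι → Π x : N, V x}
    (hA : IsLocalFrameOn I E ∞ A U) (hS : IsLocalFrameOn I F ∞ S U)
    (h : ∀ a b i, ∀ x ∈ U, curvature I F nabla (A a) (A b) (S i) x = 0)
    {W : Set N} (hW : IsOpen W)
    {X Y : Π x : N, TangentSpace I x} {s : Π x : N, V x}
    (hX : SmoothSectionOn I E X W) (hY : SmoothSectionOn I E Y W) (hs : SmoothSectionOn I F s W)
    {x : N} (hxW : x ∈ W) (hxU : x ∈ U) : curvature I F nabla X Y s x = 0 := by
  have _ : CompleteSpace E := FiniteDimensional.complete 𝕜 E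
  have hO := hU.inter hW
  have hx : x ∈ U ∩ W := ⟨hxU, hxW⟩
  have hA' : ∀ a, SmoothSectionOn I E (A a) (U ∩ W) := fun a ↦
    SmoothSectionOn.mono' (hA.contMDiffOn a) inter_subset_left
  have hS' : ∀ i, SmoothSectionOn I F (S i) (U ∩ W) := fun i ↦
    SmoothSectionOn.mono' (hS.contMDiffOn i) inter_subset_left
  replace hX := hX.mono' (inter_subset_right (s := U))
  replace hY := hY.mono' (inter_subset_right (s := U))
  replace hs := hs.mono' (inter_subset_right (s := U))
  have coefA : ∀ {Z : Π x : N, TangentSpace I x}, SmoothSectionOn I E Z (U ∩ W) → ∀ a,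
      ∀ y ∈ U ∩ W, ContMDiffAt I 𝓘(𝕜, 𝕜) ∞ (fun y ↦ hA.coeff a y (Z y)) y := fun hZ a y hy ↦
    contMDiffAt_coeff hA hU hy.1 (hZ.contMDiffAt hO hy) a
  have coefS : ∀ i, ∀ y ∈ U ∩ W, ContMDiffAt I 𝓘(𝕜, 𝕜) ∞ (fun y ↦ hS.coeff i y (s y)) y :=
    fun i y hy ↦ contMDiffAt_coeff hS hU hy.1 (hs.contMDiffAt hO hy) i
  have red : ∀ {Z Z' : Π x : N, TangentSpace I x}, SmoothSectionOn I E Z (U ∩ W) →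
      SmoothSectionOn I E Z' (U ∩ W) → curvature I F nabla Z Z' s x =
      ∑ a, hA.coeff a x (Z x) • curvature I F nabla (A a) Z' s x := by
    intro Z Z' hZ hZ'
    rw [← curvature_sum_smul_left hn hO hA' hs (coefA hZ) hx]
    exact curvature_congr hn hO hZ hZ' hs (fun y hy ↦ hA.coeff_sum_eq Z hy.1)
      (fun _ _ ↦ rfl) (fun _ _ ↦ rfl) hx
  rw [red hX hY]
  refine Finset.sum_eq_zero fun a _ ↦ ?_
  rw [curvature_swap, red hY (hA' a), neg_eq_zero.2, smul_zero]
  refine Finset.sum_eq_zero fun b _ ↦ ?_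
  rw [curvature_congr hn hO (hA' b) (hA' a) hs (fun _ _ ↦ rfl) (fun _ _ ↦ rfl)
    (fun y hy ↦ hS.coeff_sum_eq s hy.1) hx,
    curvature_sum_smul hn hO (hA' b) (hA' a) hS' coefS hx]
  simp [h b a _ x hxU]

end Curvature

section ParallelFrames

set_option maxSynthPendingDepth 3

variable {𝕜 : Type*} [RCLike 𝕜]
  {E : Type*} [NormedAddCommGroup E] [NormedSpace 𝕜 E]
  {H : Type*} [TopologicalSpace H] {I : ModelWithCorners 𝕜 E H} [I.Boundaryless]
  {N : Type*} [TopologicalSpace N] [ChartedSpace H N] [IsManifold I ∞ N]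
  {F : Type*} [NormedAddCommGroup F] [NormedSpace 𝕜 F]
  {V : N → Type*} [TopologicalSpace (TotalSpace F V)]
  [∀ x, AddCommGroup (V x)] [∀ x, Module 𝕜 (V x)] [∀ x, TopologicalSpace (V x)]
  [∀ x, IsTopologicalAddGroup (V x)] [∀ x, ContinuousSMul 𝕜 (V x)]
  [FiberBundle F V] [VectorBundle 𝕜 F V] [ContMDiffVectorBundle ∞ F V I]

theorem smoothSectionOn_symm (e : Trivialization F (TotalSpace.proj : TotalSpace F V → N))
    [MemTrivializationAtlas e] (a : F) :
    SmoothSectionOn I F (fun y ↦ e.symm y a) e.baseSet := by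
  rw [SmoothSectionOn, e.contMDiffOn_section_baseSet_iff]
  refine (contMDiffOn_const (c := a)).congr fun y hy ↦ ?_
  exact (congrArg Prod.snd (e.apply_mk_symm hy a) :)

theorem snd_apply_symm (e : Trivialization F (TotalSpace.proj : TotalSpace F V → N))
    {y : N} (hy : y ∈ e.baseSet) (a : F) : (e ⟨y, e.symm y a⟩).2 = a :=
  congrArg Prod.snd (e.apply_mk_symm hy a)

theorem snd_apply_eq (𝕜 : Type*) [RCLike 𝕜] [NormedSpace 𝕜 F] [∀ x, Module 𝕜 (V x)]
    [VectorBundle 𝕜 F V] (e : Trivialization F (TotalSpace.proj : TotalSpace F V → N))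
    [MemTrivializationAtlas e]
    {y : N} (hy : y ∈ e.baseSet) (a : V y) : (e ⟨y, a⟩).2 = e.linearEquivAt 𝕜 y hy a := rfl

theorem snd_apply_smul (e : Trivialization F (TotalSpace.proj : TotalSpace F V → N))
    [MemTrivializationAtlas e] {y : N} (hy : y ∈ e.baseSet) (c : 𝕜) (a : V y) :
    (e ⟨y, c • a⟩).2 = c • (e ⟨y, a⟩).2 :=
  map_smul (e.linearEquivAt 𝕜 y hy) c a

theorem snd_apply_add (𝕜 : Type*) [RCLike 𝕜] [NormedSpace 𝕜 F] [∀ x, Module 𝕜 (V x)]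
    [VectorBundle 𝕜 F V] (e : Trivialization F (TotalSpace.proj : TotalSpace F V → N))
    [MemTrivializationAtlas e] {y : N} (hy : y ∈ e.baseSet) (a b : V y) :
    (e ⟨y, a + b⟩).2 = (e ⟨y, a⟩).2 + (e ⟨y, b⟩).2 :=
  map_add (e.linearEquivAt 𝕜 y hy) a b

/-- The connection in a local trivialization. -/
theorem snd_nabla_apply [FiniteDimensional 𝕜 F] (nabla : CovariantDerivative I F V)
    (e : Trivialization F (TotalSpace.proj : TotalSpace F V → N))
    [MemTrivializationAtlas e] {ι : Type*} [Fintype ι] (b : Module.Basis ι 𝕜 F) {x : N}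
    (hx : x ∈ e.baseSet) {s : Π y, V y} (hs : MDiffAt (T% s) x) (u : TangentSpace I x) :
    (e ⟨x, nabla s x u⟩).2 = mvfderiv I (fun y ↦ (e ⟨y, s y⟩).2) x u +
      ∑ k, b.repr (e ⟨x, s x⟩).2 k • (e ⟨x, nabla (fun y ↦ e.symm y (b k)) x u⟩).2 := by
  have hf : MDiffAt (fun y ↦ (e ⟨y, s y⟩).2) x := (e.mdifferentiableAt_section_iff I s hx).1 hs
  let L : ι → F →L[𝕜] 𝕜 := fun k ↦ LinearMap.toContinuousLinearMap (b.coord k)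
  have hL : ∀ k v, L k v = b.repr v k := fun k v ↦ rfl
  have hc : ∀ k, MDiffAt (fun y ↦ L k (e ⟨y, s y⟩).2) x := fun k ↦
    (L k).differentiableAt.mdifferentiableAt.comp x hf
  have hS : ∀ k, MDiffAt (T% fun y ↦ e.symm y (b k)) x := fun k ↦
    (smoothSectionOn_symm (I := I) e (b k)).mdiffAt e.open_baseSet hx
  have hdc : ∀ k, mvfderiv I (fun y ↦ L k (e ⟨y, s y⟩).2) x u =
      L k (mvfderiv I (fun y ↦ (e ⟨y, s y⟩).2) x u) := by
    intro k
    change mfderiv I 𝓘(𝕜, 𝕜) (L k ∘ fun y ↦ (e ⟨y, s y⟩).2) x u = _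
    rw [mfderiv_comp x (L k).differentiableAt.mdifferentiableAt hf, mfderiv_eq_fderiv,
      ContinuousLinearMap.fderiv]
    rfl
  have h1 : ∀ᶠ y in 𝓝 x, s y = ∑ k, L k (e ⟨y, s y⟩).2 • e.symm y (b k) := by
    filter_upwards [e.open_baseSet.mem_nhds hx] with y hy
    apply (e.linearEquivAt 𝕜 y hy).injective
    rw [map_sum, ← snd_apply_eq 𝕜 e hy]
    simp only [← snd_apply_eq 𝕜 e hy, snd_apply_smul e hy, snd_apply_symm e hy, hL]
    exact (b.sum_repr _).symm
  rw [nabla_congr nabla hs h1, nabla_sum_smul_apply nabla Finset.univ hc hS, snd_apply_eq 𝕜 e hx,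
    map_sum]
  simp only [← snd_apply_eq 𝕜 e hx, snd_apply_add 𝕜 e hx, snd_apply_smul e hx,
    snd_apply_symm e hx, hdc, Finset.sum_add_distrib]
  rw [add_comm]
  exact congrArg (· + _) (b.sum_repr _)

theorem mvfderiv_extChartAt_symm {x₀ x : N} (hx : x ∈ (extChartAt I x₀).source) (h : E) :
    mvfderiv I (extChartAt I x₀) x ((trivializationAt E (TangentSpace I) x₀).symm x h) = h := by
  have hx' : x ∈ (chartAt H x₀).source := by simpa using hx
  have hb : x ∈ (trivializationAt E (TangentSpace I) x₀).baseSet := by simpa using hx'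
  have h1 := TangentBundle.continuousLinearMapAt_trivializationAt (I := I) hx'
  have h2 := congrArg (fun L ↦ L ((trivializationAt E (TangentSpace I) x₀).symm x h)) h1
  simp only [Trivialization.continuousLinearMapAt_apply] at h2
  rw [Trivialization.coe_linearMapAt_of_mem _ hb] at h2
  refine Eq.trans ?_ (snd_apply_symm (trivializationAt E (TangentSpace I) x₀) hb h)
  exact h2.symm

theorem mvfderiv_extChartAt_injective {x₀ x : N} (hx : x ∈ (extChartAt I x₀).source)
    {u v : TangentSpace I x}
    (h : mvfderiv I (extChartAt I x₀) x u = mvfderiv I (extChartAt I x₀) x v) : u = v := by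
  have h1 := (isInvertible_mfderiv_extChartAt (I := I) hx).injective
  exact h1 h

theorem symm_mvfderiv_extChartAt {x₀ x : N} (hx : x ∈ (extChartAt I x₀).source)
    (u : TangentSpace I x) : (trivializationAt E (TangentSpace I) x₀).symm x
      (mvfderiv I (extChartAt I x₀) x u) = u :=
  mvfderiv_extChartAt_injective hx (mvfderiv_extChartAt_symm hx _)

theorem mlieBracket_coordinate_eq_zero [CompleteSpace E] {x₀ x : N}
    (hx : x ∈ (extChartAt I x₀).source) (h k : E) :
    mlieBracket I (fun y ↦ (trivializationAt E (TangentSpace I) x₀).symm y h)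
      (fun y ↦ (trivializationAt E (TangentSpace I) x₀).symm y k) x = 0 := by
  have hx' : x ∈ (chartAt H x₀).source := by simpa using hx
  have hb : x ∈ (trivializationAt E (TangentSpace I) x₀).baseSet := by simpa using hx'
  have hS : ∀ h : E, MDiffAt (T% fun y ↦ (trivializationAt E (TangentSpace I) x₀).symm y h) x :=
    fun h ↦ (smoothSectionOn_symm (I := I) _ h).mdiffAt (Trivialization.open_baseSet _) hb
  have hz : ∀ h k : E, mvfderiv I (fun y ↦ mvfderiv I (extChartAt I x₀) y
      ((trivializationAt E (TangentSpace I) x₀).symm y h)) x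
      ((trivializationAt E (TangentSpace I) x₀).symm x k) = 0 := by
    intro h k
    rw [mvfderiv_congr (g := fun _ ↦ h) (eventually_of_mem
      ((isOpen_extChartAt_source (I := I) x₀).mem_nhds hx) fun y hy ↦
        mvfderiv_extChartAt_symm hy h), mvfderiv_const]
    rfl
  apply mvfderiv_extChartAt_injective hx
  rw [mvfderiv_mlieBracket (contMDiffAt_extChartAt' (by simpa using hx)) (hS h) (hS k), hz, hz,
    map_zero, sub_zero]

/-- A flat connection has a parallel local frame around every point. -/
theorem exists_parallel_frame [FiniteDimensional 𝕜 E] [FiniteDimensional 𝕜 F]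
    {nabla : CovariantDerivative I F V} (hn : PreservesSmooth nabla) {O : Set N} (hO : IsOpen O)
    (hflat : IsFlatConnectionOn I F nabla O) {x₀ : N} (hx₀ : x₀ ∈ O) :
    ∃ W, IsOpen W ∧ x₀ ∈ W ∧ W ⊆ O ∧ ∃ S : Fin (Module.finrank 𝕜 F) → Π x, V x,
      IsLocalFrameOn I F ∞ S W ∧ ∀ k, IsParallelOn I F nabla (S k) W := by
  have _ : CompleteSpace E := FiniteDimensional.complete 𝕜 E
  have _ : CompleteSpace F := FiniteDimensional.complete 𝕜 F
  set e := trivializationAt F V x₀ with he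
  set eT := trivializationAt E (TangentSpace I : N → Type _) x₀ with heT
  set φ := extChartAt I x₀ with hφ
  let b := Module.finBasis 𝕜 F
  let c := Module.finBasis 𝕜 E
  let U₀ : Set N := O ∩ e.baseSet ∩ φ.source
  have hU₀ : IsOpen U₀ := (hO.inter e.open_baseSet).inter (isOpen_extChartAt_source x₀)
  have hTb : φ.source ⊆ eT.baseSet := by
    intro y hy
    have hy' : y ∈ (chartAt H x₀).source := by simpa [hφ] using hy
    simpa [heT] using hy'
  let dh : E → Π y : N, TangentSpace I y := fun h y ↦ eT.symm y h
  let sc : F → Π y : N, V y := fun v y ↦ e.symm y v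
  have hdh : ∀ h, SmoothSectionOn I E (dh h) U₀ := fun h ↦
    (smoothSectionOn_symm (I := I) eT h).mono' fun y hy ↦ hTb hy.2
  have hsc : ∀ v, SmoothSectionOn I F (sc v) U₀ := fun v ↦
    (smoothSectionOn_symm (I := I) e v).mono' fun y hy ↦ hy.1.2
  let θ : N → E →L[𝕜] F →L[𝕜] F := fun y ↦ ∑ i, ∑ k,
    (LinearMap.toContinuousLinearMap (c.coord i)).smulRight
      ((LinearMap.toContinuousLinearMap (b.coord k)).smulRight
        (e ⟨y, nabla (sc (b k)) y (dh (c i) y)⟩).2)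
  have hθa : ∀ y h v, θ y h v = ∑ i, ∑ k, c.repr h i • b.repr v k •
      (e ⟨y, nabla (sc (b k)) y (dh (c i) y)⟩).2 := by
    intro y h v
    simp [θ, sum_apply]
  have hθ : ∀ y ∈ U₀, ContMDiffAt I 𝓘(𝕜, E →L[𝕜] F →L[𝕜] F) ∞ θ y := by
    intro y hy
    refine ContMDiffAt.sum fun i _ ↦ ContMDiffAt.sum fun k _ ↦ ?_
    have h1 : ContMDiffAt I 𝓘(𝕜, F) ∞
        (fun y ↦ (e ⟨y, nabla (sc (b k)) y (dh (c i) y)⟩).2) y :=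
      (e.contMDiffAt_section_iff hy.1.2).1
        ((hn U₀ _ _ hU₀ (hdh (c i)) (hsc (b k))).contMDiffAt hU₀ hy)
    have h2 := (ContinuousLinearMap.smulRightL 𝕜 F F
      (LinearMap.toContinuousLinearMap (b.coord k))).contMDiff.contMDiffAt.comp (I' := 𝓘(𝕜, F)) y h1
    exact (ContinuousLinearMap.smulRightL 𝕜 E (F →L[𝕜] F)
      (LinearMap.toContinuousLinearMap (c.coord i))).contMDiff.contMDiffAt.comp
        (I' := 𝓘(𝕜, F →L[𝕜] F)) y h2
  have hdhsum : ∀ h, ∀ y ∈ U₀, dh h y = ∑ i, c.repr h i • dh (c i) y := by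
    intro h y hy
    apply mvfderiv_extChartAt_injective hy.2
    simp only [map_sum, map_smul]
    rw [mvfderiv_extChartAt_symm hy.2]
    refine (c.sum_repr h).symm.trans (Finset.sum_congr rfl fun i _ ↦ ?_)
    rw [mvfderiv_extChartAt_symm hy.2]
  have hdu : ∀ y ∈ U₀, ∀ u, dh (mvfderiv I φ y u) y = u := fun y hy u ↦
    symm_mvfderiv_extChartAt hy.2 u
  have hconn : ∀ (s : Π y, V y) (y : N), y ∈ U₀ → MDiffAt (T% s) y → ∀ u,
      (e ⟨y, nabla s y u⟩).2 = mvfderiv I (fun y ↦ (e ⟨y, s y⟩).2) y u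
        + θ y (mvfderiv I φ y u) (e ⟨y, s y⟩).2 := by
    intro s y hy hs u
    rw [snd_nabla_apply nabla e b hy.1.2 hs u, hθa, Finset.sum_comm]
    congr 1
    refine Finset.sum_congr rfl fun k _ ↦ ?_
    have h1 : (e ⟨y, nabla (sc (b k)) y u⟩).2 = ∑ i, c.repr (mvfderiv I φ y u) i •
        (e ⟨y, nabla (sc (b k)) y (dh (c i) y)⟩).2 := by
      conv_lhs => rw [← hdu y hy u, hdhsum _ y hy, map_sum]
      rw [snd_apply_eq 𝕜 e hy.1.2, map_sum]
      simp only [map_smul, ← snd_apply_eq 𝕜 e hy.1.2, snd_apply_smul e hy.1.2]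
    change b.repr (e ⟨y, s y⟩).2 k • (e ⟨y, nabla (sc (b k)) y u⟩).2 = _
    rw [h1, Finset.smul_sum]
    exact Finset.sum_congr rfl fun i _ ↦ smul_comm _ _ _
  have hconst : ∀ v, ∀ y ∈ U₀, ∀ h, (e ⟨y, nabla (sc v) y (dh h y)⟩).2 = θ y h v := by
    intro v y hy h
    rw [hconn (sc v) y hy ((hsc v).mdiffAt hU₀ hy), snd_apply_symm e hy.1.2,
      mvfderiv_extChartAt_symm hy.2, mvfderiv_congr (g := fun _ ↦ v) (eventually_of_mem
      (hU₀.mem_nhds hy) fun z hz ↦ snd_apply_symm e hz.1.2 v), mvfderiv_const]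
    exact zero_add _
  let B : E → E →L[𝕜] F →L[𝕜] F := fun z ↦ θ (φ.symm z)
  let O' : Set E := φ.target ∩ φ.symm ⁻¹' U₀
  have hO' : IsOpen O' := (continuousOn_extChartAt_symm x₀).isOpen_inter_preimage
    (isOpen_extChartAt_target x₀) hU₀
  have hB : ContDiffOn 𝕜 ∞ B O' := by
    rw [← contMDiffOn_iff_contDiffOn]
    intro z hz
    have h1 : ContMDiffAt 𝓘(𝕜, E) I ∞ φ.symm z :=
      (contMDiffOn_extChartAt_symm (I := I) x₀).contMDiffAt
        ((isOpen_extChartAt_target x₀).mem_nhds hz.1)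
    exact ((hθ _ hz.2).comp (I' := I) z h1).contMDiffWithinAt
  have hBφ : ∀ y ∈ U₀, B (φ y) = θ y := fun y hy ↦ by
    simp only [B, φ.left_inv hy.2]
  have hflat' : ∀ p ∈ O', ∀ h k v, fderiv 𝕜 B p h k v - fderiv 𝕜 B p k h v
      + B p h (B p k v) - B p k (B p h v) = 0 := by
    intro p hp h k v
    set x := φ.symm p with hx
    have hpx : φ x = p := φ.right_inv hp.1
    have hxU : x ∈ U₀ := hp.2
    have hc0 := hflat U₀ hU₀ (fun y hy ↦ hy.1.1) (dh h) (dh k) (sc v) (hdh h) (hdh k) (hsc v) x hxU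
    rw [curvature, mlieBracket_coordinate_eq_zero hxU.2, map_zero, sub_zero, sub_eq_zero] at hc0
    have hder : ∀ h k, (e ⟨x, nabla (fun y ↦ nabla (sc v) y (dh k y)) x (dh h x)⟩).2 =
        fderiv 𝕜 B p h k v + B p h (B p k v) := by
      intro h k
      rw [hconn _ x hxU ((hn U₀ _ _ hU₀ (hdh k) (hsc v)).mdiffAt hU₀ hxU), hconst v x hxU,
        mvfderiv_extChartAt_symm hxU.2]
      congr 1
      rw [mvfderiv_congr (g := fun y ↦ θ y k v) (eventually_of_mem
        (hU₀.mem_nhds hxU) fun z hz ↦ hconst v z hz k)]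
      have hev : (fun y ↦ θ y k v) =ᶠ[𝓝 x] (fun z ↦ B z k v) ∘ φ := by
        filter_upwards [hU₀.mem_nhds hxU] with y hy
        simp only [Function.comp_apply, hBφ y hy]
      have hBd : DifferentiableAt 𝕜 B (φ x) := by
        rw [hpx]
        exact (hB.contDiffAt (hO'.mem_nhds hp)).differentiableAt (by simp)
      have hBd2 : DifferentiableAt 𝕜 (fun z ↦ B z k v) (φ x) :=
        (hBd.clm_apply (differentiableAt_const k)).clm_apply (differentiableAt_const v)
      rw [mvfderiv_congr hev]
      change mfderiv I 𝓘(𝕜, F) ((fun z ↦ B z k v) ∘ φ) x (dh h x) = _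
      rw [mfderiv_comp (I' := 𝓘(𝕜, E)) x hBd2.mdifferentiableAt
        (mdifferentiableAt_extChartAt (by simpa [hφ] using hxU.2)), mfderiv_eq_fderiv]
      change fderiv 𝕜 (fun z ↦ B z k v) (φ x) (mvfderiv I φ x (dh h x)) = _
      rw [mvfderiv_extChartAt_symm hxU.2, fderiv_clm_apply
        (hBd.clm_apply (differentiableAt_const k)) (differentiableAt_const v),
        fderiv_clm_apply hBd (differentiableAt_const k), hpx]
      simp
    have h3 := congrArg (fun a ↦ (e ⟨x, a⟩).2) hc0
    simp only [hder] at h3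
    rw [sub_add_eq_add_sub, sub_sub, sub_eq_zero, h3, add_comm]
  have hx₀U : x₀ ∈ U₀ :=
    ⟨⟨hx₀, FiberBundle.mem_baseSet_trivializationAt' x₀⟩, mem_extChartAt_source x₀⟩
  have hz₀ : φ x₀ ∈ O' := ⟨mem_extChartAt_target x₀, by
    rw [mem_preimage, φ.left_inv hx₀U.2]; exact hx₀U⟩
  have hex := fun k ↦ exists_parallel_of_flat hO' hB hflat' hz₀ (b k)
  choose W' hW'o hW'z hW'O f hfs hf0 hfd using hex
  let T : E → (Fin (Module.finrank 𝕜 F) → 𝕜) →L[𝕜] F := fun z ↦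
    ∑ i, (ContinuousLinearMap.proj i : (Fin (Module.finrank 𝕜 F) → 𝕜) →L[𝕜] 𝕜).smulRight (f i z)
  have hTa : ∀ z a, T z a = ∑ i, a i • f i z := by
    intro z a
    simp [T, sum_apply]
  let W₁ : Set E := O' ∩ ⋂ k, W' k
  have hW₁ : IsOpen W₁ := hO'.inter (isOpen_iInter_of_finite hW'o)
  have hT : ContinuousOn T W₁ := by
    refine continuousOn_finsetSum _ fun i _ ↦ ?_
    exact (ContinuousLinearMap.smulRightL 𝕜 (Fin (Module.finrank 𝕜 F) → 𝕜) F
      (ContinuousLinearMap.proj i)).continuous.comp_continuousOn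
      ((hfs i).continuousOn.mono (inter_subset_right.trans (iInter_subset _ i)))
  let W₂ : Set E := W₁ ∩ T ⁻¹'
    (range ((↑) : ((Fin (Module.finrank 𝕜 F) → 𝕜) ≃L[𝕜] F) → _ →L[𝕜] F))
  have hW₂ : IsOpen W₂ := hT.isOpen_inter_preimage hW₁ (ContinuousLinearEquiv.isOpen)
  have hzW₂ : φ x₀ ∈ W₂ := by
    refine ⟨⟨hz₀, mem_iInter.2 hW'z⟩, b.equivFun.symm.toContinuousLinearEquiv, ?_⟩
    ext1 a
    rw [hTa]
    simp only [hf0]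
    exact b.equivFun_symm_apply a
  let W : Set N := φ.source ∩ φ ⁻¹' W₂
  have hW : IsOpen W := (continuousOn_extChartAt x₀).isOpen_inter_preimage
    (isOpen_extChartAt_source x₀) hW₂
  have hWU : W ⊆ U₀ := by
    intro y hy
    have h1 := hy.2.1.1.2
    rwa [mem_preimage, φ.left_inv hy.1] at h1
  have hbasis : ∀ y ∈ W, ∃ β : Module.Basis (Fin (Module.finrank 𝕜 F)) 𝕜 (V y),
      ∀ k, β k = e.symm y (f k (φ y)) := by
    intro y hy
    obtain ⟨L, hL⟩ := hy.2.2
    have hye := (hWU hy).1.2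
    refine ⟨(Pi.basisFun 𝕜 _).map (L.toLinearEquiv.trans (e.linearEquivAt 𝕜 y hye).symm),
      fun k ↦ ?_⟩
    have h1 : L (Pi.single k 1) = f k (φ y) := by
      have h2 : L (Pi.single k 1) = T (φ y) (Pi.single k 1) := by rw [← hL]; rfl
      rw [h2, hTa, Finset.sum_eq_single k]
      · simp
      · intro j _ hj
        simp [hj]
      · simp
    simp only [Module.Basis.map_apply, Pi.basisFun_apply, LinearEquiv.trans_apply]
    exact congrArg (e.symm y) h1
  have hfφ : ∀ k, ∀ y ∈ W, ContMDiffAt I 𝓘(𝕜, F) ∞ (fun y ↦ f k (φ y)) y := by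
    intro k y hy
    have h1 : ContDiffAt 𝕜 ∞ (f k) (φ y) := (hfs k).contDiffAt
      ((hW'o k).mem_nhds (mem_iInter.1 hy.2.1.2 k))
    exact h1.contMDiffAt.comp (I' := 𝓘(𝕜, E)) y
      (contMDiffAt_extChartAt' (by simpa [hφ] using hy.1))
  have hSs : ∀ k, SmoothSectionOn I F (fun y ↦ e.symm y (f k (φ y))) W := by
    intro k y hy
    refine ContMDiffAt.contMDiffWithinAt ?_
    rw [e.contMDiffAt_section_iff (hWU hy).1.2]
    refine (hfφ k y hy).congr_of_eventuallyEq ?_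
    filter_upwards [hW.mem_nhds hy] with z hz
    exact snd_apply_symm e (hWU hz).1.2 _
  refine ⟨W, hW, ⟨mem_extChartAt_source x₀, hzW₂⟩, fun y hy ↦ (hWU hy).1.1,
    fun k y ↦ e.symm y (f k (φ y)), ⟨?_, ?_, hSs⟩, ?_⟩
  · intro y hy
    obtain ⟨β, hβ⟩ := hbasis y hy
    simp only [← hβ]
    exact β.linearIndependent
  · intro y hy
    obtain ⟨β, hβ⟩ := hbasis y hy
    simp only [← hβ]
    exact β.span_eq.ge
  · intro k y hy
    have hye := (hWU hy).1.2
    ext u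
    apply (e.linearEquivAt 𝕜 y hye).injective
    rw [← snd_apply_eq 𝕜 e hye, hconn _ y (hWU hy) ((hSs k).mdiffAt hW hy),
      snd_apply_symm e hye, mvfderiv_congr (g := f k ∘ φ)
        (f := fun y ↦ (e ⟨y, e.symm y (f k (φ y))⟩).2) (eventually_of_mem
        (hW.mem_nhds hy) fun z hz ↦ snd_apply_symm e (hWU hz).1.2 _)]
    have hd := hfd k (φ y) (mem_iInter.1 hy.2.1.2 k)
    change mfderiv I 𝓘(𝕜, F) (f k ∘ φ) y u + _ = _
    rw [mfderiv_comp (I' := 𝓘(𝕜, E)) y hd.differentiableAt.mdifferentiableAt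
      (mdifferentiableAt_extChartAt (by simpa [hφ] using hy.1)), mfderiv_eq_fderiv, hd.fderiv,
      hBφ y (hWU hy), zero_apply, map_zero]
    exact neg_add_cancel _

end ParallelFrames

section Derivatives

set_option maxSynthPendingDepth 3

variable {𝕜 : Type*} [RCLike 𝕜]
  {E : Type*} [NormedAddCommGroup E] [NormedSpace 𝕜 E]
  {H : Type*} [TopologicalSpace H] {I : ModelWithCorners 𝕜 E H}
  {N : Type*} [TopologicalSpace N] [ChartedSpace H N]
  {E' : Type*} [NormedAddCommGroup E'] [NormedSpace 𝕜 E']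
  {H' : Type*} [TopologicalSpace H'] {I' : ModelWithCorners 𝕜 E' H'}
  {N' : Type*} [TopologicalSpace N'] [ChartedSpace H' N']
  {G : Type*} [NormedAddCommGroup G] [NormedSpace 𝕜 G]
  {G' : Type*} [NormedAddCommGroup G'] [NormedSpace 𝕜 G']

theorem mvfderiv_clm_comp (L : G →L[𝕜] G') {f : N → G} {x : N} (hf : MDiffAt f x)
    (u : TangentSpace I x) : mvfderiv I (fun y ↦ L (f y)) x u = L (mvfderiv I f x u) := by
  change mfderiv I 𝓘(𝕜, G') (L ∘ f) x u = _
  rw [mfderiv_comp x L.differentiableAt.mdifferentiableAt hf, mfderiv_eq_fderiv,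
    ContinuousLinearMap.fderiv]
  rfl

theorem mvfderiv_comp_mfderiv {f : N → N'} {h : N' → G} {x : N} (hh : MDiffAt h (f x))
    (hf : MDiffAt f x) (u : TangentSpace I x) :
    mvfderiv I (fun y ↦ h (f y)) x u = mvfderiv I' h (f x) (mfderiv I I' f x u) := by
  change mfderiv I 𝓘(𝕜, G) (h ∘ f) x u = _
  rw [mfderiv_comp x hh hf]
  rfl

theorem mvfderiv_smul_apply {c : N → 𝕜} {f : N → G} {x : N} (hc : MDiffAt c x) (hf : MDiffAt f x)
    (u : TangentSpace I x) : mvfderiv I (fun y ↦ c y • f y) x u =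
      c x • mvfderiv I f x u + mvfderiv I c x u • f x :=
  congrArg (fun L ↦ L u) (mvfderiv_smul hc hf)

theorem mvfderiv_add_apply {f h : N → G} {x : N} (hf : MDiffAt f x) (hh : MDiffAt h x)
    (u : TangentSpace I x) : mvfderiv I (fun y ↦ f y + h y) x u =
      mvfderiv I f x u + mvfderiv I h x u :=
  congrArg (fun L ↦ L u) (mvfderiv_add hf hh)

theorem mvfderiv_sub_apply {f h : N → G} {x : N} (hf : MDiffAt f x) (hh : MDiffAt h x)
    (u : TangentSpace I x) : mvfderiv I (fun y ↦ f y - h y) x u =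
      mvfderiv I f x u - mvfderiv I h x u :=
  congrArg (fun L ↦ L u) (mvfderiv_sub hf hh)

theorem mvfderiv_const_apply (c : G) {x : N} (u : TangentSpace I x) :
    mvfderiv I (fun _ ↦ c) x u = 0 := by
  rw [mvfderiv_const]; rfl

theorem mdiffAt_finsetSum {ι : Type*} {A : Finset ι} {f : ι → N → G} {x : N}
    (hf : ∀ i ∈ A, MDiffAt (f i) x) : MDiffAt (fun y ↦ ∑ i ∈ A, f i y) x := by
  classical
  induction A using Finset.induction_on with
  | empty => simpa using mdifferentiableAt_const
  | insert i A hi ih =>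
    simp only [Finset.sum_insert hi]
    exact (hf i (Finset.mem_insert_self i A)).add
      (ih fun j hj ↦ hf j (Finset.mem_insert_of_mem hj))

theorem mvfderiv_sum_apply {ι : Type*} (A : Finset ι) {f : ι → N → G} {x : N}
    (hf : ∀ i ∈ A, MDiffAt (f i) x) (u : TangentSpace I x) :
    mvfderiv I (fun y ↦ ∑ i ∈ A, f i y) x u = ∑ i ∈ A, mvfderiv I (f i) x u := by
  classical
  induction A using Finset.induction_on with
  | empty => simpa using mvfderiv_const_apply (I := I) (0 : G) u
  | insert i A hi ih =>
    simp only [Finset.sum_insert hi]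
    rw [mvfderiv_add_apply (h := fun y ↦ ∑ i ∈ A, f i y) (hf i (Finset.mem_insert_self i A))
      (mdiffAt_finsetSum fun j hj ↦ hf j (Finset.mem_insert_of_mem hj)),
      ih fun j hj ↦ hf j (Finset.mem_insert_of_mem hj)]

theorem mvfderiv_prodMk_apply {f : N → G} {h : N → G'} {x : N} (hf : MDiffAt f x)
    (hh : MDiffAt h x) (u : TangentSpace I x) :
    mvfderiv I (fun y ↦ (f y, h y)) x u = (mvfderiv I f x u, mvfderiv I h x u) := by
  have h1 : MDifferentiableAt I 𝓘(𝕜, G × G') (fun y ↦ (f y, h y)) x := hf.prodMk_space hh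
  refine Prod.ext ?_ ?_
  · exact (mvfderiv_clm_comp (ContinuousLinearMap.fst 𝕜 G G') h1 u).symm
  · exact (mvfderiv_clm_comp (ContinuousLinearMap.snd 𝕜 G G') h1 u).symm

theorem mvfderiv_clm_apply_apply {C : N → G →L[𝕜] G'} {f : N → G} {x : N} (hC : MDiffAt C x)
    (hf : MDiffAt f x) (u : TangentSpace I x) :
    mvfderiv I (fun y ↦ C y (f y)) x u = mvfderiv I C x u (f x) + C x (mvfderiv I f x u) := by
  have h1 : MDifferentiableAt I 𝓘(𝕜, (G →L[𝕜] G') × G) (fun y ↦ (C y, f y)) x :=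
    hC.prodMk_space hf
  have h2 : DifferentiableAt 𝕜 (fun p : (G →L[𝕜] G') × G ↦ p.1 p.2) (C x, f x) :=
    differentiableAt_fst.clm_apply differentiableAt_snd
  have h3 := mvfderiv_comp_mfderiv (I' := 𝓘(𝕜, (G →L[𝕜] G') × G))
    (f := fun y ↦ (C y, f y)) (x := x) h2.mdifferentiableAt h1 u
  have h4 := mvfderiv_prodMk_apply hC hf u
  change mvfderiv I (fun y ↦ C y (f y)) x u = _ at h3
  rw [h3]
  change mfderiv 𝓘(𝕜, (G →L[𝕜] G') × G) 𝓘(𝕜, G') _ _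
    (mvfderiv I (fun y ↦ (C y, f y)) x u) = _
  rw [h4, mfderiv_eq_fderiv, fderiv_clm_apply differentiableAt_fst differentiableAt_snd]
  change (C x) (fderiv 𝕜 Prod.snd (C x, f x) _) + (fderiv 𝕜 Prod.fst (C x, f x) _) (f x) = _
  rw [fderiv_fst, fderiv_snd, add_comm]
  rfl

end Derivatives

section TotalSpaceCalculus

set_option maxSynthPendingDepth 3

variable {𝕜 : Type*} [RCLike 𝕜]
  {E : Type*} [NormedAddCommGroup E] [NormedSpace 𝕜 E] [FiniteDimensional 𝕜 E]
  {M : Type*} [TopologicalSpace M] [ChartedSpace E M] [IsManifold 𝓘(𝕜, E) ∞ M]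
  {F : Type*} [NormedAddCommGroup F] [NormedSpace 𝕜 F] [FiniteDimensional 𝕜 F]
  {V : M → Type*} [TopologicalSpace (TotalSpace F V)]
  [∀ x, AddCommGroup (V x)] [∀ x, Module 𝕜 (V x)] [∀ x, TopologicalSpace (V x)]
  [∀ x, IsTopologicalAddGroup (V x)] [∀ x, ContinuousSMul 𝕜 (V x)]
  [FiberBundle F V] [VectorBundle 𝕜 F V] [ContMDiffVectorBundle ∞ F V 𝓘(𝕜, E)]

variable (D : CovariantDerivative 𝓘(𝕜, E) F V)
  (e : Trivialization F (TotalSpace.proj : TotalSpace F V → M)) [MemTrivializationAtlas e]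

theorem contMDiffAt_fiberCoord {w : TotalSpace F V} (hw : w.proj ∈ e.baseSet) :
    ContMDiffAt (𝓘(𝕜, E).prod 𝓘(𝕜, F)) 𝓘(𝕜, F) ∞ (fun v : TotalSpace F V ↦ (e v).2) w := by
  have h1 : ContMDiffAt (𝓘(𝕜, E).prod 𝓘(𝕜, F)) (𝓘(𝕜, E).prod 𝓘(𝕜, F)) ∞ e w :=
    e.contMDiffOn.contMDiffAt (e.open_source.mem_nhds (e.mem_source.2 hw))
  exact contMDiffAt_snd.comp w h1

theorem mdiffAt_proj (w : TotalSpace F V) :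
    MDifferentiableAt (𝓘(𝕜, E).prod 𝓘(𝕜, F)) 𝓘(𝕜, E) (TotalSpace.proj : TotalSpace F V → M) w :=
  (Bundle.contMDiffAt_proj (n := 1) V).mdifferentiableAt (by simp)

/-- The derivative of the pull-back of a function on the base. -/
theorem mvfderiv_comp_proj {G : Type*} [NormedAddCommGroup G] [NormedSpace 𝕜 G] {f : M → G}
    {w : TotalSpace F V} (hf : MDiffAt f w.proj) (W : TotalTangent 𝕜 (E := E) w) :
    mvfderiv (𝓘(𝕜, E).prod 𝓘(𝕜, F)) (fun v : TotalSpace F V ↦ f v.proj) w W =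
      mvfderiv 𝓘(𝕜, E) f w.proj (projDeriv w W) :=
  mvfderiv_comp_mfderiv (I' := 𝓘(𝕜, E)) hf (mdiffAt_proj w) W

/-- The connection form of `D` in a trivialization. -/
def connForm (x : M) (u : TangentSpace 𝓘(𝕜, E) x) : F →ₗ[𝕜] F :=
  ∑ k, ((Module.finBasis 𝕜 F).coord k).smulRight
    (e ⟨x, D (fun y ↦ e.symm y (Module.finBasis 𝕜 F k)) x u⟩).2

theorem connForm_apply (x : M) (u : TangentSpace 𝓘(𝕜, E) x) (a : F) :
    connForm D e x u a = ∑ k, (Module.finBasis 𝕜 F).repr a k •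
      (e ⟨x, D (fun y ↦ e.symm y (Module.finBasis 𝕜 F k)) x u⟩).2 := by
  simp [connForm, LinearMap.sum_apply]

theorem snd_connection_apply {x : M} (hx : x ∈ e.baseSet) {s : Π y, V y} (hs : MDiffAt (T% s) x)
    (u : TangentSpace 𝓘(𝕜, E) x) :
    (e ⟨x, D s x u⟩).2 = mvfderiv 𝓘(𝕜, E) (fun y ↦ (e ⟨y, s y⟩).2) x u
      + connForm D e x u (e ⟨x, s x⟩).2 := by
  rw [snd_nabla_apply D e (Module.finBasis 𝕜 F) hx hs u, connForm_apply]

theorem snd_connection_symm {x : M} (hx : x ∈ e.baseSet) (a : F) (u : TangentSpace 𝓘(𝕜, E) x) :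
    (e ⟨x, D (fun y ↦ e.symm y a) x u⟩).2 = connForm D e x u a := by
  rw [snd_connection_apply D e hx
    ((smoothSectionOn_symm (I := 𝓘(𝕜, E)) e a).mdiffAt e.open_baseSet hx), snd_apply_symm e hx,
    mvfderiv_congr (g := fun _ ↦ a) (eventually_of_mem (e.open_baseSet.mem_nhds hx) fun y hy ↦
      snd_apply_symm e hy a), mvfderiv_const_apply, zero_add]

/-- The connection map in an arbitrary trivialization. -/
theorem snd_connectionMap_apply {w : TotalSpace F V} (hw : w.proj ∈ e.baseSet)
    (W : TotalTangent 𝕜 (E := E) w) :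
    (e ⟨w.proj, connectionMap D w W⟩).2 = mvfderiv (𝓘(𝕜, E).prod 𝓘(𝕜, F)) (fun v : TotalSpace F V ↦ (e v).2) w W
      + connForm D e w.proj (projDeriv w W) (e w).2 := by
  set e' := trivializationAt F V w.proj with he'
  have hw' : w.proj ∈ e'.baseSet := FiberBundle.mem_baseSet_trivializationAt' w.proj
  set a := (e' w).2 with ha
  have hext : FiberBundle.extend F w.2 = fun y ↦ e'.symm y a := rfl
  have hw2 : e'.symm w.proj a = w.2 := e'.symm_apply_apply_mk hw' w.2
  let C : M → F →L[𝕜] F := fun y ↦ e'.coordChangeL 𝕜 e y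
  have hC : ContMDiffAt 𝓘(𝕜, E) 𝓘(𝕜, F →L[𝕜] F) ∞ C w.proj := contMDiffAt_coordChangeL hw' hw
  have hCa : ∀ y ∈ e'.baseSet ∩ e.baseSet, ∀ a, C y a = (e ⟨y, e'.symm y a⟩).2 :=
    fun y hy a ↦ e'.coordChangeL_apply e hy a
  have hO : e'.baseSet ∩ e.baseSet ∈ 𝓝 w.proj :=
    (e'.open_baseSet.inter e.open_baseSet).mem_nhds ⟨hw', hw⟩
  have hφ : (fun v : TotalSpace F V ↦ (e v).2) =ᶠ[𝓝 w] fun v ↦ C v.proj (e' v).2 := by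
    filter_upwards [(FiberBundle.continuous_proj F V).continuousAt.preimage_mem_nhds hO] with v hv
    rw [hCa _ hv]
    congr 2
    exact (congrArg (TotalSpace.mk v.proj) (e'.symm_apply_apply_mk hv.1 v.2)).symm
  have hCJ : MDifferentiableAt (𝓘(𝕜, E).prod 𝓘(𝕜, F)) 𝓘(𝕜, F →L[𝕜] F) (fun v : TotalSpace F V ↦ C v.proj) w :=
    (contMDiffAt_fun_mdiffAt hC).comp w (mdiffAt_proj w)
  have hs := (smoothSectionOn_symm (I := 𝓘(𝕜, E)) e' a).mdiffAt e'.open_baseSet hw'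
  have h1 : mvfderiv (𝓘(𝕜, E).prod 𝓘(𝕜, F)) (fun v : TotalSpace F V ↦ (e v).2) w W =
      mvfderiv 𝓘(𝕜, E) C w.proj (projDeriv w W) a + C w.proj (fiberCoordDeriv w W) := by
    rw [mvfderiv_congr hφ, mvfderiv_clm_apply_apply hCJ
      (contMDiffAt_fun_mdiffAt (contMDiffAt_fiberCoord e' hw')),
      mvfderiv_comp_proj (contMDiffAt_fun_mdiffAt hC)]
    rfl
  have h2 : mvfderiv 𝓘(𝕜, E) (fun y ↦ (e ⟨y, e'.symm y a⟩).2) w.proj (projDeriv w W) =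
      mvfderiv 𝓘(𝕜, E) C w.proj (projDeriv w W) a := by
    rw [mvfderiv_congr (g := fun y ↦ C y a) (eventually_of_mem hO fun y hy ↦ (hCa y hy a).symm),
      mvfderiv_clm_apply_apply (contMDiffAt_fun_mdiffAt hC) mdifferentiableAt_const,
      mvfderiv_const_apply, map_zero, add_zero]
  have h3 : connectionMap D w W = e'.symm w.proj (fiberCoordDeriv w W)
      + D (fun y ↦ e'.symm y a) w.proj (projDeriv w W) := by
    rw [← e'.symmL_apply (R := 𝕜) hw', ← hext]
    rfl
  rw [h3, snd_apply_add 𝕜 e hw, snd_connection_apply D e hw hs, h1, h2, hw2, ← hCa _ ⟨hw', hw⟩]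
  abel

/-- A field on the total space is smooth if its components are. -/
theorem contMDiffAt_totalField {Z : Π v : TotalSpace F V, TangentSpace (𝓘(𝕜, E).prod 𝓘(𝕜, F)) v} {x₀ : M}
    {w : TotalSpace F V} (hx₀ : w.proj = x₀)
    (h1 : ContMDiffAt (𝓘(𝕜, E).prod 𝓘(𝕜, F)) 𝓘(𝕜, E) ∞ (fun v : TotalSpace F V ↦
      mvfderiv (𝓘(𝕜, E).prod 𝓘(𝕜, F)) (fun v' : TotalSpace F V ↦ extChartAt 𝓘(𝕜, E) x₀ v'.proj) v (Z v)) w)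
    (h2 : ContMDiffAt (𝓘(𝕜, E).prod 𝓘(𝕜, F)) 𝓘(𝕜, F) ∞ (fun v : TotalSpace F V ↦
      mvfderiv (𝓘(𝕜, E).prod 𝓘(𝕜, F)) (fun v' : TotalSpace F V ↦ (trivializationAt F V x₀ v').2) v (Z v)) w) :
    CMDiffAt ∞ (T% Z) w := by
  subst hx₀
  have h := contMDiffAt_vectorField_iff (I := 𝓘(𝕜, E).prod 𝓘(𝕜, F)) (n := ⊤) (Z := Z) (mem_extChartAt_source w)
  refine h.2 ?_
  have h3 := h1.prodMk_space h2
  refine ContMDiffAt.congr_of_eventuallyEq h3 ?_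
  have hO : (trivializationAt F V w.proj).baseSet ∩ (extChartAt 𝓘(𝕜, E) w.proj).source ∈
      𝓝 w.proj := Filter.inter_mem ((trivializationAt F V w.proj).open_baseSet.mem_nhds
      (FiberBundle.mem_baseSet_trivializationAt' w.proj)) (extChartAt_source_mem_nhds w.proj)
  filter_upwards [eventually_eventually_nhds.2
    ((FiberBundle.continuous_proj F V).continuousAt.preimage_mem_nhds hO)] with v hv
  have hv' := mem_of_mem_nhds hv
  rw [mvfderiv_congr (g := fun v' : TotalSpace F V ↦ (extChartAt 𝓘(𝕜, E) w.proj v'.proj,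
    (trivializationAt F V w.proj v').2))]
  · refine mvfderiv_prodMk_apply ?_ ?_ (Z v)
    · exact MDifferentiableAt.comp (I' := 𝓘(𝕜, E)) v
        (mdifferentiableAt_extChartAt (by simpa using hv'.2)) (mdiffAt_proj v)
    · exact contMDiffAt_fun_mdiffAt (contMDiffAt_fiberCoord _ hv'.1)
  · filter_upwards [hv] with v' hv'
    rw [FiberBundle.extChartAt]
    simp only [PartialEquiv.trans_apply, PartialEquiv.prod_coe, PartialEquiv.refl_coe, id]
    change (extChartAt 𝓘(𝕜, E) w.proj (trivializationAt F V w.proj v').1,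
      (trivializationAt F V w.proj v').2) = _
    rw [((trivializationAt F V w.proj).coe_fst' hv'.1)]

variable {D}

/-- A field on the total space with smooth horizontal and vertical parts on the base is smooth. -/
theorem smoothSectionOn_totalField (hD : PreservesSmooth D)
    {Z : Π v : TotalSpace F V, TangentSpace (𝓘(𝕜, E).prod 𝓘(𝕜, F)) v} {U : Set M} (hU : IsOpen U)
    {X : Π x : M, TangentSpace 𝓘(𝕜, E) x} {s : Π x : M, V x}
    (hX : SmoothSectionOn 𝓘(𝕜, E) E X U) (hs : SmoothSectionOn 𝓘(𝕜, E) F s U)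
    (hZX : ∀ v : TotalSpace F V, v.proj ∈ U → projDeriv v (Z v) = X v.proj)
    (hZs : ∀ v : TotalSpace F V, v.proj ∈ U → connectionMap D v (Z v) = s v.proj) :
    SmoothSectionOn (𝓘(𝕜, E).prod 𝓘(𝕜, F)) (E × F) Z (TotalSpace.proj ⁻¹' U : Set (TotalSpace F V)) := by
  intro w hw
  refine ContMDiffAt.contMDiffWithinAt ?_
  set e := trivializationAt F V w.proj with he
  have hwe : w.proj ∈ e.baseSet := FiberBundle.mem_baseSet_trivializationAt' w.proj
  have hpr : ContMDiffAt (𝓘(𝕜, E).prod 𝓘(𝕜, F)) 𝓘(𝕜, E) ∞ (TotalSpace.proj : TotalSpace F V → M) w :=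
    Bundle.contMDiffAt_proj V
  have hπ : ∀ {A : Set M}, A ∈ 𝓝 w.proj → ∀ᶠ v : TotalSpace F V in 𝓝 w, v.proj ∈ A := fun hA ↦
    (FiberBundle.continuous_proj F V).continuousAt.preimage_mem_nhds hA
  refine contMDiffAt_totalField (x₀ := w.proj) rfl ?_ ?_
  · have h1 : ContMDiffAt 𝓘(𝕜, E) 𝓘(𝕜, E) ∞
        (fun y ↦ mvfderiv 𝓘(𝕜, E) (extChartAt 𝓘(𝕜, E) w.proj) y (X y)) w.proj :=
      contMDiffAt_mvfderiv_apply contMDiffAt_extChartAt (hX.contMDiffAt hU hw)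
    refine (h1.comp (I' := 𝓘(𝕜, E)) w hpr).congr_of_eventuallyEq ?_
    filter_upwards [hπ (hU.mem_nhds hw), hπ (extChartAt_source_mem_nhds (I := 𝓘(𝕜, E)) w.proj)]
      with v hv hv2
    rw [mvfderiv_comp_proj (mdifferentiableAt_extChartAt (by simpa using hv2)), hZX v hv]
    rfl
  · have hφ := contMDiffAt_fiberCoord (𝕜 := 𝕜) (E := E) e hwe
    have h1 : ContMDiffAt 𝓘(𝕜, E) 𝓘(𝕜, F) ∞ (fun y ↦ (e ⟨y, s y⟩).2) w.proj :=
      (e.contMDiffAt_section_iff hwe).1 (hs.contMDiffAt hU hw)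
    have h2 : ∀ k, ContMDiffAt 𝓘(𝕜, E) 𝓘(𝕜, F) ∞
        (fun y ↦ (e ⟨y, D (fun y ↦ e.symm y (Module.finBasis 𝕜 F k)) y (X y)⟩).2) w.proj := by
      intro k
      refine (e.contMDiffAt_section_iff hwe).1 ?_
      refine (hD (U ∩ e.baseSet) _ _ (hU.inter e.open_baseSet) (hX.mono' inter_subset_left)
        ((smoothSectionOn_symm e _).mono' inter_subset_right)).contMDiffAt
        (hU.inter e.open_baseSet) ⟨hw, hwe⟩
    have h3 : ContMDiffAt (𝓘(𝕜, E).prod 𝓘(𝕜, F)) 𝓘(𝕜, F) ∞ (fun v : TotalSpace F V ↦ (e ⟨v.proj, s v.proj⟩).2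
        - ∑ k, (LinearMap.toContinuousLinearMap ((Module.finBasis 𝕜 F).coord k)) (e v).2 •
          (e ⟨v.proj, D (fun y ↦ e.symm y (Module.finBasis 𝕜 F k)) v.proj (X v.proj)⟩).2) w := by
      refine (h1.comp (I' := 𝓘(𝕜, E)) w hpr).sub (ContMDiffAt.sum fun k _ ↦ ?_)
      exact ((ContinuousLinearMap.contMDiff _).contMDiffAt.comp (I' := 𝓘(𝕜, F)) w hφ).smul
        ((h2 k).comp (I' := 𝓘(𝕜, E)) w hpr)
    refine h3.congr_of_eventuallyEq ?_
    filter_upwards [hπ (hU.mem_nhds hw), hπ (e.open_baseSet.mem_nhds hwe)] with v hv hve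
    rw [← hZs v hv, snd_connectionMap_apply D e hve, connForm_apply, hZX v hv]
    exact (add_sub_cancel_right _ _).symm

end TotalSpaceCalculus

section LiftFields

set_option maxSynthPendingDepth 3

variable {𝕜 : Type*} [RCLike 𝕜]
  {E : Type*} [NormedAddCommGroup E] [NormedSpace 𝕜 E] [FiniteDimensional 𝕜 E]
  {M : Type*} [TopologicalSpace M] [ChartedSpace E M] [IsManifold 𝓘(𝕜, E) ∞ M]
  {F : Type*} [NormedAddCommGroup F] [NormedSpace 𝕜 F] [FiniteDimensional 𝕜 F]
  {V : M → Type*} [TopologicalSpace (TotalSpace F V)]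
  [∀ x, AddCommGroup (V x)] [∀ x, Module 𝕜 (V x)] [∀ x, TopologicalSpace (V x)]
  [∀ x, IsTopologicalAddGroup (V x)] [∀ x, ContinuousSMul 𝕜 (V x)]
  [FiberBundle F V] [VectorBundle 𝕜 F V] [ContMDiffVectorBundle ∞ F V 𝓘(𝕜, E)]

/-- The field `X̃ + s` on the total space. -/
def liftField (D : CovariantDerivative 𝓘(𝕜, E) F V) (X : Π x : M, TangentSpace 𝓘(𝕜, E) x)
    (s : Π x : M, V x) (v : TotalSpace F V) : TangentSpace (𝓘(𝕜, E).prod 𝓘(𝕜, F)) v :=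
  horLift D v (X v.proj) + vertLift D v (s v.proj)

theorem totalTangent_ext (D : CovariantDerivative 𝓘(𝕜, E) F V) {v : TotalSpace F V}
    {W W' : TotalTangent 𝕜 (E := E) v} (h1 : projDeriv v W = projDeriv v W')
    (h2 : connectionMap D v W = connectionMap D v W') : W = W' :=
  splitMap_injective D v (Prod.ext h1 h2)

variable {D : CovariantDerivative 𝓘(𝕜, E) F V}

theorem projDeriv_liftField (X : Π x : M, TangentSpace 𝓘(𝕜, E) x) (s : Π x : M, V x)
    (v : TotalSpace F V) : projDeriv v (liftField D X s v) = X v.proj := by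
  rw [liftField, map_add, projDeriv_horLift, projDeriv_vertLift, add_zero]

theorem connectionMap_liftField (X : Π x : M, TangentSpace 𝓘(𝕜, E) x) (s : Π x : M, V x)
    (v : TotalSpace F V) : connectionMap D v (liftField D X s v) = s v.proj := by
  rw [liftField, map_add, connectionMap_horLift, connectionMap_vertLift, zero_add]

theorem smoothSectionOn_liftField (hD : PreservesSmooth D) {U : Set M} (hU : IsOpen U)
    {X : Π x : M, TangentSpace 𝓘(𝕜, E) x} {s : Π x : M, V x}
    (hX : SmoothSectionOn 𝓘(𝕜, E) E X U) (hs : SmoothSectionOn 𝓘(𝕜, E) F s U) :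
    SmoothSectionOn (𝓘(𝕜, E).prod 𝓘(𝕜, F)) (E × F) (liftField D X s) (TotalSpace.proj ⁻¹' U : Set (TotalSpace F V)) :=
  smoothSectionOn_totalField hD hU hX hs (fun _ _ ↦ projDeriv_liftField X s _)
    (fun _ _ ↦ connectionMap_liftField X s _)

theorem isOpen_proj_preimage {U : Set M} (hU : IsOpen U) :
    IsOpen (TotalSpace.proj ⁻¹' U : Set (TotalSpace F V)) :=
  hU.preimage (FiberBundle.continuous_proj F V)

variable {U : Set M} {X₁ X₂ : Π x : M, TangentSpace 𝓘(𝕜, E) x} {s₁ s₂ : Π x : M, V x}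

theorem projDeriv_mlieBracket_liftField (hD : PreservesSmooth D) (hU : IsOpen U)
    (hX₁ : SmoothSectionOn 𝓘(𝕜, E) E X₁ U) (hs₁ : SmoothSectionOn 𝓘(𝕜, E) F s₁ U)
    (hX₂ : SmoothSectionOn 𝓘(𝕜, E) E X₂ U) (hs₂ : SmoothSectionOn 𝓘(𝕜, E) F s₂ U)
    {w : TotalSpace F V} (hw : w.proj ∈ U) :
    projDeriv w (mlieBracket (𝓘(𝕜, E).prod 𝓘(𝕜, F)) (liftField D X₁ s₁) (liftField D X₂ s₂) w) =
      mlieBracket 𝓘(𝕜, E) X₁ X₂ w.proj := by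
  have _ : CompleteSpace E := FiniteDimensional.complete 𝕜 E
  have _ : CompleteSpace F := FiniteDimensional.complete 𝕜 F
  set φ := extChartAt 𝓘(𝕜, E) w.proj with hφ
  have hxφ : w.proj ∈ φ.source := mem_extChartAt_source _
  have hφs : ContMDiffAt 𝓘(𝕜, E) 𝓘(𝕜, E) ∞ φ w.proj := contMDiffAt_extChartAt
  have hpU := isOpen_proj_preimage (F := F) (V := V) hU
  have hZ₁ := (smoothSectionOn_liftField hD hU hX₁ hs₁).mdiffAt hpU hw
  have hZ₂ := (smoothSectionOn_liftField hD hU hX₂ hs₂).mdiffAt hpU hw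
  have hf : ContMDiffAt (𝓘(𝕜, E).prod 𝓘(𝕜, F)) 𝓘(𝕜, E) ∞ (fun v : TotalSpace F V ↦ φ v.proj) w :=
    hφs.comp (I' := 𝓘(𝕜, E)) w (Bundle.contMDiffAt_proj V)
  have hder : ∀ {X X' : Π x : M, TangentSpace 𝓘(𝕜, E) x} {s s' : Π x : M, V x},
      SmoothSectionOn 𝓘(𝕜, E) E X U →
      mvfderiv (𝓘(𝕜, E).prod 𝓘(𝕜, F)) (fun v : TotalSpace F V ↦ mvfderiv (𝓘(𝕜, E).prod 𝓘(𝕜, F)) (fun v : TotalSpace F V ↦ φ v.proj) v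
        (liftField D X s v)) w (liftField D X' s' w) =
      mvfderiv 𝓘(𝕜, E) (fun y ↦ mvfderiv 𝓘(𝕜, E) φ y (X y)) w.proj (X' w.proj) := by
    intro X X' s s' hX
    rw [mvfderiv_congr (g := fun v : TotalSpace F V ↦ mvfderiv 𝓘(𝕜, E) φ v.proj (X v.proj)),
      mvfderiv_comp_proj (f := fun y ↦ mvfderiv 𝓘(𝕜, E) φ y (X y)), projDeriv_liftField]
    · exact contMDiffAt_fun_mdiffAt (contMDiffAt_mvfderiv_apply hφs (hX.contMDiffAt hU hw))
    · filter_upwards [(isOpen_proj_preimage (F := F) (V := V)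
        (isOpen_extChartAt_source (I := 𝓘(𝕜, E)) w.proj)).mem_nhds hxφ] with v hv
      rw [mvfderiv_comp_proj (mdifferentiableAt_extChartAt (by simpa [hφ] using hv)),
        projDeriv_liftField]
  apply mvfderiv_extChartAt_injective hxφ
  rw [← hφ, ← mvfderiv_comp_proj (contMDiffAt_fun_mdiffAt hφs),
    mvfderiv_mlieBracket (hf.of_le (by norm_cast)) hZ₁ hZ₂,
    mvfderiv_mlieBracket (hφs.of_le (by norm_cast)) (hX₁.mdiffAt hU hw) (hX₂.mdiffAt hU hw),
    hder hX₂, hder hX₁]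

theorem connectionMap_mlieBracket_liftField (hD : PreservesSmooth D) (hU : IsOpen U)
    (hX₁ : SmoothSectionOn 𝓘(𝕜, E) E X₁ U) (hs₁ : SmoothSectionOn 𝓘(𝕜, E) F s₁ U)
    (hX₂ : SmoothSectionOn 𝓘(𝕜, E) E X₂ U) (hs₂ : SmoothSectionOn 𝓘(𝕜, E) F s₂ U)
    (e : Trivialization F (TotalSpace.proj : TotalSpace F V → M)) [MemTrivializationAtlas e]
    {w : TotalSpace F V} (hw : w.proj ∈ U) (hwe : w.proj ∈ e.baseSet) :
    connectionMap D w (mlieBracket (𝓘(𝕜, E).prod 𝓘(𝕜, F)) (liftField D X₁ s₁) (liftField D X₂ s₂) w) =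
      D s₂ w.proj (X₁ w.proj) - D s₁ w.proj (X₂ w.proj)
        - curvature 𝓘(𝕜, E) F D X₁ X₂ (fun y ↦ e.symm y (e w).2) w.proj := by
  have _ : CompleteSpace E := FiniteDimensional.complete 𝕜 E
  have _ : CompleteSpace F := FiniteDimensional.complete 𝕜 F
  set b := Module.finBasis 𝕜 F with hb
  let L : Fin (Module.finrank 𝕜 F) → F →L[𝕜] 𝕜 := fun k ↦ LinearMap.toContinuousLinearMap (b.coord k)
  have hL : ∀ k v, L k v = b.repr v k := fun k v ↦ rfl
  have hpU := isOpen_proj_preimage (F := F) (V := V) hU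
  have hOo : IsOpen (U ∩ e.baseSet) := hU.inter e.open_baseSet
  have hx : w.proj ∈ U ∩ e.baseSet := ⟨hw, hwe⟩
  have hφ := contMDiffAt_fiberCoord (𝕜 := 𝕜) (E := E) e hwe
  have hφd := contMDiffAt_fun_mdiffAt hφ
  have hZ₁ := (smoothSectionOn_liftField hD hU hX₁ hs₁).mdiffAt hpU hw
  have hZ₂ := (smoothSectionOn_liftField hD hU hX₂ hs₂).mdiffAt hpU hw
  set x := w.proj with hxw
  set t : Π y : M, V y := fun y ↦ e.symm y (e w).2 with ht
  let sc : F → Π y : M, V y := fun a y ↦ e.symm y a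
  have hsc : ∀ a, SmoothSectionOn 𝓘(𝕜, E) F (sc a) (U ∩ e.baseSet) := fun a ↦
    (smoothSectionOn_symm (I := 𝓘(𝕜, E)) e a).mono' inter_subset_right
  have hts : SmoothSectionOn 𝓘(𝕜, E) F t (U ∩ e.baseSet) := hsc _
  have hXO : ∀ {X : Π x : M, TangentSpace 𝓘(𝕜, E) x}, SmoothSectionOn 𝓘(𝕜, E) E X U →
      SmoothSectionOn 𝓘(𝕜, E) E X (U ∩ e.baseSet) := fun h ↦ h.mono' inter_subset_left
  have hcoef : ∀ {s : Π y : M, V y}, SmoothSectionOn 𝓘(𝕜, E) F s (U ∩ e.baseSet) →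
      MDiffAt (fun y ↦ (e ⟨y, s y⟩).2) x := fun h ↦
    (e.mdifferentiableAt_section_iff 𝓘(𝕜, E) _ hwe).1 (h.mdiffAt hOo hx)
  have hZφ : ∀ (X : Π x : M, TangentSpace 𝓘(𝕜, E) x) (s : Π x : M, V x) (v : TotalSpace F V),
      v.proj ∈ e.baseSet → mvfderiv (𝓘(𝕜, E).prod 𝓘(𝕜, F)) (fun v : TotalSpace F V ↦ (e v).2) v (liftField D X s v) =
        (e ⟨v.proj, s v.proj⟩).2 - ∑ k, L k (e v).2 •
          (e ⟨v.proj, D (sc (b k)) v.proj (X v.proj)⟩).2 := by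
    intro X s v hv
    have h := snd_connectionMap_apply D e hv (liftField D X s v)
    rw [connectionMap_liftField, projDeriv_liftField, connForm_apply] at h
    exact eq_sub_of_add_eq h.symm
  have hZφ' : ∀ (X : Π x : M, TangentSpace 𝓘(𝕜, E) x) (s : Π x : M, V x),
      mvfderiv (𝓘(𝕜, E).prod 𝓘(𝕜, F)) (fun v : TotalSpace F V ↦ (e v).2) w (liftField D X s w) =
        (e ⟨x, s x⟩).2 - connForm D e x (X x) (e w).2 := by
    intro X s
    rw [hZφ X s w hwe, connForm_apply]
    rfl
  have hder : ∀ {X X' : Π x : M, TangentSpace 𝓘(𝕜, E) x} {s s' : Π x : M, V x},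
      SmoothSectionOn 𝓘(𝕜, E) E X U → SmoothSectionOn 𝓘(𝕜, E) F s U →
      mvfderiv (𝓘(𝕜, E).prod 𝓘(𝕜, F)) (fun v : TotalSpace F V ↦ mvfderiv (𝓘(𝕜, E).prod 𝓘(𝕜, F)) (fun v : TotalSpace F V ↦ (e v).2) v
        (liftField D X s v)) w (liftField D X' s' w) =
      (e ⟨x, D s x (X' x)⟩).2 - connForm D e x (X' x) (e ⟨x, s x⟩).2
        - connForm D e x (X x) ((e ⟨x, s' x⟩).2 - connForm D e x (X' x) (e w).2)
        - ((e ⟨x, D (fun y ↦ D t y (X y)) x (X' x)⟩).2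
          - connForm D e x (X' x) (connForm D e x (X x) (e w).2)) := by
    intro X X' s s' hX hs
    have hτ : ∀ a, SmoothSectionOn 𝓘(𝕜, E) F (fun y ↦ D (sc a) y (X y)) (U ∩ e.baseSet) :=
      fun a ↦ hD _ _ _ hOo (hXO hX) (hsc a)
    have hsO : SmoothSectionOn 𝓘(𝕜, E) F s (U ∩ e.baseSet) := hs.mono' inter_subset_left
    have hm1 : ∀ k, MDifferentiableAt (𝓘(𝕜, E).prod 𝓘(𝕜, F)) 𝓘(𝕜, 𝕜) (fun v : TotalSpace F V ↦ L k (e v).2) w :=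
      fun k ↦ (L k).differentiableAt.mdifferentiableAt.comp (I' := 𝓘(𝕜, F)) w hφd
    have hm2 : ∀ k, MDifferentiableAt (𝓘(𝕜, E).prod 𝓘(𝕜, F)) 𝓘(𝕜, F)
        (fun v : TotalSpace F V ↦ (e ⟨v.proj, D (sc (b k)) v.proj (X v.proj)⟩).2) w :=
      fun k ↦ MDifferentiableAt.comp (I' := 𝓘(𝕜, E)) w
        (g := fun y ↦ (e ⟨y, D (sc (b k)) y (X y)⟩).2) (hcoef (hτ (b k))) (mdiffAt_proj w)
    have hm3 : ∀ k, MDifferentiableAt (𝓘(𝕜, E).prod 𝓘(𝕜, F)) 𝓘(𝕜, F) (fun v : TotalSpace F V ↦ L k (e v).2 •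
        (e ⟨v.proj, D (sc (b k)) v.proj (X v.proj)⟩).2) w := fun k ↦ (hm1 k).smul (hm2 k)
    have hm4 : MDifferentiableAt (𝓘(𝕜, E).prod 𝓘(𝕜, F)) 𝓘(𝕜, F)
        (fun v : TotalSpace F V ↦ (e ⟨v.proj, s v.proj⟩).2) w :=
      MDifferentiableAt.comp (I' := 𝓘(𝕜, E)) w
        (g := fun y ↦ (e ⟨y, s y⟩).2) (hcoef hsO) (mdiffAt_proj w)
    have hm5 : ∀ k, MDifferentiableAt 𝓘(𝕜, E) 𝓘(𝕜, F) (fun y ↦ L k (e w).2 •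
        (e ⟨y, D (sc (b k)) y (X y)⟩).2) x := fun k ↦
      mdifferentiableAt_const.smul (hcoef (hτ (b k)))
    have hDt : (fun y ↦ (e ⟨y, D t y (X y)⟩).2) =ᶠ[𝓝 x] fun y ↦ ∑ k, L k (e w).2 •
        (e ⟨y, D (sc (b k)) y (X y)⟩).2 := by
      filter_upwards [e.open_baseSet.mem_nhds hwe] with y hy
      rw [ht, snd_connection_symm D e hy, connForm_apply]
      rfl
    rw [mvfderiv_congr (g := fun v : TotalSpace F V ↦ (e ⟨v.proj, s v.proj⟩).2
      - ∑ k, L k (e v).2 • (e ⟨v.proj, D (sc (b k)) v.proj (X v.proj)⟩).2)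
      (eventually_of_mem ((isOpen_proj_preimage (F := F) (V := V) e.open_baseSet).mem_nhds hwe)
        fun v hv ↦ hZφ X s v hv),
      mvfderiv_sub_apply hm4 (mdiffAt_finsetSum fun k _ ↦ hm3 k),
      mvfderiv_sum_apply Finset.univ fun k _ ↦ hm3 k]
    have hp1 := mvfderiv_comp_proj (f := fun y ↦ (e ⟨y, s y⟩).2) (hcoef hsO) (liftField D X' s' w)
    have hp2 : ∀ k, mvfderiv (𝓘(𝕜, E).prod 𝓘(𝕜, F)) (fun v : TotalSpace F V ↦
        (e ⟨v.proj, D (sc (b k)) v.proj (X v.proj)⟩).2) w (liftField D X' s' w) =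
        mvfderiv 𝓘(𝕜, E) (fun y ↦ (e ⟨y, D (sc (b k)) y (X y)⟩).2) x (X' x) := fun k ↦ by
      rw [mvfderiv_comp_proj (f := fun y ↦ (e ⟨y, D (sc (b k)) y (X y)⟩).2) (hcoef (hτ (b k))),
        projDeriv_liftField]
    rw [projDeriv_liftField] at hp1
    have hp3 : ∀ k, mvfderiv (𝓘(𝕜, E).prod 𝓘(𝕜, F)) (fun v : TotalSpace F V ↦ L k (e v).2) w (liftField D X' s' w) =
        L k ((e ⟨x, s' x⟩).2 - connForm D e x (X' x) (e w).2) := fun k ↦ by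
      rw [mvfderiv_clm_comp (L k) hφd, hZφ']
    have hp4 : ∀ k, mvfderiv (𝓘(𝕜, E).prod 𝓘(𝕜, F)) (fun v : TotalSpace F V ↦ L k (e v).2 •
        (e ⟨v.proj, D (sc (b k)) v.proj (X v.proj)⟩).2) w (liftField D X' s' w) =
        L k (e w).2 • mvfderiv 𝓘(𝕜, E) (fun y ↦ (e ⟨y, D (sc (b k)) y (X y)⟩).2) x (X' x)
        + L k ((e ⟨x, s' x⟩).2 - connForm D e x (X' x) (e w).2) •
          (e ⟨x, D (sc (b k)) x (X x)⟩).2 := fun k ↦ by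
      rw [mvfderiv_smul_apply (hm1 k) (hm2 k), hp2, hp3]
    have h5 : (e ⟨x, D (fun y ↦ D t y (X y)) x (X' x)⟩).2 =
        ∑ k, L k (e w).2 • mvfderiv 𝓘(𝕜, E) (fun y ↦ (e ⟨y, D (sc (b k)) y (X y)⟩).2) x (X' x)
          + connForm D e x (X' x) (connForm D e x (X x) (e w).2) := by
      rw [snd_connection_apply D e hwe
        ((hD _ _ _ hOo (hXO hX) hts).mdiffAt hOo hx), mvfderiv_congr hDt,
        mvfderiv_sum_apply Finset.univ fun k _ ↦ hm5 k]
      congr 1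
      · refine Finset.sum_congr rfl fun k _ ↦ ?_
        rw [mvfderiv_smul_apply mdifferentiableAt_const (hcoef (hτ (b k))), mvfderiv_const_apply,
          zero_smul, add_zero]
      · rw [ht, snd_connection_symm D e hwe]
    rw [hp1, Finset.sum_congr rfl fun k _ ↦ hp4 k, Finset.sum_add_distrib, h5,
      snd_connection_apply D e hwe (hsO.mdiffAt hOo hx) (X' x),
      connForm_apply D e x (X x) ((e ⟨x, s' x⟩).2 - connForm D e x (X' x) (e w).2)]
    simp only [← hb, ← hL]
    abel
  apply (e.linearEquivAt 𝕜 x hwe).injective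
  rw [curvature, map_sub, map_sub, map_sub, map_sub]
  simp only [← snd_apply_eq 𝕜 e hwe]
  rw [snd_connectionMap_apply D e hwe, projDeriv_mlieBracket_liftField hD hU hX₁ hs₁ hX₂ hs₂ hw,
    mvfderiv_mlieBracket (hφ.of_le (by norm_cast)) hZ₁ hZ₂, hder hX₂ hs₂, hder hX₁ hs₁,
    ht, snd_connection_symm D e hwe]
  simp only [map_sub]
  abel

end LiftFields

section Pairings

set_option maxSynthPendingDepth 3

variable {𝕜 : Type*} [RCLike 𝕜]
  {E : Type*} [NormedAddCommGroup E] [NormedSpace 𝕜 E]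
  {H : Type*} [TopologicalSpace H] {I : ModelWithCorners 𝕜 E H}
  {N : Type*} [TopologicalSpace N] [ChartedSpace H N]
  {F : Type*} [NormedAddCommGroup F] [NormedSpace 𝕜 F]
  {V : N → Type*} [TopologicalSpace (TotalSpace F V)]
  [∀ x, AddCommGroup (V x)] [∀ x, Module 𝕜 (V x)] [∀ x, TopologicalSpace (V x)]
  [∀ x, IsTopologicalAddGroup (V x)] [∀ x, ContinuousSMul 𝕜 (V x)]
  [FiberBundle F V] [VectorBundle 𝕜 F V]

theorem IsInvariantMetric.contMDiffAt {mul : ∀ x : N, V x →L[𝕜] V x →L[𝕜] V x}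
    {g : ∀ x : N, V x →L[𝕜] V x →L[𝕜] 𝕜} (hg : IsInvariantMetric I F mul g) {s t : Π x, V x}
    {x : N} (hs : CMDiffAt ∞ (T% s) x) (ht : CMDiffAt ∞ (T% t) x) :
    ContMDiffAt I 𝓘(𝕜, 𝕜) ∞ (fun y ↦ g y (s y) (t y)) x := by
  have h1 : ContMDiffAt I (I.prod 𝓘(𝕜, 𝕜)) ∞
      (fun y ↦ TotalSpace.mk' 𝕜 (E := Bundle.Trivial N 𝕜) y (g y (s y) (t y))) x :=
    ContMDiffAt.clm_bundle_apply₂ (E₃ := Bundle.Trivial N 𝕜) (b := fun y ↦ y)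
      (hg.smooth.contMDiffAt) hs ht
  exact (contMDiffAt_totalSpace.1 h1).2

theorem IsCommAlgebraBundle.contMDiffAt {mul : ∀ x : N, V x →L[𝕜] V x →L[𝕜] V x}
    {one : Π x, V x} (hm : IsCommAlgebraBundle I F mul one) {s t : Π x, V x}
    {x : N} (hs : CMDiffAt ∞ (T% s) x) (ht : CMDiffAt ∞ (T% t) x) :
    CMDiffAt ∞ (T% fun y ↦ mul y (s y) (t y)) x :=
  ContMDiffAt.clm_bundle_apply₂ (b := fun y ↦ y) hm.smooth_mul.contMDiffAt hs ht

theorem IsCommAlgebraBundle.smoothSectionOn {mul : ∀ x : N, V x →L[𝕜] V x →L[𝕜] V x}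
    {one : Π x, V x} (hm : IsCommAlgebraBundle I F mul one) {s t : Π x, V x}
    {U : Set N} (hU : IsOpen U) (hs : SmoothSectionOn I F s U) (ht : SmoothSectionOn I F t U) :
    SmoothSectionOn I F (fun y ↦ mul y (s y) (t y)) U := fun _ hx ↦
  (hm.contMDiffAt (hs.contMDiffAt hU hx) (ht.contMDiffAt hU hx)).contMDiffWithinAt

theorem smoothSectionOn_zero {U : Set N} :
    SmoothSectionOn I F (fun x ↦ (0 : V x)) U :=
  (contMDiff_zeroSection 𝕜 V).contMDiffOn

end Pairings

section Consequences

set_option maxSynthPendingDepth 3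

variable {𝕜 : Type*} [RCLike 𝕜]
  {E : Type*} [NormedAddCommGroup E] [NormedSpace 𝕜 E] [FiniteDimensional 𝕜 E]
  {M : Type*} [TopologicalSpace M] [ChartedSpace E M] [IsManifold 𝓘(𝕜, E) ∞ M]
  {F : Type*} [NormedAddCommGroup F] [NormedSpace 𝕜 F] [FiniteDimensional 𝕜 F]
  {V : M → Type*} [TopologicalSpace (TotalSpace F V)]
  [∀ x, AddCommGroup (V x)] [∀ x, Module 𝕜 (V x)] [∀ x, TopologicalSpace (V x)]
  [∀ x, IsTopologicalAddGroup (V x)] [∀ x, ContinuousSMul 𝕜 (V x)]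
  [FiberBundle F V] [VectorBundle 𝕜 F V] [ContMDiffVectorBundle ∞ F V 𝓘(𝕜, E)]

variable {D : CovariantDerivative 𝓘(𝕜, E) F V}
  {mulM : ∀ x : M,
    TangentSpace 𝓘(𝕜, E) x →L[𝕜] TangentSpace 𝓘(𝕜, E) x →L[𝕜] TangentSpace 𝓘(𝕜, E) x}
  {mulV : ∀ x : M, V x →L[𝕜] V x →L[𝕜] V x}
  {gM : ∀ x : M, TangentSpace 𝓘(𝕜, E) x →L[𝕜] TangentSpace 𝓘(𝕜, E) x →L[𝕜] 𝕜}
  {gV : ∀ x : M, V x →L[𝕜] V x →L[𝕜] 𝕜}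
  {α : ∀ x : M, V x →L[𝕜] TangentSpace 𝓘(𝕜, E) x}
  {eM : Π x : M, TangentSpace 𝓘(𝕜, E) x} {eV : Π x : M, V x}

theorem IsSmoothConnection.preservesSmooth (hD : IsSmoothConnection (F := F) D) :
    PreservesSmooth D := by
  intro U X s hU hX hs
  have h1 := (hD U hU).contMDiff (σ := s) (by exact hs)
  exact ContMDiffOn.clm_bundle_apply (b := fun y ↦ y) h1 hX

theorem IsSmoothMorphism.contMDiffAt (hα : IsSmoothMorphism (F := F) α) {s : Π x : M, V x} {x : M}
    (hs : CMDiffAt ∞ (T% s) x) :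
    CMDiffAt ∞ (T% fun y ↦ (α y (s y) : TangentSpace 𝓘(𝕜, E) y)) x :=
  ContMDiffAt.clm_bundle_apply (b := fun y ↦ y) (ContMDiff.contMDiffAt hα) hs

theorem IsSmoothMorphism.smoothSectionOn (hα : IsSmoothMorphism (F := F) α) {s : Π x : M, V x}
    {U : Set M} (hU : IsOpen U) (hs : SmoothSectionOn 𝓘(𝕜, E) F s U) :
    SmoothSectionOn 𝓘(𝕜, E) E (fun y ↦ α y (s y)) U := fun _ hx ↦
  (hα.contMDiffAt (hs.contMDiffAt hU hx)).contMDiffWithinAt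

theorem connectionMap_totalMul (v : TotalSpace F V) (W W' : TotalTangent 𝕜 (E := E) v) :
    connectionMap D v (totalMul D mulM mulV α v W W') =
      mulV v.proj (connectionMap D v W) (connectionMap D v W') := by
  rw [totalMul_apply, map_add, connectionMap_horLift, connectionMap_vertLift, zero_add]

theorem projDeriv_totalMul (v : TotalSpace F V) (W W' : TotalTangent 𝕜 (E := E) v) :
    projDeriv v (totalMul D mulM mulV α v W W') =
      mulM v.proj (projDeriv v W) (projDeriv v W')
        + mulM v.proj (α v.proj (connectionMap D v W)) (projDeriv v W')
        + mulM v.proj (projDeriv v W) (α v.proj (connectionMap D v W')) := by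
  rw [totalMul_apply, map_add, projDeriv_horLift, projDeriv_vertLift, add_zero]

theorem totalMetric_liftField (X Y : Π x : M, TangentSpace 𝓘(𝕜, E) x) (s t : Π x : M, V x)
    (v : TotalSpace F V) :
    totalMetric D gM gV α v (liftField D X s v) (liftField D Y t v) =
      gM v.proj (X v.proj) (Y v.proj) + gM v.proj (α v.proj (s v.proj)) (Y v.proj)
        + gM v.proj (X v.proj) (α v.proj (t v.proj)) + gV v.proj (s v.proj) (t v.proj) := by
  rw [totalMetric_apply, projDeriv_liftField, projDeriv_liftField, connectionMap_liftField,
    connectionMap_liftField]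

theorem liftField_unit_mul (hM : ∀ x (a : TangentSpace 𝓘(𝕜, E) x), mulM x (eM x) a = a)
    (hMc : ∀ x (a b : TangentSpace 𝓘(𝕜, E) x), mulM x a b = mulM x b a)
    (X : Π x : M, TangentSpace 𝓘(𝕜, E) x) (v : TotalSpace F V) :
    totalMul D mulM mulV α v (liftField D X (fun _ ↦ 0) v) (liftField D eM (fun _ ↦ 0) v) =
      liftField D X (fun _ ↦ 0) v := by
  apply totalTangent_ext D
  · rw [projDeriv_totalMul, projDeriv_liftField, projDeriv_liftField, connectionMap_liftField,
      connectionMap_liftField, hMc, hM]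
    simp
  · rw [connectionMap_totalMul, connectionMap_liftField, connectionMap_liftField]
    simp

/-- The vertical part of the `F`-manifold condition for a horizontal lift. -/
theorem connectionMap_lieDerivMul_horizontal
    (hM : IsCommAlgebraBundle 𝓘(𝕜, E) E mulM eM)
    (hD : PreservesSmooth D)
    (hF : IsFManifold (𝓘(𝕜, E).prod 𝓘(𝕜, F)) (totalMul D mulM mulV α) (totalUnit D eV))
    {U : Set M} (hU : IsOpen U) {X : Π x : M, TangentSpace 𝓘(𝕜, E) x}
    (hX : SmoothSectionOn 𝓘(𝕜, E) E X U) {Z T : Π v : TotalSpace F V, TangentSpace (𝓘(𝕜, E).prod 𝓘(𝕜, F)) v}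
    (hZ : SmoothSectionOn (𝓘(𝕜, E).prod 𝓘(𝕜, F)) (E × F) Z (TotalSpace.proj ⁻¹' U : Set (TotalSpace F V)))
    (hT : SmoothSectionOn (𝓘(𝕜, E).prod 𝓘(𝕜, F)) (E × F) T (TotalSpace.proj ⁻¹' U : Set (TotalSpace F V)))
    {w : TotalSpace F V} (hw : w.proj ∈ U) :
    connectionMap D w (lieDerivMul (𝓘(𝕜, E).prod 𝓘(𝕜, F)) (totalMul D mulM mulV α) (liftField D X fun _ ↦ 0) Z T w)
      = 0 := by
  have he : SmoothSectionOn 𝓘(𝕜, E) E eM U := hM.smooth_one.mono' (subset_univ _)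
  have h := hF.lie_mul _ (isOpen_proj_preimage hU) (liftField D X fun _ ↦ 0)
    (liftField D eM fun _ ↦ 0) Z T (smoothSectionOn_liftField hD hU hX smoothSectionOn_zero)
    (smoothSectionOn_liftField hD hU he smoothSectionOn_zero) hZ hT w hw
  have h1 : (fun v : TotalSpace F V ↦ totalMul D mulM mulV α v (liftField D X (fun _ ↦ 0) v)
      (liftField D eM (fun _ ↦ 0) v)) = liftField D X fun _ ↦ 0 :=
    funext fun v ↦ liftField_unit_mul hM.one_mul hM.mul_comm X v
  rw [h1] at h
  rw [h, map_add, connectionMap_totalMul, connectionMap_totalMul, connectionMap_liftField,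
    connectionMap_liftField]
  simp

theorem isFlatConnectionOn_of_isFManifold
    (hM : IsCommAlgebraBundle 𝓘(𝕜, E) E mulM eM)
    (hD : PreservesSmooth D)
    (hF : IsFManifold (𝓘(𝕜, E).prod 𝓘(𝕜, F)) (totalMul D mulM mulV α) (totalUnit D eV)) :
    IsFlatConnectionOn 𝓘(𝕜, E) F D univ := by
  intro U hU _ X Y s hX hY hs x hx
  set e := trivializationAt F V x
  have hxe : x ∈ e.baseSet := FiberBundle.mem_baseSet_trivializationAt' x
  have hO := hU.inter e.open_baseSet
  have he : SmoothSectionOn 𝓘(𝕜, E) E eM U := hM.smooth_one.mono' (subset_univ _)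
  have key : ∀ {X Y : Π x : M, TangentSpace 𝓘(𝕜, E) x} {U : Set M}, IsOpen U →
      SmoothSectionOn 𝓘(𝕜, E) E X U →
      SmoothSectionOn 𝓘(𝕜, E) E Y U → ∀ a : F, ∀ y ∈ U, y ∈ e.baseSet →
      curvature 𝓘(𝕜, E) F D X Y (fun y ↦ e.symm y a) y = 0 := by
    intro X Y U hU hX hY a y hy hye
    have he : SmoothSectionOn 𝓘(𝕜, E) E eM U := hM.smooth_one.mono' (subset_univ _)
    have h := connectionMap_lieDerivMul_horizontal hM hD hF hU hX
      (smoothSectionOn_liftField hD hU hY smoothSectionOn_zero)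
      (smoothSectionOn_liftField hD hU he smoothSectionOn_zero)
      (w := ⟨y, e.symm y a⟩) hy
    rw [lieDerivMul, map_sub, map_sub, connectionMap_totalMul, connectionMap_totalMul,
      connectionMap_liftField, connectionMap_liftField, map_zero, map_zero] at h
    have h1 : (fun v : TotalSpace F V ↦ totalMul D mulM mulV α v (liftField D Y (fun _ ↦ 0) v)
        (liftField D eM (fun _ ↦ 0) v)) = liftField D Y fun _ ↦ 0 :=
      funext fun v ↦ liftField_unit_mul hM.one_mul hM.mul_comm Y v
    rw [h1, connectionMap_mlieBracket_liftField hD hU hX smoothSectionOn_zero hY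
      smoothSectionOn_zero e hy hye] at h
    have h2 : (e ⟨y, e.symm y a⟩).2 = a := snd_apply_symm e hye a
    rw [h2, nabla_zero_apply, nabla_zero_apply] at h
    simpa using h
  have hS := e.isLocalFrameOn_localFrame_baseSet 𝓘(𝕜, E) ∞ (Module.finBasis 𝕜 F)
  set eT := trivializationAt E (TangentSpace 𝓘(𝕜, E) : M → Type _) x
  have hA := eT.isLocalFrameOn_localFrame_baseSet 𝓘(𝕜, E) ∞ (Module.finBasis 𝕜 E)
  have hxT : x ∈ eT.baseSet := FiberBundle.mem_baseSet_trivializationAt' x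
  refine curvature_eq_zero_of_frame (U := eT.baseSet ∩ e.baseSet) hD
    (eT.open_baseSet.inter e.open_baseSet) (hA.mono inter_subset_left)
    (hS.mono inter_subset_right) ?_ hU hX hY hs hx ⟨hxT, hxe⟩
  intro a b i y hy
  have hO' := eT.open_baseSet.inter e.open_baseSet
  have hAa : ∀ a, SmoothSectionOn 𝓘(𝕜, E) E (eT.localFrame (Module.finBasis 𝕜 E) a)
      (eT.baseSet ∩ e.baseSet) := fun a ↦ (hA.mono inter_subset_left).contMDiffOn a
  rw [curvature_congr hD hO' (hAa a) (hAa b) ((hS.mono inter_subset_right).contMDiffOn i)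
    (fun _ _ ↦ rfl) (fun _ _ ↦ rfl) (s' := fun y ↦ e.symm y (Module.finBasis 𝕜 F i)) ?_ hy]
  · exact key hO' (hAa a) (hAa b) _ y hy hy.2
  · intro z hz
    rw [e.localFrame_apply_of_mem_baseSet _ hz.2]
    rfl

theorem connection_mul
    (hM : IsCommAlgebraBundle 𝓘(𝕜, E) E mulM eM) (hV : IsCommAlgebraBundle 𝓘(𝕜, E) F mulV eV)
    (hD : PreservesSmooth D)
    (hF : IsFManifold (𝓘(𝕜, E).prod 𝓘(𝕜, F)) (totalMul D mulM mulV α) (totalUnit D eV))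
    {U : Set M} (hU : IsOpen U) {s t : Π x : M, V x}
    (hs : SmoothSectionOn 𝓘(𝕜, E) F s U) (ht : SmoothSectionOn 𝓘(𝕜, E) F t U) {x : M} (hx : x ∈ U)
    (u : TangentSpace 𝓘(𝕜, E) x) :
    D (fun y ↦ mulV y (s y) (t y)) x u = mulV x (D s x u) (t x) + mulV x (s x) (D t x u) := by
  set e := trivializationAt F V x
  have hxe : x ∈ e.baseSet := FiberBundle.mem_baseSet_trivializationAt' x
  have hflat := isFlatConnectionOn_of_isFManifold hM hD hF
  obtain ⟨X, rfl, hX⟩ := exists_smooth_extension (I := 𝓘(𝕜, E)) (F := E) x u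
  set eT := trivializationAt E (TangentSpace 𝓘(𝕜, E) : M → Type _) x
  have hxT : x ∈ eT.baseSet := FiberBundle.mem_baseSet_trivializationAt' x
  have hO : IsOpen (U ∩ e.baseSet ∩ eT.baseSet) := (hU.inter e.open_baseSet).inter eT.open_baseSet
  have hxO : x ∈ U ∩ e.baseSet ∩ eT.baseSet := ⟨⟨hx, hxe⟩, hxT⟩
  replace hX := hX.mono' (inter_subset_right (s := U ∩ e.baseSet))
  have hsub : U ∩ e.baseSet ∩ eT.baseSet ⊆ U := inter_subset_left.trans inter_subset_left
  replace hs := hs.mono' hsub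
  replace ht := ht.mono' hsub
  have hst := hV.smoothSectionOn hO hs ht
  have hz : SmoothSectionOn 𝓘(𝕜, E) E (fun x ↦ (0 : TangentSpace 𝓘(𝕜, E) x))
    (U ∩ e.baseSet ∩ eT.baseSet) := smoothSectionOn_zero
  have h := connectionMap_lieDerivMul_horizontal (w := ⟨x, 0⟩) hM hD hF hO hX
    (smoothSectionOn_liftField hD hO hz hs) (smoothSectionOn_liftField hD hO hz ht) hxO
  have h1 : (fun v : TotalSpace F V ↦ totalMul D mulM mulV α v
      (liftField D (fun x ↦ (0 : TangentSpace 𝓘(𝕜, E) x)) s v)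
      (liftField D (fun x ↦ (0 : TangentSpace 𝓘(𝕜, E) x)) t v)) =
      liftField D (fun x ↦ (0 : TangentSpace 𝓘(𝕜, E) x)) fun y ↦ mulV y (s y) (t y) := by
    funext v
    apply totalTangent_ext D
    · simp [projDeriv_totalMul, projDeriv_liftField]
    · simp [connectionMap_totalMul, connectionMap_liftField]
  have hb : ∀ {s : Π x : M, V x}, SmoothSectionOn 𝓘(𝕜, E) F s (U ∩ e.baseSet ∩ eT.baseSet) →
      connectionMap D ⟨x, 0⟩ (mlieBracket (𝓘(𝕜, E).prod 𝓘(𝕜, F)) (liftField D X fun _ ↦ 0)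
        (liftField D (fun x ↦ (0 : TangentSpace 𝓘(𝕜, E) x)) s) ⟨x, 0⟩) = D s x (X x) := by
    intro s hs
    rw [connectionMap_mlieBracket_liftField hD hO hX smoothSectionOn_zero hz hs e hxO hxe,
      nabla_zero_apply, hflat _ (hO) (subset_univ _) X _ _ hX hz
        ((smoothSectionOn_symm e _).mono' fun y hy ↦ hy.1.2) x hxO, sub_zero, sub_zero]
  rw [lieDerivMul, h1, map_sub, map_sub, connectionMap_totalMul, connectionMap_totalMul,
    connectionMap_liftField, connectionMap_liftField, hb hs, hb ht, hb hst, sub_sub,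
    sub_eq_zero] at h
  exact h

theorem connection_unit
    (hM : IsCommAlgebraBundle 𝓘(𝕜, E) E mulM eM) (hV : IsCommAlgebraBundle 𝓘(𝕜, E) F mulV eV)
    (hD : PreservesSmooth D)
    (hF : IsFManifold (𝓘(𝕜, E).prod 𝓘(𝕜, F)) (totalMul D mulM mulV α) (totalUnit D eV)) (x : M) : D eV x = 0 := by
  ext u
  have h := connection_mul hM hV hD hF isOpen_univ hV.smooth_one hV.smooth_one (mem_univ x) u
  have h1 : (fun y ↦ mulV y (eV y) (eV y)) = eV := funext fun y ↦ hV.one_mul y _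
  rw [h1, hV.one_mul, hV.mul_comm, hV.one_mul] at h
  simpa using h

theorem connection_metric
    (hM : IsCommAlgebraBundle 𝓘(𝕜, E) E mulM eM) (hV : IsCommAlgebraBundle 𝓘(𝕜, E) F mulV eV)
    (hgM : IsInvariantMetric 𝓘(𝕜, E) E mulM gM) (hgV : IsInvariantMetric 𝓘(𝕜, E) F mulV gV)
    (hD : PreservesSmooth D) (hα : IsSmoothMorphism (F := F) α)
    (hF : IsFManifold (𝓘(𝕜, E).prod 𝓘(𝕜, F)) (totalMul D mulM mulV α) (totalUnit D eV))
    (hadm : IsAdmissible (𝓘(𝕜, E).prod 𝓘(𝕜, F)) (totalMetric D gM gV α) (totalUnit D eV))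
    {U : Set M} (hU : IsOpen U) {s t : Π x : M, V x}
    (hs : SmoothSectionOn 𝓘(𝕜, E) F s U) (ht : SmoothSectionOn 𝓘(𝕜, E) F t U) {x : M} (hx : x ∈ U)
    (u : TangentSpace 𝓘(𝕜, E) x) :
    mvfderiv 𝓘(𝕜, E) (fun y ↦ gV y (s y) (t y)) x u = gV x (D s x u) (t x) + gV x (s x) (D t x u) := by
  obtain ⟨nabla, hLC, hpar⟩ := hadm
  have hsymm : ∀ v (a b : TangentSpace (𝓘(𝕜, E).prod 𝓘(𝕜, F)) v),
      totalMetric D gM gV α v a b = totalMetric D gM gV α v b a := by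
    intro v a b
    rw [totalMetric_apply, totalMetric_apply, hgM.symm, hgV.symm,
      hgM.symm _ (α v.proj _) (projDeriv v b), hgM.symm _ (projDeriv v a)]
    ring
  set e := trivializationAt F V x
  have hxe : x ∈ e.baseSet := FiberBundle.mem_baseSet_trivializationAt' x
  have hflat := isFlatConnectionOn_of_isFManifold hM hD hF
  obtain ⟨X, rfl, hX⟩ := exists_smooth_extension (I := 𝓘(𝕜, E)) (F := E) x u
  set eT := trivializationAt E (TangentSpace 𝓘(𝕜, E) : M → Type _) x
  have hxT : x ∈ eT.baseSet := FiberBundle.mem_baseSet_trivializationAt' x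
  have hO : IsOpen (U ∩ e.baseSet ∩ eT.baseSet) := (hU.inter e.open_baseSet).inter eT.open_baseSet
  have hxO : x ∈ U ∩ e.baseSet ∩ eT.baseSet := ⟨⟨hx, hxe⟩, hxT⟩
  replace hX := hX.mono' (inter_subset_right (s := U ∩ e.baseSet))
  have hsub : U ∩ e.baseSet ∩ eT.baseSet ⊆ U := inter_subset_left.trans inter_subset_left
  replace hs := hs.mono' hsub
  replace ht := ht.mono' hsub
  have he : SmoothSectionOn 𝓘(𝕜, E) F eV (U ∩ e.baseSet ∩ eT.baseSet) :=
    hV.smooth_one.mono' (subset_univ _)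
  have hpO := isOpen_proj_preimage (F := F) (V := V) hO
  let z : Π x : M, TangentSpace 𝓘(𝕜, E) x := fun _ ↦ 0
  have hz : SmoothSectionOn 𝓘(𝕜, E) E z (U ∩ e.baseSet ∩ eT.baseSet) := smoothSectionOn_zero
  have hunit : (totalUnit D eV : Π v : TotalSpace F V, TangentSpace (𝓘(𝕜, E).prod 𝓘(𝕜, F)) v) = liftField D z eV := by
    funext v
    simp [totalUnit, liftField, z]
  have hDe := connection_unit hM hV hD hF
  let w : TotalSpace F V := ⟨x, 0⟩
  have bracket : ∀ {X : Π x : M, TangentSpace 𝓘(𝕜, E) x} {s t : Π x : M, V x},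
      SmoothSectionOn 𝓘(𝕜, E) E X (U ∩ e.baseSet ∩ eT.baseSet) →
      SmoothSectionOn 𝓘(𝕜, E) F s (U ∩ e.baseSet ∩ eT.baseSet) →
      SmoothSectionOn 𝓘(𝕜, E) F t (U ∩ e.baseSet ∩ eT.baseSet) →
      mlieBracket (𝓘(𝕜, E).prod 𝓘(𝕜, F)) (liftField D X s) (liftField D z t) w =
        liftField D z (fun y ↦ D t y (X y)) w := by
    intro X s t hX hs ht
    apply totalTangent_ext D
    · rw [projDeriv_mlieBracket_liftField hD hO hX hs hz ht (w := w) hxO, projDeriv_liftField]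
      exact congrFun (mlieBracket_zero_right (I := 𝓘(𝕜, E)) (W := X)) x
    · rw [connectionMap_mlieBracket_liftField hD hO hX hs hz ht e (w := w) hxO hxe,
        hflat _ (hO) (subset_univ _) X _ _ hX hz
        ((smoothSectionOn_symm e _).mono' fun y hy ↦ hy.1.2) x hxO, connectionMap_liftField]
      simp [z, w]
  have key : ∀ {s : Π x : M, V x}, SmoothSectionOn 𝓘(𝕜, E) F s (U ∩ e.baseSet ∩ eT.baseSet) →
      mvfderiv 𝓘(𝕜, E) (fun y ↦ gV y (eV y) (s y)) x (X x) = gV x (D s x (X x)) (eV x) := by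
    intro s hs
    have h0 : SmoothSectionOn 𝓘(𝕜, E) F (fun x ↦ (0 : V x)) (U ∩ e.baseSet ∩ eT.baseSet) :=
      smoothSectionOn_zero
    have hk := hLC.koszul hsymm
      ((smoothSectionOn_liftField hD hO hX h0).mdiffAt hpO (x := w) hxO)
      ((smoothSectionOn_liftField hD hO hz he).mdiffAt hpO (x := w) hxO)
      ((smoothSectionOn_liftField hD hO hz hs).mdiffAt hpO (x := w) hxO)
    rw [← hunit, hpar w (mem_univ _), hunit, bracket hX h0 he, bracket hX h0 hs, bracket hz he hs]
      at hk
    simp only [totalMetric_liftField, hDe] at hk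
    have hgs := contMDiffAt_fun_mdiffAt
      (hgV.contMDiffAt (he.contMDiffAt hO hxO) (hs.contMDiffAt hO hxO))
    have hgX : ∀ {s : Π x : M, V x}, SmoothSectionOn 𝓘(𝕜, E) F s (U ∩ e.baseSet ∩ eT.baseSet) →
        MDiffAt (fun y ↦ gM y (X y) (α y (s y))) x := fun hs ↦ contMDiffAt_fun_mdiffAt
      (hgM.contMDiffAt (hX.contMDiffAt hO hxO) (hα.contMDiffAt (hs.contMDiffAt hO hxO)))
    simp only [z, map_zero, zero_apply, zero_add, add_zero, mul_zero, sub_zero] at hk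
    rw [mvfderiv_comp_proj (w := w) (f := fun y ↦ gV y (eV y) (s y)) hgs,
      mvfderiv_comp_proj (w := w) (f := fun y ↦ gM y (X y) (α y (s y))) (hgX hs),
      mvfderiv_comp_proj (w := w) (f := fun y ↦ gM y (X y) (α y (eV y))) (hgX he)] at hk
    simp only [projDeriv_liftField, map_zero, add_zero, sub_zero] at hk
    exact (sub_eq_zero.1 hk.symm)
  have hst := hV.smoothSectionOn hO hs ht
  have h1 : (fun y ↦ gV y (s y) (t y)) = fun y ↦ gV y (eV y) (mulV y (s y) (t y)) := by
    funext y
    rw [← hgV.invariant, hV.one_mul]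
  rw [h1, key hst, connection_mul hM hV hD hF hO hs ht hxO, map_add, add_apply,
    hgV.invariant, hgV.invariant, hV.mul_comm _ _ (eV x), hV.one_mul, hV.mul_comm _ _ (eV x),
    hV.one_mul]

theorem IsFlatConnectionOn.congr {nabla nabla' : CovariantDerivative 𝓘(𝕜, E) F V} {O : Set M}
    (hn : PreservesSmooth nabla) (h : IsFlatConnectionOn 𝓘(𝕜, E) F nabla O)
    (heq : ∀ (s : Π x : M, V x) (x : M), MDiffAt (T% s) x → nabla s x = nabla' s x) :
    IsFlatConnectionOn 𝓘(𝕜, E) F nabla' O := by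
  intro U hU hUO X Y s hX hY hs x hx
  rw [← h U hU hUO X Y s hX hY hs x hx]
  have h2 : ∀ {A : Π x : M, TangentSpace 𝓘(𝕜, E) x}, SmoothSectionOn 𝓘(𝕜, E) E A U →
      nabla (fun y ↦ nabla s y (A y)) x = nabla' (fun y ↦ nabla' s y (A y)) x := by
    intro A hA
    rw [← heq (fun y ↦ nabla' s y (A y)) x]
    · refine nabla_congr nabla ((hn U A s hU hA hs).mdiffAt hU hx) ?_
      filter_upwards [hU.mem_nhds hx] with y hy
      rw [heq s y (hs.mdiffAt hU hy)]
    · refine ((hn U A s hU hA hs).mdiffAt hU hx).congr_of_eventuallyEq ?_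
      filter_upwards [hU.mem_nhds hx] with y hy
      rw [heq s y (hs.mdiffAt hU hy)]
  rw [curvature, curvature, h2 hX, h2 hY, heq s x (hs.mdiffAt hU hx)]

end Consequences

section AdaptedMetric

set_option maxSynthPendingDepth 3

variable {𝕜 : Type*} [RCLike 𝕜]
  {E : Type*} [NormedAddCommGroup E] [NormedSpace 𝕜 E] [FiniteDimensional 𝕜 E]
  {M : Type*} [TopologicalSpace M] [ChartedSpace E M] [IsManifold 𝓘(𝕜, E) ∞ M]
  {F : Type*} [NormedAddCommGroup F] [NormedSpace 𝕜 F] [FiniteDimensional 𝕜 F]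
  {V : M → Type*} [TopologicalSpace (TotalSpace F V)]
  [∀ x, AddCommGroup (V x)] [∀ x, Module 𝕜 (V x)] [∀ x, TopologicalSpace (V x)]
  [∀ x, IsTopologicalAddGroup (V x)] [∀ x, ContinuousSMul 𝕜 (V x)]
  [FiberBundle F V] [VectorBundle 𝕜 F V] [ContMDiffVectorBundle ∞ F V 𝓘(𝕜, E)]

/-- Flat metric connections on the base and on the bundle, and a morphism between them. -/
structure FlatMetricPair
    (nablaM : CovariantDerivative 𝓘(𝕜, E) E (TangentSpace 𝓘(𝕜, E) : M → Type _))
    (D : CovariantDerivative 𝓘(𝕜, E) F V)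
    (gM : ∀ x : M, TangentSpace 𝓘(𝕜, E) x →L[𝕜] TangentSpace 𝓘(𝕜, E) x →L[𝕜] 𝕜)
    (gV : ∀ x : M, V x →L[𝕜] V x →L[𝕜] 𝕜)
    (α : ∀ x : M, V x →L[𝕜] TangentSpace 𝓘(𝕜, E) x) : Prop where
  preservesSmooth_base : PreservesSmooth nablaM
  preservesSmooth : PreservesSmooth D
  flat_base : IsFlatConnectionOn 𝓘(𝕜, E) E nablaM univ
  flat : IsFlatConnectionOn 𝓘(𝕜, E) F D univ
  leviCivita : IsLeviCivita 𝓘(𝕜, E) gM nablaM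
  symm_base : ∀ x (a b : TangentSpace 𝓘(𝕜, E) x), gM x a b = gM x b a
  symm : ∀ x (a b : V x), gV x a b = gV x b a
  smooth_base : SmoothPairing 𝓘(𝕜, E) gM
  smooth : ∀ (s t : Π x : M, V x) (x : M), CMDiffAt ∞ (T% s) x → CMDiffAt ∞ (T% t) x →
    ContMDiffAt 𝓘(𝕜, E) 𝓘(𝕜, 𝕜) ∞ (fun y ↦ gV y (s y) (t y)) x
  smooth_morphism : IsSmoothMorphism (F := F) α
  metric : ∀ (U : Set M) (s t : Π x : M, V x), IsOpen U → SmoothSectionOn 𝓘(𝕜, E) F s U →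
    SmoothSectionOn 𝓘(𝕜, E) F t U → ∀ x ∈ U, ∀ u : TangentSpace 𝓘(𝕜, E) x,
    mvfderiv 𝓘(𝕜, E) (fun y ↦ gV y (s y) (t y)) x u = gV x (D s x u) (t x) + gV x (s x) (D t x u)
  nondegenerate : ∀ (v : TotalSpace F V) (W : TotalTangent 𝕜 (E := E) v),
    (∀ W', totalMetric D gM gV α v W W' = 0) → W = 0

theorem smoothSectionOn_sumElim_left {ι κ : Type*} {A : κ → Π x : M, V x} {U : Set M}
    (hA : ∀ i, SmoothSectionOn 𝓘(𝕜, E) F (A i) U) (m : κ ⊕ ι) :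
    SmoothSectionOn 𝓘(𝕜, E) F (Sum.elim A (fun _ _ ↦ 0) m : Π x : M, V x) U := by
  rcases m with i | k
  · exact hA i
  · exact smoothSectionOn_zero

theorem smoothSectionOn_sumElim_right {ι κ : Type*} {S : ι → Π x : M, V x} {U : Set M}
    (hS : ∀ i, SmoothSectionOn 𝓘(𝕜, E) F (S i) U) (m : κ ⊕ ι) :
    SmoothSectionOn 𝓘(𝕜, E) F (Sum.elim (fun _ _ ↦ 0) S m : Π x : M, V x) U := by
  rcases m with i | k
  · exact smoothSectionOn_zero
  · exact hS k

/-- The frame of the total space made of the horizontal lifts of the members of a frame of the base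
and the vertical lifts of the members of a frame of the bundle. -/
def liftFrame (D : CovariantDerivative 𝓘(𝕜, E) F V) {ι κ : Type*}
    (A : κ → Π x : M, TangentSpace 𝓘(𝕜, E) x) (S : ι → Π x : M, V x) (m : κ ⊕ ι)
    (w : TotalSpace F V) : TotalTangent 𝕜 (E := E) w :=
  liftField D (Sum.elim A (fun _ _ ↦ 0) m) (Sum.elim (fun _ _ ↦ 0) S m) w

theorem isLocalFrameOn_liftFrame {D : CovariantDerivative 𝓘(𝕜, E) F V} (hD : PreservesSmooth D)
    {ι κ : Type*} {A : κ → Π x : M, TangentSpace 𝓘(𝕜, E) x} {S : ι → Π x : M, V x} {U : Set M}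
    (hU : IsOpen U) (hA : IsLocalFrameOn 𝓘(𝕜, E) E ∞ A U) (hS : IsLocalFrameOn 𝓘(𝕜, E) F ∞ S U) :
    IsLocalFrameOn (𝓘(𝕜, E).prod 𝓘(𝕜, F)) (E × F) ∞ (liftFrame D A S)
      (TotalSpace.proj ⁻¹' U : Set (TotalSpace F V)) := by
  have hbasis : ∀ w : TotalSpace F V, w.proj ∈ U →
      ∃ β : Module.Basis (κ ⊕ ι) 𝕜 (TotalTangent 𝕜 (E := E) w), ∀ m, β m =
        liftFrame D A S m w := by
    intro w hw
    refine ⟨((hA.toBasisAt hw).prod (hS.toBasisAt hw)).map (splitting D w).symm.toLinearEquiv,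
      fun m ↦ ?_⟩
    rcases m with i | k
    · simp only [Module.Basis.map_apply, Module.Basis.prod_apply, Sum.elim_inl, Function.comp_apply,
        LinearMap.inl_apply, IsLocalFrameOn.toBasisAt_coe]
      simp only [liftFrame, liftField, Sum.elim_inl, map_zero, add_zero]
      rfl
    · simp only [Module.Basis.map_apply, Module.Basis.prod_apply, Sum.elim_inr, Function.comp_apply,
        LinearMap.inr_apply, IsLocalFrameOn.toBasisAt_coe]
      simp only [liftFrame, liftField, Sum.elim_inr, map_zero, zero_add]
      rfl
  refine ⟨fun {w} hw ↦ ?_, fun {w} hw ↦ ?_, fun m ↦ ?_⟩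
  · obtain ⟨β, hβ⟩ := hbasis w hw
    simp only [← hβ]
    exact β.linearIndependent
  · obtain ⟨β, hβ⟩ := hbasis w hw
    simp only [← hβ]
    exact β.span_eq.ge
  · exact smoothSectionOn_liftField hD hU (smoothSectionOn_sumElim_left hA.contMDiffOn m)
      (smoothSectionOn_sumElim_right hS.contMDiffOn m)

variable {nablaM : CovariantDerivative 𝓘(𝕜, E) E (TangentSpace 𝓘(𝕜, E) : M → Type _)}
  {D : CovariantDerivative 𝓘(𝕜, E) F V}
  {gM : ∀ x : M, TangentSpace 𝓘(𝕜, E) x →L[𝕜] TangentSpace 𝓘(𝕜, E) x →L[𝕜] 𝕜}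
  {gV : ∀ x : M, V x →L[𝕜] V x →L[𝕜] 𝕜}
  {α : ∀ x : M, V x →L[𝕜] TangentSpace 𝓘(𝕜, E) x}

theorem smoothPairing_totalMetric (hD : PreservesSmooth D) (hM : SmoothPairing 𝓘(𝕜, E) gM)
    (hV : ∀ (s t : Π x : M, V x) (x : M), CMDiffAt ∞ (T% s) x → CMDiffAt ∞ (T% t) x →
      ContMDiffAt 𝓘(𝕜, E) 𝓘(𝕜, 𝕜) ∞ (fun y ↦ gV y (s y) (t y)) x)
    (hα : IsSmoothMorphism (F := F) α) :
    SmoothPairing (𝓘(𝕜, E).prod 𝓘(𝕜, F)) (totalMetric D gM gV α) := by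
  intro Z Z' w hZ hZ'
  set e := trivializationAt F V w.proj
  set eT := trivializationAt E (TangentSpace 𝓘(𝕜, E) : M → Type _) w.proj
  have hO := eT.open_baseSet.inter e.open_baseSet
  have hxO : w.proj ∈ eT.baseSet ∩ e.baseSet :=
    ⟨FiberBundle.mem_baseSet_trivializationAt' w.proj, FiberBundle.mem_baseSet_trivializationAt' _⟩
  have hA := (eT.isLocalFrameOn_localFrame_baseSet 𝓘(𝕜, E) ∞ (Module.finBasis 𝕜 E)).mono
    (inter_subset_left (t := e.baseSet))
  have hS := (e.isLocalFrameOn_localFrame_baseSet 𝓘(𝕜, E) ∞ (Module.finBasis 𝕜 F)).mono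
    (inter_subset_right (s := eT.baseSet))
  have hL := isLocalFrameOn_liftFrame hD hO hA hS
  have hpO := isOpen_proj_preimage (F := F) (V := V) hO
  have hpr : ContMDiffAt (𝓘(𝕜, E).prod 𝓘(𝕜, F)) 𝓘(𝕜, E) ∞ (TotalSpace.proj : TotalSpace F V → M) w :=
    Bundle.contMDiffAt_proj V
  have hpair : ∀ {X Y : Π x : M, TangentSpace 𝓘(𝕜, E) x} {s t : Π x : M, V x},
      SmoothSectionOn 𝓘(𝕜, E) E X (eT.baseSet ∩ e.baseSet) →
      SmoothSectionOn 𝓘(𝕜, E) E Y (eT.baseSet ∩ e.baseSet) →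
      SmoothSectionOn 𝓘(𝕜, E) F s (eT.baseSet ∩ e.baseSet) →
      SmoothSectionOn 𝓘(𝕜, E) F t (eT.baseSet ∩ e.baseSet) →
      ContMDiffAt (𝓘(𝕜, E).prod 𝓘(𝕜, F)) 𝓘(𝕜, 𝕜) ∞ (fun v : TotalSpace F V ↦
        totalMetric D gM gV α v (liftField D X s v) (liftField D Y t v)) w := by
    intro X Y s t hX hY hs ht
    simp only [totalMetric_liftField]
    replace hX := hX.contMDiffAt hO hxO
    replace hY := hY.contMDiffAt hO hxO
    replace hs := hs.contMDiffAt hO hxO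
    replace ht := ht.contMDiffAt hO hxO
    have h1 : ContMDiffAt 𝓘(𝕜, E) 𝓘(𝕜, 𝕜) ∞ (fun x ↦ gM x (X x) (Y x) + gM x (α x (s x)) (Y x)
        + gM x (X x) (α x (t x)) + gV x (s x) (t x)) w.proj :=
      (((hM _ _ _ hX hY).add (hM _ _ _ (hα.contMDiffAt hs) hY)).add
        (hM _ _ _ hX (hα.contMDiffAt ht))).add (hV _ _ _ hs ht)
    exact h1.comp (I' := 𝓘(𝕜, E)) w hpr
  have hframe : ∀ m m', ContMDiffAt (𝓘(𝕜, E).prod 𝓘(𝕜, F)) 𝓘(𝕜, 𝕜) ∞ (fun v : TotalSpace F V ↦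
      totalMetric D gM gV α v
        (liftFrame D (eT.localFrame (Module.finBasis 𝕜 E)) (e.localFrame (Module.finBasis 𝕜 F)) m v)
        (liftFrame D (eT.localFrame (Module.finBasis 𝕜 E)) (e.localFrame (Module.finBasis 𝕜 F))
          m' v)) w := fun m m' ↦
    hpair (smoothSectionOn_sumElim_left hA.contMDiffOn m)
      (smoothSectionOn_sumElim_left hA.contMDiffOn m')
      (smoothSectionOn_sumElim_right hS.contMDiffOn m)
      (smoothSectionOn_sumElim_right hS.contMDiffOn m')
  have hsum : ContMDiffAt (𝓘(𝕜, E).prod 𝓘(𝕜, F)) 𝓘(𝕜, 𝕜) ∞ (fun v : TotalSpace F V ↦ ∑ m, ∑ m',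
      hL.coeff m v (Z v) * (hL.coeff m' v (Z' v) * totalMetric D gM gV α v
        (liftFrame D (eT.localFrame (Module.finBasis 𝕜 E)) (e.localFrame (Module.finBasis 𝕜 F)) m v)
        (liftFrame D (eT.localFrame (Module.finBasis 𝕜 E)) (e.localFrame (Module.finBasis 𝕜 F))
          m' v))) w := by
    refine ContMDiffAt.sum fun m _ ↦ ContMDiffAt.sum fun m' _ ↦ ?_
    exact (contMDiffAt_coeff hL hpO hxO hZ m).mul
      ((contMDiffAt_coeff hL hpO hxO hZ' m').mul (hframe m m'))
  refine hsum.congr_of_eventuallyEq ?_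
  filter_upwards [hpO.mem_nhds hxO] with v hv
  conv_lhs => rw [hL.coeff_sum_eq Z hv, hL.coeff_sum_eq Z' hv]
  rw [map_sum, Finset.sum_comm]
  refine Finset.sum_congr rfl fun m' _ ↦ ?_
  rw [map_sum, sum_apply]
  refine Finset.sum_congr rfl fun m _ ↦ ?_
  simp only [map_smul, smul_apply, smul_eq_mul]
  ring

namespace FlatMetricPair

variable (h : FlatMetricPair nablaM D gM gV α)
include h

theorem symm_total (v : TotalSpace F V) (a b : TangentSpace (𝓘(𝕜, E).prod 𝓘(𝕜, F)) v) :
    totalMetric D gM gV α v a b = totalMetric D gM gV α v b a := by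
  rw [totalMetric_apply, totalMetric_apply, h.symm_base, h.symm,
    h.symm_base _ (α v.proj _) (projDeriv v b), h.symm_base _ (projDeriv v a)]
  ring

theorem smoothPairing_total : SmoothPairing (𝓘(𝕜, E).prod 𝓘(𝕜, F)) (totalMetric D gM gV α) :=
  smoothPairing_totalMetric h.preservesSmooth h.smooth_base h.smooth h.smooth_morphism

end FlatMetricPair

end AdaptedMetric

section ParallelLifts

set_option maxSynthPendingDepth 3

variable {𝕜 : Type*} [RCLike 𝕜]
  {E : Type*} [NormedAddCommGroup E] [NormedSpace 𝕜 E] [FiniteDimensional 𝕜 E]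
  {M : Type*} [TopologicalSpace M] [ChartedSpace E M] [IsManifold 𝓘(𝕜, E) ∞ M]
  {F : Type*} [NormedAddCommGroup F] [NormedSpace 𝕜 F] [FiniteDimensional 𝕜 F]
  {V : M → Type*} [TopologicalSpace (TotalSpace F V)]
  [∀ x, AddCommGroup (V x)] [∀ x, Module 𝕜 (V x)] [∀ x, TopologicalSpace (V x)]
  [∀ x, IsTopologicalAddGroup (V x)] [∀ x, ContinuousSMul 𝕜 (V x)]
  [FiberBundle F V] [VectorBundle 𝕜 F V] [ContMDiffVectorBundle ∞ F V 𝓘(𝕜, E)]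

/-- A pair of a parallel vector field on the base and a parallel section, over an open set. -/
structure ParallelLift (nablaM : CovariantDerivative 𝓘(𝕜, E) E (TangentSpace 𝓘(𝕜, E) : M → Type _))
    (D : CovariantDerivative 𝓘(𝕜, E) F V) (W : Set M) where
  /-- the vector field on the base -/
  base : Π x : M, TangentSpace 𝓘(𝕜, E) x
  /-- the section of the bundle -/
  fiber : Π x : M, V x
  smooth_base : SmoothSectionOn 𝓘(𝕜, E) E base W
  parallel_base : IsParallelOn 𝓘(𝕜, E) E nablaM base W
  smooth_fiber : SmoothSectionOn 𝓘(𝕜, E) F fiber W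
  parallel_fiber : IsParallelOn 𝓘(𝕜, E) F D fiber W

/-- The vector field on the total space given by a pair of parallel fields. -/
def ParallelLift.field {nablaM : CovariantDerivative 𝓘(𝕜, E) E (TangentSpace 𝓘(𝕜, E) : M → Type _)}
    {D : CovariantDerivative 𝓘(𝕜, E) F V} {W : Set M} (A : ParallelLift nablaM D W)
    (v : TotalSpace F V) : TangentSpace (𝓘(𝕜, E).prod 𝓘(𝕜, F)) v :=
  liftField D A.base A.fiber v

/-- The function `g_M(∇_Y(α(s)), X)`. -/
def alphaDeriv (nablaM : CovariantDerivative 𝓘(𝕜, E) E (TangentSpace 𝓘(𝕜, E) : M → Type _))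
    (gM : ∀ x : M, TangentSpace 𝓘(𝕜, E) x →L[𝕜] TangentSpace 𝓘(𝕜, E) x →L[𝕜] 𝕜)
    (α : ∀ x : M, V x →L[𝕜] TangentSpace 𝓘(𝕜, E) x) (s : Π x : M, V x)
    (Y X : Π x : M, TangentSpace 𝓘(𝕜, E) x) (x : M) : 𝕜 :=
  gM x (nablaM (fun y ↦ α y (s y)) x (Y x)) (X x)

variable {nablaM : CovariantDerivative 𝓘(𝕜, E) E (TangentSpace 𝓘(𝕜, E) : M → Type _)}
  {D : CovariantDerivative 𝓘(𝕜, E) F V}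
  {gM : ∀ x : M, TangentSpace 𝓘(𝕜, E) x →L[𝕜] TangentSpace 𝓘(𝕜, E) x →L[𝕜] 𝕜}
  {gV : ∀ x : M, V x →L[𝕜] V x →L[𝕜] 𝕜}
  {α : ∀ x : M, V x →L[𝕜] TangentSpace 𝓘(𝕜, E) x}
  {W : Set M}

namespace FlatMetricPair

theorem mvfderiv_alpha (h : FlatMetricPair nablaM D gM gV α) (hW : IsOpen W) {s : Π x : M, V x}
    {X : Π x : M, TangentSpace 𝓘(𝕜, E) x} (hs : SmoothSectionOn 𝓘(𝕜, E) F s W)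
    (hX : SmoothSectionOn 𝓘(𝕜, E) E X W) (hXp : IsParallelOn 𝓘(𝕜, E) E nablaM X W)
    {x : M} (hx : x ∈ W) (u : TangentSpace 𝓘(𝕜, E) x) :
    mvfderiv 𝓘(𝕜, E) (fun y ↦ gM y (α y (s y)) (X y)) x u =
      gM x (nablaM (fun y ↦ α y (s y)) x u) (X x) := by
  rw [h.leviCivita.metric (fun y ↦ α y (s y)) X x u
    ((h.smooth_morphism.smoothSectionOn hW hs).mdiffAt hW hx) (hX.mdiffAt hW hx), hXp x hx]
  simp

theorem contMDiffAt_alpha (h : FlatMetricPair nablaM D gM gV α) (hW : IsOpen W) {s : Π x : M, V x}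
    {X : Π x : M, TangentSpace 𝓘(𝕜, E) x} (hs : SmoothSectionOn 𝓘(𝕜, E) F s W)
    (hX : SmoothSectionOn 𝓘(𝕜, E) E X W) {x : M} (hx : x ∈ W) :
    ContMDiffAt 𝓘(𝕜, E) 𝓘(𝕜, 𝕜) ∞ (fun y ↦ gM y (α y (s y)) (X y)) x :=
  h.smooth_base _ _ x ((h.smooth_morphism.smoothSectionOn hW hs).contMDiffAt hW hx)
    (hX.contMDiffAt hW hx)

theorem contMDiffAt_alphaDeriv (h : FlatMetricPair nablaM D gM gV α) (hW : IsOpen W)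
    {s : Π x : M, V x} {X Y : Π x : M, TangentSpace 𝓘(𝕜, E) x}
    (hs : SmoothSectionOn 𝓘(𝕜, E) F s W) (hX : SmoothSectionOn 𝓘(𝕜, E) E X W)
    (hY : SmoothSectionOn 𝓘(𝕜, E) E Y W) {x : M} (hx : x ∈ W) :
    ContMDiffAt 𝓘(𝕜, E) 𝓘(𝕜, 𝕜) ∞ (alphaDeriv nablaM gM α s Y X) x :=
  h.smooth_base _ _ x ((h.preservesSmooth_base W Y (fun y ↦ α y (s y)) hW hY
    (h.smooth_morphism.smoothSectionOn hW hs)).contMDiffAt hW hx) (hX.contMDiffAt hW hx)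

theorem mlieBracket_eq_zero (h : FlatMetricPair nablaM D gM gV α) (hW : IsOpen W)
    {X Y : Π x : M, TangentSpace 𝓘(𝕜, E) x}
    (hX : SmoothSectionOn 𝓘(𝕜, E) E X W) (hXp : IsParallelOn 𝓘(𝕜, E) E nablaM X W)
    (hY : SmoothSectionOn 𝓘(𝕜, E) E Y W) (hYp : IsParallelOn 𝓘(𝕜, E) E nablaM Y W)
    {x : M} (hx : x ∈ W) : mlieBracket 𝓘(𝕜, E) X Y x = 0 := by
  rw [← h.leviCivita.torsion_free X Y x (hX.mdiffAt hW hx) (hY.mdiffAt hW hx), hXp x hx, hYp x hx]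
  simp

theorem mvfderiv_alphaDeriv_symm (h : FlatMetricPair nablaM D gM gV α) (hW : IsOpen W)
    {s : Π x : M, V x} {X Y Z : Π x : M, TangentSpace 𝓘(𝕜, E) x}
    (hs : SmoothSectionOn 𝓘(𝕜, E) F s W)
    (hX : SmoothSectionOn 𝓘(𝕜, E) E X W) (hXp : IsParallelOn 𝓘(𝕜, E) E nablaM X W)
    (hY : SmoothSectionOn 𝓘(𝕜, E) E Y W) (hYp : IsParallelOn 𝓘(𝕜, E) E nablaM Y W)
    (hZ : SmoothSectionOn 𝓘(𝕜, E) E Z W) (hZp : IsParallelOn 𝓘(𝕜, E) E nablaM Z W)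
    {x : M} (hx : x ∈ W) :
    mvfderiv 𝓘(𝕜, E) (alphaDeriv nablaM gM α s Y X) x (Z x) =
      mvfderiv 𝓘(𝕜, E) (alphaDeriv nablaM gM α s Z X) x (Y x) := by
  have _ : CompleteSpace E := FiniteDimensional.complete 𝕜 E
  have h1 := mvfderiv_mlieBracket ((h.contMDiffAt_alpha hW hs hX hx).of_le (by norm_cast))
    (hZ.mdiffAt hW hx) (hY.mdiffAt hW hx)
  rw [h.mlieBracket_eq_zero hW hZ hZp hY hYp hx, map_zero] at h1
  have h2 : ∀ T : Π x : M, TangentSpace 𝓘(𝕜, E) x,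
      (fun y ↦ mvfderiv 𝓘(𝕜, E) (fun y ↦ gM y (α y (s y)) (X y)) y (T y)) =ᶠ[𝓝 x]
        alphaDeriv nablaM gM α s T X := fun T ↦ by
    filter_upwards [hW.mem_nhds hx] with y hy
    exact h.mvfderiv_alpha hW hs hX hXp hy _
  rw [mvfderiv_congr (h2 Y), mvfderiv_congr (h2 Z)] at h1
  exact (sub_eq_zero.1 h1.symm)

theorem mvfderiv_alphaDeriv (h : FlatMetricPair nablaM D gM gV α) (hW : IsOpen W)
    {s : Π x : M, V x} {X Y : Π x : M, TangentSpace 𝓘(𝕜, E) x}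
    (hs : SmoothSectionOn 𝓘(𝕜, E) F s W)
    (hX : SmoothSectionOn 𝓘(𝕜, E) E X W) (hXp : IsParallelOn 𝓘(𝕜, E) E nablaM X W)
    (hY : SmoothSectionOn 𝓘(𝕜, E) E Y W) {x : M} (hx : x ∈ W) (u : TangentSpace 𝓘(𝕜, E) x) :
    mvfderiv 𝓘(𝕜, E) (alphaDeriv nablaM gM α s Y X) x u =
      gM x (nablaM (fun y ↦ nablaM (fun z ↦ α z (s z)) y (Y y)) x u) (X x) := by
  have h1 := h.leviCivita.metric (fun y ↦ nablaM (fun z ↦ α z (s z)) y (Y y)) X x u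
    ((h.preservesSmooth_base W Y (fun y ↦ α y (s y)) hW hY
      (h.smooth_morphism.smoothSectionOn hW hs)).mdiffAt hW hx) (hX.mdiffAt hW hx)
  rw [hXp x hx, zero_apply, map_zero, add_zero] at h1
  exact h1

variable (h : FlatMetricPair nablaM D gM gV α) (hW : IsOpen W) (A B C : ParallelLift nablaM D W)
  {w : TotalSpace F V} (hw : w.proj ∈ W)
include h hW hw

theorem mdiffAt_field : MDiffAt (T% A.field) w :=
  (smoothSectionOn_liftField h.preservesSmooth hW A.smooth_base A.smooth_fiber).mdiffAt
    (isOpen_proj_preimage hW) hw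

theorem mlieBracket_field_eq_zero : mlieBracket (𝓘(𝕜, E).prod 𝓘(𝕜, F)) A.field B.field w = 0 := by
  refine totalTangent_ext D ?_ ?_
  · refine (projDeriv_mlieBracket_liftField h.preservesSmooth hW A.smooth_base A.smooth_fiber
      B.smooth_base B.smooth_fiber hw).trans ?_
    rw [h.mlieBracket_eq_zero hW A.smooth_base A.parallel_base B.smooth_base B.parallel_base hw,
      map_zero]
  · set e := trivializationAt F V w.proj
    have hwe : w.proj ∈ e.baseSet := FiberBundle.mem_baseSet_trivializationAt' w.proj
    refine (connectionMap_mlieBracket_liftField h.preservesSmooth hW A.smooth_base A.smooth_fiber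
      B.smooth_base B.smooth_fiber e hw hwe).trans ?_
    rw [A.parallel_fiber _ hw, B.parallel_fiber _ hw,
      h.flat (W ∩ e.baseSet) (hW.inter e.open_baseSet) (subset_univ _) _ _ _
        (A.smooth_base.mono' inter_subset_left) (B.smooth_base.mono' inter_subset_left)
        ((smoothSectionOn_symm e (e w).2).mono' inter_subset_right) _ ⟨hw, hwe⟩]
    simp

theorem mvfderiv_totalMetric_field :
    mvfderiv (𝓘(𝕜, E).prod 𝓘(𝕜, F)) (fun v ↦ totalMetric D gM gV α v (A.field v) (B.field v)) w (C.field w) =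
      alphaDeriv nablaM gM α A.fiber C.base B.base w.proj
        + alphaDeriv nablaM gM α B.fiber C.base A.base w.proj := by
  simp only [ParallelLift.field, totalMetric_liftField]
  have h1 := h.smooth_base _ _ _ (A.smooth_base.contMDiffAt hW hw) (B.smooth_base.contMDiffAt hW hw)
  have h2 := h.contMDiffAt_alpha hW A.smooth_fiber B.smooth_base hw
  have h3 := h.contMDiffAt_alpha hW B.smooth_fiber A.smooth_base hw
  have h4 := h.smooth _ _ _ (A.smooth_fiber.contMDiffAt hW hw) (B.smooth_fiber.contMDiffAt hW hw)
  simp only [h.symm_base _ (A.base _) (α _ _)]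
  replace h1 := contMDiffAt_fun_mdiffAt h1
  replace h2 := contMDiffAt_fun_mdiffAt h2
  replace h3 := contMDiffAt_fun_mdiffAt h3
  replace h4 := contMDiffAt_fun_mdiffAt h4
  have key : ∀ {f₁ f₂ f₃ f₄ : M → 𝕜} {x : M} (u : TangentSpace 𝓘(𝕜, E) x), MDiffAt f₁ x → MDiffAt f₂ x →
      MDiffAt f₃ x → MDiffAt f₄ x → mvfderiv 𝓘(𝕜, E) (fun y ↦ f₁ y + f₂ y + f₃ y + f₄ y) x u =
        mvfderiv 𝓘(𝕜, E) f₁ x u + mvfderiv 𝓘(𝕜, E) f₂ x u + mvfderiv 𝓘(𝕜, E) f₃ x u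
          + mvfderiv 𝓘(𝕜, E) f₄ x u := by
    intro f₁ f₂ f₃ f₄ x u h1 h2 h3 h4
    rw [mvfderiv_add_apply (f := fun y ↦ f₁ y + f₂ y + f₃ y) ((h1.add h2).add h3) h4,
      mvfderiv_add_apply (f := fun y ↦ f₁ y + f₂ y) (h1.add h2) h3, mvfderiv_add_apply h1 h2]
  rw [mvfderiv_comp_proj (f := fun x ↦ gM x (A.base x) (B.base x) + gM x (α x (A.fiber x)) (B.base x)
      + gM x (α x (B.fiber x)) (A.base x) + gV x (A.fiber x) (B.fiber x))
      (((h1.add h2).add h3).add h4), projDeriv_liftField,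
    key _ h1 h2 h3 h4, h.mvfderiv_alpha hW A.smooth_fiber B.smooth_base B.parallel_base hw,
    h.mvfderiv_alpha hW B.smooth_fiber A.smooth_base A.parallel_base hw,
    h.leviCivita.metric _ _ _ _ (A.smooth_base.mdiffAt hW hw) (B.smooth_base.mdiffAt hW hw),
    h.metric W _ _ hW A.smooth_fiber B.smooth_fiber _ hw, A.parallel_base _ hw,
    B.parallel_base _ hw, A.parallel_fiber _ hw, B.parallel_fiber _ hw]
  simp [alphaDeriv]

theorem two_mul_totalMetric_nabla
    {nabla : CovariantDerivative (𝓘(𝕜, E).prod 𝓘(𝕜, F)) (E × F) (TangentSpace (𝓘(𝕜, E).prod 𝓘(𝕜, F)) : TotalSpace F V → Type _)}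
    (hLC : IsLeviCivita (𝓘(𝕜, E).prod 𝓘(𝕜, F)) (totalMetric D gM gV α) nabla) :
    2 * totalMetric D gM gV α w (nabla B.field w (A.field w)) (C.field w) =
      alphaDeriv nablaM gM α B.fiber A.base C.base w.proj
        - alphaDeriv nablaM gM α B.fiber C.base A.base w.proj
        + (alphaDeriv nablaM gM α A.fiber B.base C.base w.proj
          - alphaDeriv nablaM gM α A.fiber C.base B.base w.proj)
        + (alphaDeriv nablaM gM α C.fiber A.base B.base w.proj
          + alphaDeriv nablaM gM α C.fiber B.base A.base w.proj) := by
  rw [hLC.koszul h.symm_total (h.mdiffAt_field hW A hw) (h.mdiffAt_field hW B hw)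
    (h.mdiffAt_field hW C hw), h.mvfderiv_totalMetric_field hW _ _ _ hw,
    h.mvfderiv_totalMetric_field hW _ _ _ hw, h.mvfderiv_totalMetric_field hW _ _ _ hw,
    h.mlieBracket_field_eq_zero hW _ _ hw, h.mlieBracket_field_eq_zero hW _ _ hw,
    h.mlieBracket_field_eq_zero hW _ _ hw]
  simp only [map_zero, zero_apply]
  ring

end FlatMetricPair

end ParallelLifts

section OrthonormalExpansion

theorem bilin_eq_sum_of_orthonormal {𝕜 T ι : Type*} [Field 𝕜] [AddCommGroup T] [Module 𝕜 T]
    [Fintype ι] (B : T → T →ₗ[𝕜] 𝕜) (O : ι → T)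
    (horth : ∀ i j, i ≠ j → B (O i) (O j) = 0) (hnorm : ∀ i, B (O i) (O i) = 1 ∨ B (O i) (O i) = -1)
    (hsymm : ∀ a b, B a b = B b a) (P : T) {Q : T} (hQ : Q ∈ Submodule.span 𝕜 (Set.range O)) :
    B P Q = ∑ i, B (O i) (O i) * (B P (O i) * B Q (O i)) := by
  classical
  obtain ⟨c, rfl⟩ := (Submodule.mem_span_range_iff_exists_fun 𝕜).1 hQ
  rw [map_sum]
  refine Finset.sum_congr rfl fun i _ ↦ ?_
  have h1 : B (∑ j, c j • O j) (O i) = c i * B (O i) (O i) := by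
    rw [hsymm, map_sum, Finset.sum_eq_single i]
    · rw [map_smul, smul_eq_mul]
    · intro j _ hj
      rw [map_smul, horth _ _ hj.symm, smul_zero]
    · simp
  have h2 : B (O i) (O i) * B (O i) (O i) = 1 := by
    rcases hnorm i with h | h <;> rw [h] <;> ring
  rw [h1, map_smul, smul_eq_mul]
  linear_combination (- c i * B P (O i)) * h2

end OrthonormalExpansion

section CurvatureFormula

set_option maxSynthPendingDepth 3

variable {𝕜 : Type*} [RCLike 𝕜]
  {E : Type*} [NormedAddCommGroup E] [NormedSpace 𝕜 E] [FiniteDimensional 𝕜 E]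
  {M : Type*} [TopologicalSpace M] [ChartedSpace E M] [IsManifold 𝓘(𝕜, E) ∞ M]
  {F : Type*} [NormedAddCommGroup F] [NormedSpace 𝕜 F] [FiniteDimensional 𝕜 F]
  {V : M → Type*} [TopologicalSpace (TotalSpace F V)]
  [∀ x, AddCommGroup (V x)] [∀ x, Module 𝕜 (V x)] [∀ x, TopologicalSpace (V x)]
  [∀ x, IsTopologicalAddGroup (V x)] [∀ x, ContinuousSMul 𝕜 (V x)]
  [FiberBundle F V] [VectorBundle 𝕜 F V] [ContMDiffVectorBundle ∞ F V 𝓘(𝕜, E)]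

/-- The function `U(g_M(∇_Y(α(s)), X))`. -/
def alphaHess (nablaM : CovariantDerivative 𝓘(𝕜, E) E (TangentSpace 𝓘(𝕜, E) : M → Type _))
    (gM : ∀ x : M, TangentSpace 𝓘(𝕜, E) x →L[𝕜] TangentSpace 𝓘(𝕜, E) x →L[𝕜] 𝕜)
    (α : ∀ x : M, V x →L[𝕜] TangentSpace 𝓘(𝕜, E) x) (s : Π x : M, V x)
    (U Y X : Π x : M, TangentSpace 𝓘(𝕜, E) x) (x : M) : 𝕜 :=
  mvfderiv 𝓘(𝕜, E) (alphaDeriv nablaM gM α s Y X) x (U x)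

/-- The trilinear form `(a, u, v) ↦ g_M((∇_u α)(a), v)` at a point. -/
def alphaForm (nablaM : CovariantDerivative 𝓘(𝕜, E) E (TangentSpace 𝓘(𝕜, E) : M → Type _))
    (D : CovariantDerivative 𝓘(𝕜, E) F V)
    (gM : ∀ x : M, TangentSpace 𝓘(𝕜, E) x →L[𝕜] TangentSpace 𝓘(𝕜, E) x →L[𝕜] 𝕜)
    (α : ∀ x : M, V x →L[𝕜] TangentSpace 𝓘(𝕜, E) x) (x : M) (a : V x)
    (u v : TangentSpace 𝓘(𝕜, E) x) : 𝕜 :=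
  gM x (nablaM (fun y ↦ α y (FiberBundle.extend F a y)) x u
    - α x (D (FiberBundle.extend F a) x u)) v

/-- The skew-symmetric part of `alphaForm` in the two tangent vectors (without the factor `1/2`). -/
def alphaSkew (nablaM : CovariantDerivative 𝓘(𝕜, E) E (TangentSpace 𝓘(𝕜, E) : M → Type _))
    (D : CovariantDerivative 𝓘(𝕜, E) F V)
    (gM : ∀ x : M, TangentSpace 𝓘(𝕜, E) x →L[𝕜] TangentSpace 𝓘(𝕜, E) x →L[𝕜] 𝕜)
    (α : ∀ x : M, V x →L[𝕜] TangentSpace 𝓘(𝕜, E) x) (x : M) (a : V x)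
    (u v : TangentSpace 𝓘(𝕜, E) x) : 𝕜 :=
  alphaForm nablaM D gM α x a u v - alphaForm nablaM D gM α x a v u

/-- The symmetric part of `alphaForm` in the two tangent vectors (without the factor `1/2`). -/
def alphaSym (nablaM : CovariantDerivative 𝓘(𝕜, E) E (TangentSpace 𝓘(𝕜, E) : M → Type _))
    (D : CovariantDerivative 𝓘(𝕜, E) F V)
    (gM : ∀ x : M, TangentSpace 𝓘(𝕜, E) x →L[𝕜] TangentSpace 𝓘(𝕜, E) x →L[𝕜] 𝕜)
    (α : ∀ x : M, V x →L[𝕜] TangentSpace 𝓘(𝕜, E) x) (x : M) (a : V x)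
    (u v : TangentSpace 𝓘(𝕜, E) x) : 𝕜 :=
  alphaForm nablaM D gM α x a u v + alphaForm nablaM D gM α x a v u

variable {nablaM : CovariantDerivative 𝓘(𝕜, E) E (TangentSpace 𝓘(𝕜, E) : M → Type _)}
  {D : CovariantDerivative 𝓘(𝕜, E) F V}
  {gM : ∀ x : M, TangentSpace 𝓘(𝕜, E) x →L[𝕜] TangentSpace 𝓘(𝕜, E) x →L[𝕜] 𝕜}
  {gV : ∀ x : M, V x →L[𝕜] V x →L[𝕜] 𝕜}
  {α : ∀ x : M, V x →L[𝕜] TangentSpace 𝓘(𝕜, E) x}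
  {W : Set M}

theorem IsSmoothMorphism.mdiffAt (hα : IsSmoothMorphism (F := F) α) {s : Π x : M, V x} {x : M}
    (hs : MDiffAt (T% s) x) : MDiffAt (T% fun y ↦ (α y (s y) : TangentSpace 𝓘(𝕜, E) y)) x :=
  MDifferentiableAt.clm_bundle_apply (b := fun y ↦ y)
    ((ContMDiff.contMDiffAt hα).mdifferentiableAt (by simp)) hs

theorem nablaAlpha_eq_extend (hα : IsSmoothMorphism (F := F) α) {s : Π x : M, V x} {x : M}
    (hs : MDiffAt (T% s) x) (u : TangentSpace 𝓘(𝕜, E) x) :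
    nablaM (fun y ↦ α y (s y)) x u - α x (D s x u) =
      nablaM (fun y ↦ α y (FiberBundle.extend F (s x) y)) x u
        - α x (D (FiberBundle.extend F (s x)) x u) := by
  have hΦ : TensorialAt 𝓘(𝕜, E) F (fun t : Π x : M, V x ↦
      nablaM (fun y ↦ α y (t y)) x u - α x (D t x u)) x := by
    refine ⟨fun {f σ} hf hσ ↦ ?_, fun {σ σ'} hσ hσ' ↦ ?_⟩
    · have h1 := nabla_smul_apply nablaM hf (hα.mdiffAt hσ) u
      have h2 := nabla_smul_apply D hf hσ u
      simp only [Pi.smul_apply', map_smul]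
      have e1 : (fun y ↦ f y • σ y) = f • σ := rfl
      rw [e1] at h2
      rw [h1, h2, map_add, map_smul, map_smul, smul_sub]
      abel
    · have h1 := nabla_add_apply nablaM (hα.mdiffAt hσ) (hα.mdiffAt hσ') u
      have h2 := nabla_add_apply D hσ hσ' u
      simp only [Pi.add_apply, map_add]
      have e1 : (fun y ↦ σ y + σ' y) = σ + σ' := rfl
      rw [e1] at h2
      rw [h1, h2, map_add]
      abel
  have : ContMDiffVectorBundle 1 F V 𝓘(𝕜, E) := .of_le (n := ∞) (by norm_cast)
  exact hΦ.pointwise hs (FiberBundle.mdifferentiableAt_extend 𝓘(𝕜, E) F (s x)) (by simp)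

theorem symNablaAlpha_eq (hα : IsSmoothMorphism (F := F) α) {s : Π x : M, V x} {x : M}
    (hs : MDiffAt (T% s) x) (X Z : Π x : M, TangentSpace 𝓘(𝕜, E) x) :
    symNablaAlpha nablaM D gM α X Z s x = alphaSym nablaM D gM α x (s x) (X x) (Z x) := by
  rw [symNablaAlpha, nablaAlpha, nablaAlpha, nablaAlpha_eq_extend hα hs,
    nablaAlpha_eq_extend hα hs, alphaSym, alphaForm, alphaForm]

theorem alphaDeriv_eq (hα : IsSmoothMorphism (F := F) α) {s : Π x : M, V x} {x : M}
    (hs : MDiffAt (T% s) x) (hp : D s x = 0) (Y X : Π x : M, TangentSpace 𝓘(𝕜, E) x) :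
    alphaDeriv nablaM gM α s Y X x = alphaForm nablaM D gM α x (s x) (Y x) (X x) := by
  rw [alphaForm, ← nablaAlpha_eq_extend hα hs, hp, alphaDeriv]
  simp

theorem dOneForm_alphaFlat_eq (hα : IsSmoothMorphism (F := F) α)
    (hLC : IsLeviCivita 𝓘(𝕜, E) gM nablaM) {s : Π x : M, V x} {x : M}
    (hs : MDiffAt (T% s) x) (hp : D s x = 0) {A B : Π x : M, TangentSpace 𝓘(𝕜, E) x}
    (hA : MDiffAt (T% A) x) (hB : MDiffAt (T% B) x) :
    dOneForm 𝓘(𝕜, E) (alphaFlat gM α s) A B x =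
      alphaSkew nablaM D gM α x (s x) (A x) (B x) := by
  rw [alphaSkew, ← alphaDeriv_eq hα hs hp, ← alphaDeriv_eq hα hs hp, dOneForm,
    ← hLC.torsion_free A B x hA hB]
  simp only [alphaFlat]
  rw [hLC.metric _ _ _ _ (hα.mdiffAt hs) hA, hLC.metric _ _ _ _ (hα.mdiffAt hs) hB, map_sub,
    alphaDeriv, alphaDeriv]
  ring

theorem alphaForm_zero (hα : IsSmoothMorphism (F := F) α) (x : M)
    (u v : TangentSpace 𝓘(𝕜, E) x) : alphaForm nablaM D gM α x 0 u v = 0 := by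
  have h0 : MDiffAt (T% (fun _ ↦ 0 : Π x : M, V x)) x :=
    (smoothSectionOn_zero (U := univ)).mdiffAt isOpen_univ (mem_univ x)
  have := nablaAlpha_eq_extend (nablaM := nablaM) (D := D) hα h0 u
  rw [alphaForm, ← this, nabla_zero_apply]
  simp [nabla_zero_apply]

namespace FlatMetricPair

theorem four_mul_curvature_eq_hess (h : FlatMetricPair nablaM D gM gV α) (hW : IsOpen W)
    (A B C B' : ParallelLift nablaM D W) {w : TotalSpace F V} (hw : w.proj ∈ W)
    {nabla : CovariantDerivative (𝓘(𝕜, E).prod 𝓘(𝕜, F)) (E × F) (TangentSpace (𝓘(𝕜, E).prod 𝓘(𝕜, F)) : TotalSpace F V → Type _)}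
    (hLC : IsLeviCivita (𝓘(𝕜, E).prod 𝓘(𝕜, F)) (totalMetric D gM gV α) nabla) :
    2 * totalMetric D gM gV α w (curvature (𝓘(𝕜, E).prod 𝓘(𝕜, F)) (E × F) nabla A.field B.field C.field w) (B'.field w)
      = alphaHess nablaM gM α C.fiber B.base B'.base A.base w.proj
        - alphaHess nablaM gM α C.fiber A.base B'.base B.base w.proj
        + (alphaHess nablaM gM α B.fiber A.base C.base B'.base w.proj
          - alphaHess nablaM gM α B.fiber A.base B'.base C.base w.proj)
        - (alphaHess nablaM gM α A.fiber B.base C.base B'.base w.proj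
          - alphaHess nablaM gM α A.fiber B.base B'.base C.base w.proj)
        + (alphaHess nablaM gM α B'.fiber A.base C.base B.base w.proj
          - alphaHess nablaM gM α B'.fiber B.base C.base A.base w.proj)
        - 2 * totalMetric D gM gV α w (nabla C.field w (B.field w)) (nabla B'.field w (A.field w))
        + 2 * totalMetric D gM gV α w (nabla C.field w (A.field w))
          (nabla B'.field w (B.field w)) := by
  have hpW := isOpen_proj_preimage (F := F) (V := V) hW
  have hsm : ∀ P : ParallelLift nablaM D W,
      SmoothSectionOn (𝓘(𝕜, E).prod 𝓘(𝕜, F)) (E × F) P.field (TotalSpace.proj ⁻¹' W : Set (TotalSpace F V)) := fun P ↦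
    smoothSectionOn_liftField h.preservesSmooth hW P.smooth_base P.smooth_fiber
  have hder : ∀ P Q : ParallelLift nablaM D W,
      2 * totalMetric D gM gV α w (nabla (fun v ↦ nabla C.field v (Q.field v)) w (P.field w))
        (B'.field w) =
      alphaHess nablaM gM α C.fiber P.base Q.base B'.base w.proj
        - alphaHess nablaM gM α C.fiber P.base B'.base Q.base w.proj
        + (alphaHess nablaM gM α Q.fiber P.base C.base B'.base w.proj
          - alphaHess nablaM gM α Q.fiber P.base B'.base C.base w.proj)
        + (alphaHess nablaM gM α B'.fiber P.base Q.base C.base w.proj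
          + alphaHess nablaM gM α B'.fiber P.base C.base Q.base w.proj)
        - 2 * totalMetric D gM gV α w (nabla C.field w (Q.field w))
          (nabla B'.field w (P.field w)) := by
    intro P Q
    have h1 := hLC.metric (fun v ↦ nabla C.field v (Q.field v)) B'.field w (P.field w)
      ((hLC.contMDiffAt h.symm_total h.nondegenerate h.smoothPairing_total hpW (hsm Q) (hsm C)
        hw).mdifferentiableAt (by simp)) ((hsm B').mdiffAt hpW hw)
    have hd : ∀ (S Y X : ParallelLift nablaM D W),
        MDiffAt (alphaDeriv nablaM gM α S.fiber Y.base X.base) w.proj := fun S Y X ↦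
      contMDiffAt_fun_mdiffAt
        (h.contMDiffAt_alphaDeriv hW S.smooth_fiber X.smooth_base Y.smooth_base hw)
    have key : ∀ {f₁ f₂ f₃ f₄ f₅ f₆ : M → 𝕜} {x : M} (u : TangentSpace 𝓘(𝕜, E) x), MDiffAt f₁ x →
        MDiffAt f₂ x → MDiffAt f₃ x → MDiffAt f₄ x → MDiffAt f₅ x → MDiffAt f₆ x →
        mvfderiv 𝓘(𝕜, E) (fun y ↦ f₁ y - f₂ y + (f₃ y - f₄ y) + (f₅ y + f₆ y)) x u =
          mvfderiv 𝓘(𝕜, E) f₁ x u - mvfderiv 𝓘(𝕜, E) f₂ x u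
            + (mvfderiv 𝓘(𝕜, E) f₃ x u - mvfderiv 𝓘(𝕜, E) f₄ x u)
            + (mvfderiv 𝓘(𝕜, E) f₅ x u + mvfderiv 𝓘(𝕜, E) f₆ x u) := by
      intro f₁ f₂ f₃ f₄ f₅ f₆ x u h1 h2 h3 h4 h5 h6
      rw [mvfderiv_add_apply (f := fun y ↦ f₁ y - f₂ y + (f₃ y - f₄ y))
          (h := fun y ↦ f₅ y + f₆ y) ((h1.sub h2).add (h3.sub h4)) (h5.add h6),
        mvfderiv_add_apply (f := fun y ↦ f₁ y - f₂ y) (h := fun y ↦ f₃ y - f₄ y) (h1.sub h2)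
          (h3.sub h4), mvfderiv_add_apply h5 h6, mvfderiv_sub_apply h1 h2,
        mvfderiv_sub_apply h3 h4]
    let Φ : M → 𝕜 := fun y ↦ alphaDeriv nablaM gM α C.fiber Q.base B'.base y
        - alphaDeriv nablaM gM α C.fiber B'.base Q.base y
        + (alphaDeriv nablaM gM α Q.fiber C.base B'.base y
          - alphaDeriv nablaM gM α Q.fiber B'.base C.base y)
        + (alphaDeriv nablaM gM α B'.fiber Q.base C.base y
          + alphaDeriv nablaM gM α B'.fiber C.base Q.base y)
    have hΦ : MDiffAt Φ w.proj := (((hd _ _ _).sub (hd _ _ _)).add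
      ((hd _ _ _).sub (hd _ _ _))).add ((hd _ _ _).add (hd _ _ _))
    have hev : (fun v ↦ totalMetric D gM gV α v (nabla C.field v (Q.field v)) (B'.field v)) =ᶠ[𝓝 w]
        fun v ↦ ((2 : 𝕜)⁻¹ • ContinuousLinearMap.id 𝕜 𝕜) (Φ v.proj) := by
      filter_upwards [hpW.mem_nhds hw] with v hv
      have := h.two_mul_totalMetric_nabla hW Q C B' hv hLC
      have h2 : (2 : 𝕜) ≠ 0 := two_ne_zero
      simp only [Φ, ← this, smul_apply, ContinuousLinearMap.id_apply, smul_eq_mul]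
      field_simp
    have h2 : (2 : 𝕜) * (2 : 𝕜)⁻¹ = 1 := mul_inv_cancel₀ two_ne_zero
    rw [mvfderiv_congr hev, mvfderiv_clm_comp _ (f := fun v : TotalSpace F V ↦ Φ v.proj)
      (hΦ.comp (I' := 𝓘(𝕜, E)) w (mdiffAt_proj w)), mvfderiv_comp_proj hΦ,
      ParallelLift.field, projDeriv_liftField, key _ (hd _ _ _) (hd _ _ _) (hd _ _ _) (hd _ _ _)
        (hd _ _ _) (hd _ _ _)] at h1
    simp only [smul_apply, ContinuousLinearMap.id_apply, smul_eq_mul] at h1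
    simp only [alphaHess]
    simp only [ParallelLift.field] at h1 ⊢
    linear_combination (-2) * h1 + (mvfderiv 𝓘(𝕜, E) (alphaDeriv nablaM gM α C.fiber Q.base B'.base) w.proj (P.base w.proj)
        - mvfderiv 𝓘(𝕜, E) (alphaDeriv nablaM gM α C.fiber B'.base Q.base) w.proj (P.base w.proj)
        + (mvfderiv 𝓘(𝕜, E) (alphaDeriv nablaM gM α Q.fiber C.base B'.base) w.proj (P.base w.proj)
          - mvfderiv 𝓘(𝕜, E) (alphaDeriv nablaM gM α Q.fiber B'.base C.base) w.proj (P.base w.proj))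
        + (mvfderiv 𝓘(𝕜, E) (alphaDeriv nablaM gM α B'.fiber Q.base C.base) w.proj (P.base w.proj)
          + mvfderiv 𝓘(𝕜, E) (alphaDeriv nablaM gM α B'.fiber C.base Q.base) w.proj (P.base w.proj))) * h2
  have hsym : ∀ S P Q R : ParallelLift nablaM D W,
      alphaHess nablaM gM α S.fiber P.base Q.base R.base w.proj =
        alphaHess nablaM gM α S.fiber Q.base P.base R.base w.proj := fun S P Q R ↦
    h.mvfderiv_alphaDeriv_symm hW S.smooth_fiber R.smooth_base R.parallel_base Q.smooth_base
      Q.parallel_base P.smooth_base P.parallel_base hw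
  have hAB := hder A B
  have hBA := hder B A
  rw [hsym C B A B', hsym B' B A C] at hBA
  rw [curvature, h.mlieBracket_field_eq_zero hW A B hw, map_zero, sub_zero, map_sub, sub_apply]
  linear_combination hAB - hBA

end FlatMetricPair

end CurvatureFormula

section OrthonormalFormula

set_option maxSynthPendingDepth 3

variable {𝕜 : Type*} [RCLike 𝕜]
  {E : Type*} [NormedAddCommGroup E] [NormedSpace 𝕜 E] [FiniteDimensional 𝕜 E]
  {M : Type*} [TopologicalSpace M] [ChartedSpace E M] [IsManifold 𝓘(𝕜, E) ∞ M]
  {F : Type*} [NormedAddCommGroup F] [NormedSpace 𝕜 F] [FiniteDimensional 𝕜 F]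
  {V : M → Type*} [TopologicalSpace (TotalSpace F V)]
  [∀ x, AddCommGroup (V x)] [∀ x, Module 𝕜 (V x)] [∀ x, TopologicalSpace (V x)]
  [∀ x, IsTopologicalAddGroup (V x)] [∀ x, ContinuousSMul 𝕜 (V x)]
  [FiberBundle F V] [VectorBundle 𝕜 F V] [ContMDiffVectorBundle ∞ F V 𝓘(𝕜, E)]

variable {nablaM : CovariantDerivative 𝓘(𝕜, E) E (TangentSpace 𝓘(𝕜, E) : M → Type _)}
  {D : CovariantDerivative 𝓘(𝕜, E) F V}
  {gM : ∀ x : M, TangentSpace 𝓘(𝕜, E) x →L[𝕜] TangentSpace 𝓘(𝕜, E) x →L[𝕜] 𝕜}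
  {gV : ∀ x : M, V x →L[𝕜] V x →L[𝕜] 𝕜}
  {α : ∀ x : M, V x →L[𝕜] TangentSpace 𝓘(𝕜, E) x}
  {W U : Set M}

theorem alphaForm_zero_right (x : M) (a : V x) (u : TangentSpace 𝓘(𝕜, E) x) :
    alphaForm nablaM D gM α x a u 0 = 0 := by
  rw [alphaForm, map_zero]

theorem alphaForm_zero_left (x : M) (a : V x) (u : TangentSpace 𝓘(𝕜, E) x) :
    alphaForm nablaM D gM α x a 0 u = 0 := by
  simp [alphaForm]

theorem alphaForm_neg_right (x : M) (a : V x) (u v : TangentSpace 𝓘(𝕜, E) x) :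
    alphaForm nablaM D gM α x a u (-v) = - alphaForm nablaM D gM α x a u v := by
  rw [alphaForm, map_neg]; rfl

theorem alphaForm_neg_left (x : M) (a : V x) (u v : TangentSpace 𝓘(𝕜, E) x) :
    alphaForm nablaM D gM α x a (-u) v = - alphaForm nablaM D gM α x a u v := by
  rw [alphaForm, map_neg, map_neg, map_neg, ← neg_sub', map_neg]
  rfl

theorem alphaSkew_swap (x : M) (a : V x) (u v : TangentSpace 𝓘(𝕜, E) x) :
    alphaSkew nablaM D gM α x a u v = - alphaSkew nablaM D gM α x a v u := by
  rw [alphaSkew, alphaSkew, neg_sub]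

theorem alphaSkew_neg_right (x : M) (a : V x) (u v : TangentSpace 𝓘(𝕜, E) x) :
    alphaSkew nablaM D gM α x a u (-v) = - alphaSkew nablaM D gM α x a u v := by
  rw [alphaSkew, alphaSkew, alphaForm_neg_left, alphaForm_neg_right]
  ring

theorem alphaSkew_zero (hα : IsSmoothMorphism (F := F) α) (x : M)
    (u v : TangentSpace 𝓘(𝕜, E) x) : alphaSkew nablaM D gM α x 0 u v = 0 := by
  rw [alphaSkew, alphaForm_zero hα, alphaForm_zero hα, sub_zero]

theorem alphaSym_swap (x : M) (a : V x) (u v : TangentSpace 𝓘(𝕜, E) x) :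
    alphaSym nablaM D gM α x a u v = alphaSym nablaM D gM α x a v u := by
  rw [alphaSym, alphaSym, add_comm]

theorem alphaSkew_zero_right (x : M) (a : V x) (u : TangentSpace 𝓘(𝕜, E) x) :
    alphaSkew nablaM D gM α x a u 0 = 0 := by
  rw [alphaSkew, alphaForm_zero_left, alphaForm_zero_right, sub_zero]

theorem alphaSym_zero_left (x : M) (a : V x) (u : TangentSpace 𝓘(𝕜, E) x) :
    alphaSym nablaM D gM α x a 0 u = 0 := by
  rw [alphaSym, alphaForm_zero_left, alphaForm_zero_right, add_zero]

theorem alphaSym_zero_right (x : M) (a : V x) (u : TangentSpace 𝓘(𝕜, E) x) :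
    alphaSym nablaM D gM α x a u 0 = 0 := by
  rw [alphaSym, alphaForm_zero_left, alphaForm_zero_right, add_zero]

variable {ι κ : Type*} [Fintype ι] [Fintype κ] {v : ι → Π x : M, V x}
  {Xf : κ → Π x : M, TangentSpace 𝓘(𝕜, E) x}

/-- The orthonormal expansion of the metric of the total space in the horizontal lifts of an
orthonormal frame of the base and the vectors `v_i - (α(v_i))~`. -/
theorem totalMetric_eq_sum (hsM : ∀ x (a b : TangentSpace 𝓘(𝕜, E) x), gM x a b = gM x b a)
    (hsV : ∀ x (a b : V x), gV x a b = gV x b a)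
    (hv : IsOrthonormalFrameOn (E := E) F (reducedMetric gM gV α) v U)
    (hX : IsOrthonormalFrameOn (E := E) E (fun x a b ↦ gM x a b) Xf U)
    {w : TotalSpace F V} (hw : w.proj ∈ U) (P Q : TotalTangent 𝕜 (E := E) w) :
    totalMetric D gM gV α w P Q =
      ∑ j, gM w.proj (Xf j w.proj) (Xf j w.proj) *
        (totalMetric D gM gV α w P (horLift D w (Xf j w.proj)) *
          totalMetric D gM gV α w Q (horLift D w (Xf j w.proj)))
      + ∑ i, reducedMetric gM gV α w.proj (v i w.proj) (v i w.proj) *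
        (totalMetric D gM gV α w P
            (horLift D w (-α w.proj (v i w.proj)) + vertLift D w (v i w.proj)) *
          totalMetric D gM gV α w Q
            (horLift D w (-α w.proj (v i w.proj)) + vertLift D w (v i w.proj))) := by
  let O : κ ⊕ ι → TotalTangent 𝕜 (E := E) w := Sum.elim (fun j ↦ horLift D w (Xf j w.proj))
    (fun i ↦ horLift D w (-α w.proj (v i w.proj)) + vertLift D w (v i w.proj))
  have hsym : ∀ a b, totalMetric D gM gV α w a b = totalMetric D gM gV α w b a := by
    intro a b
    rw [totalMetric_apply, totalMetric_apply, hsM, hsV,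
      hsM _ (α w.proj _) (projDeriv w b), hsM _ (projDeriv w a)]
    ring
  have e1 : ∀ j j', totalMetric D gM gV α w (O (.inl j)) (O (.inl j')) = gM w.proj (Xf j w.proj) (Xf j' w.proj) := by
    intro j j'
    simp only [O, Sum.elim_inl, totalMetric_apply, projDeriv_horLift, connectionMap_horLift, map_zero]
    simp
  have e2 : ∀ j i, totalMetric D gM gV α w (O (.inl j)) (O (.inr i)) = 0 := by
    intro j i
    simp only [O, Sum.elim_inl, Sum.elim_inr, totalMetric_apply, map_add, projDeriv_horLift,
      connectionMap_horLift, projDeriv_vertLift, connectionMap_vertLift, map_zero, add_zero, zero_add,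
      map_neg]
    simp
  have e3 : ∀ i i', totalMetric D gM gV α w (O (.inr i)) (O (.inr i')) =
      reducedMetric gM gV α w.proj (v i w.proj) (v i' w.proj) := by
    intro i i'
    simp only [O, Sum.elim_inl, Sum.elim_inr]
    rw [totalMetric_apply]
    simp only [map_add, projDeriv_horLift,
      connectionMap_horLift, projDeriv_vertLift, connectionMap_vertLift, map_zero, add_zero, zero_add,
      map_neg, neg_zero, reducedMetric, neg_apply]
    ring
  have hspan : Q ∈ Submodule.span 𝕜 (Set.range O) := by
    obtain ⟨a, ha⟩ := (Submodule.mem_span_range_iff_exists_fun 𝕜).1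
      (hv.frame.generating hw (Submodule.mem_top (x := connectionMap D w Q)))
    obtain ⟨b, hb⟩ := (Submodule.mem_span_range_iff_exists_fun 𝕜).1
      (hX.frame.generating hw
        (Submodule.mem_top (x := projDeriv w Q + α w.proj (connectionMap D w Q))))
    refine (Submodule.mem_span_range_iff_exists_fun 𝕜).2 ⟨Sum.elim b a, ?_⟩
    rw [Fintype.sum_sum_type]
    simp only [O, Sum.elim_inl, Sum.elim_inr]
    refine totalTangent_ext D ?_ ?_
    · rw [map_add, map_sum, map_sum]
      simp only [map_smul, map_add, projDeriv_horLift, projDeriv_vertLift, add_zero]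
      rw [hb]
      simp only [smul_neg, Finset.sum_neg_distrib, ← map_smul]
      rw [← map_sum, ha]
      abel
    · rw [map_add, map_sum, map_sum]
      simp only [map_smul, map_add, connectionMap_horLift, connectionMap_vertLift, zero_add, smul_zero,
        Finset.sum_const_zero]
      exact ha
  have key := bilin_eq_sum_of_orthonormal (fun a ↦ (totalMetric D gM gV α w a).toLinearMap) O
    (by
      rintro (j | i) (j' | i') hne
      · exact (e1 j j').trans (hX.orthogonal w.proj hw j j' fun h ↦ hne (congrArg _ h))
      · exact e2 j i'
      · exact (hsym _ _).trans (e2 j' i)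
      · exact (e3 i i').trans (hv.orthogonal w.proj hw i i' fun h ↦ hne (congrArg _ h)))
    (by
      rintro (j | i)
      · have := hX.normalized w.proj hw j
        rw [← e1] at this
        exact this
      · have := hv.normalized w.proj hw i
        rw [← e3] at this
        exact this) hsym P hspan
  rw [Fintype.sum_sum_type] at key
  refine key.trans ?_
  congr 1
  · refine Finset.sum_congr rfl fun j _ ↦ ?_
    exact congrArg (· * _) (e1 j j)
  · refine Finset.sum_congr rfl fun i _ ↦ ?_
    exact congrArg (· * _) (e3 i i)

end OrthonormalFormula

section OrthonormalCurvature

set_option maxSynthPendingDepth 3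

variable {𝕜 : Type*} [RCLike 𝕜]
  {E : Type*} [NormedAddCommGroup E] [NormedSpace 𝕜 E] [FiniteDimensional 𝕜 E]
  {M : Type*} [TopologicalSpace M] [ChartedSpace E M] [IsManifold 𝓘(𝕜, E) ∞ M]
  {F : Type*} [NormedAddCommGroup F] [NormedSpace 𝕜 F] [FiniteDimensional 𝕜 F]
  {V : M → Type*} [TopologicalSpace (TotalSpace F V)]
  [∀ x, AddCommGroup (V x)] [∀ x, Module 𝕜 (V x)] [∀ x, TopologicalSpace (V x)]
  [∀ x, IsTopologicalAddGroup (V x)] [∀ x, ContinuousSMul 𝕜 (V x)]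
  [FiberBundle F V] [VectorBundle 𝕜 F V] [ContMDiffVectorBundle ∞ F V 𝓘(𝕜, E)]

variable {nablaM : CovariantDerivative 𝓘(𝕜, E) E (TangentSpace 𝓘(𝕜, E) : M → Type _)}
  {D : CovariantDerivative 𝓘(𝕜, E) F V}
  {gM : ∀ x : M, TangentSpace 𝓘(𝕜, E) x →L[𝕜] TangentSpace 𝓘(𝕜, E) x →L[𝕜] 𝕜}
  {gV : ∀ x : M, V x →L[𝕜] V x →L[𝕜] 𝕜}
  {α : ∀ x : M, V x →L[𝕜] TangentSpace 𝓘(𝕜, E) x}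
  {W U : Set M}
  {ι κ : Type*} [Fintype ι] [Fintype κ] {v : ι → Π x : M, V x}
  {Xf : κ → Π x : M, TangentSpace 𝓘(𝕜, E) x}

/-- The left-hand side of the quadratic condition, as a function of vectors at a point. -/
def skewPairing (nablaM : CovariantDerivative 𝓘(𝕜, E) E (TangentSpace 𝓘(𝕜, E) : M → Type _))
    (D : CovariantDerivative 𝓘(𝕜, E) F V)
    (gM : ∀ x : M, TangentSpace 𝓘(𝕜, E) x →L[𝕜] TangentSpace 𝓘(𝕜, E) x →L[𝕜] 𝕜)
    (gV : ∀ x : M, V x →L[𝕜] V x →L[𝕜] 𝕜)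
    (α : ∀ x : M, V x →L[𝕜] TangentSpace 𝓘(𝕜, E) x)
    (v : ι → Π x : M, V x) (Xf : κ → Π x : M, TangentSpace 𝓘(𝕜, E) x) (x : M)
    (a b : V x) (p q : TangentSpace 𝓘(𝕜, E) x) : 𝕜 :=
  ∑ j, gM x (Xf j x) (Xf j x) *
      (alphaSkew nablaM D gM α x a p (Xf j x) * alphaSkew nablaM D gM α x b q (Xf j x))
    + ∑ i, reducedMetric gM gV α x (v i x) (v i x) *
      (alphaSkew nablaM D gM α x a p (α x (v i x)) * alphaSkew nablaM D gM α x b q (α x (v i x)))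

/-- `∑ ε_i σ(v_i; p, q) σ(v_i; r, t)`. -/
def symPairing (nablaM : CovariantDerivative 𝓘(𝕜, E) E (TangentSpace 𝓘(𝕜, E) : M → Type _))
    (D : CovariantDerivative 𝓘(𝕜, E) F V)
    (gM : ∀ x : M, TangentSpace 𝓘(𝕜, E) x →L[𝕜] TangentSpace 𝓘(𝕜, E) x →L[𝕜] 𝕜)
    (gV : ∀ x : M, V x →L[𝕜] V x →L[𝕜] 𝕜)
    (α : ∀ x : M, V x →L[𝕜] TangentSpace 𝓘(𝕜, E) x)
    (v : ι → Π x : M, V x) (x : M) (p q r t : TangentSpace 𝓘(𝕜, E) x) : 𝕜 :=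
  ∑ i, reducedMetric gM gV α x (v i x) (v i x) *
    (alphaSym nablaM D gM α x (v i x) p q * alphaSym nablaM D gM α x (v i x) r t)

/-- `S₂` as a function of vectors at a point. -/
def mixedPairing (nablaM : CovariantDerivative 𝓘(𝕜, E) E (TangentSpace 𝓘(𝕜, E) : M → Type _))
    (D : CovariantDerivative 𝓘(𝕜, E) F V)
    (gM : ∀ x : M, TangentSpace 𝓘(𝕜, E) x →L[𝕜] TangentSpace 𝓘(𝕜, E) x →L[𝕜] 𝕜)
    (gV : ∀ x : M, V x →L[𝕜] V x →L[𝕜] 𝕜)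
    (α : ∀ x : M, V x →L[𝕜] TangentSpace 𝓘(𝕜, E) x)
    (v : ι → Π x : M, V x) (x : M) (p q r : TangentSpace 𝓘(𝕜, E) x) (a : V x) : 𝕜 :=
  ∑ i, reducedMetric gM gV α x (v i x) (v i x) *
    (alphaSkew nablaM D gM α x a (α x (v i x)) q * alphaSym nablaM D gM α x (v i x) p r)

/-- The difference of the two sides of the condition on `S₂`. -/
def mixedDefect (nablaM : CovariantDerivative 𝓘(𝕜, E) E (TangentSpace 𝓘(𝕜, E) : M → Type _))
    (D : CovariantDerivative 𝓘(𝕜, E) F V)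
    (gM : ∀ x : M, TangentSpace 𝓘(𝕜, E) x →L[𝕜] TangentSpace 𝓘(𝕜, E) x →L[𝕜] 𝕜)
    (gV : ∀ x : M, V x →L[𝕜] V x →L[𝕜] 𝕜)
    (α : ∀ x : M, V x →L[𝕜] TangentSpace 𝓘(𝕜, E) x)
    (v : ι → Π x : M, V x) (X Y Z : Π x : M, TangentSpace 𝓘(𝕜, E) x) (s : Π x : M, V x)
    (x : M) : 𝕜 :=
  mixedPairing nablaM D gM gV α v x (X x) (Y x) (Z x) (s x)
    - mixedPairing nablaM D gM gV α v x (Y x) (X x) (Z x) (s x)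
    - 2 * (alphaHess nablaM gM α s Y Z X x - alphaHess nablaM gM α s X Z Y x)

theorem mixedPairing_symm (x : M) (p q r : TangentSpace 𝓘(𝕜, E) x) (a : V x) :
    mixedPairing nablaM D gM gV α v x p q r a = mixedPairing nablaM D gM gV α v x r q p a := by
  simp only [mixedPairing, alphaSym_swap x _ p r]

namespace FlatMetricPair

variable (h : FlatMetricPair nablaM D gM gV α) (hW : IsOpen W)
  (hval : ∀ x ∈ W, ∀ (p : TangentSpace 𝓘(𝕜, E) x) (a : V x),
    ∃ L : ParallelLift nablaM D W, L.base x = p ∧ L.fiber x = a)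
  {w : TotalSpace F V} (hw : w.proj ∈ W)
  {nabla : CovariantDerivative (𝓘(𝕜, E).prod 𝓘(𝕜, F)) (E × F) (TangentSpace (𝓘(𝕜, E).prod 𝓘(𝕜, F)) : TotalSpace F V → Type _)}
  (hLC : IsLeviCivita (𝓘(𝕜, E).prod 𝓘(𝕜, F)) (totalMetric D gM gV α) nabla)
include h hW hval hw hLC

theorem two_mul_totalMetric_nabla_lift (P Q : ParallelLift nablaM D W)
    (p : TangentSpace 𝓘(𝕜, E) w.proj) (a : V w.proj) :
    2 * totalMetric D gM gV α w (nabla Q.field w (P.field w)) (horLift D w p + vertLift D w a) =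
      alphaSkew nablaM D gM α w.proj (Q.fiber w.proj) (P.base w.proj) p
        + alphaSkew nablaM D gM α w.proj (P.fiber w.proj) (Q.base w.proj) p
        + alphaSym nablaM D gM α w.proj a (P.base w.proj) (Q.base w.proj) := by
  obtain ⟨L, rfl, rfl⟩ := hval w.proj hw p a
  have hα := h.smooth_morphism
  have hd : ∀ (L : ParallelLift nablaM D W) (Y X : Π x : M, TangentSpace 𝓘(𝕜, E) x),
      alphaDeriv nablaM gM α L.fiber Y X w.proj =
        alphaForm nablaM D gM α w.proj (L.fiber w.proj) (Y w.proj) (X w.proj) := fun L Y X ↦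
    alphaDeriv_eq hα (L.smooth_fiber.mdiffAt hW hw) (L.parallel_fiber _ hw) Y X
  have := h.two_mul_totalMetric_nabla hW P Q L hw hLC
  simp only [hd] at this
  exact this

theorem four_mul_totalMetric_nabla_nabla
    (hv : IsOrthonormalFrameOn (E := E) F (reducedMetric gM gV α) v U)
    (hX : IsOrthonormalFrameOn (E := E) E (fun x a b ↦ gM x a b) Xf U) (hwU : w.proj ∈ U)
    (A B C B' : ParallelLift nablaM D W) :
    4 * totalMetric D gM gV α w (nabla C.field w (B.field w)) (nabla B'.field w (A.field w)) =
      symPairing nablaM D gM gV α v w.proj (B.base w.proj) (C.base w.proj) (A.base w.proj)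
          (B'.base w.proj)
      + mixedPairing nablaM D gM gV α v w.proj (B.base w.proj) (A.base w.proj) (C.base w.proj)
          (B'.fiber w.proj)
      + mixedPairing nablaM D gM gV α v w.proj (B.base w.proj) (B'.base w.proj) (C.base w.proj)
          (A.fiber w.proj)
      + mixedPairing nablaM D gM gV α v w.proj (A.base w.proj) (B.base w.proj) (B'.base w.proj)
          (C.fiber w.proj)
      + mixedPairing nablaM D gM gV α v w.proj (A.base w.proj) (C.base w.proj) (B'.base w.proj)
          (B.fiber w.proj)
      + skewPairing nablaM D gM gV α v Xf w.proj (C.fiber w.proj) (B'.fiber w.proj) (B.base w.proj)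
          (A.base w.proj)
      + skewPairing nablaM D gM gV α v Xf w.proj (C.fiber w.proj) (A.fiber w.proj) (B.base w.proj)
          (B'.base w.proj)
      + skewPairing nablaM D gM gV α v Xf w.proj (B.fiber w.proj) (B'.fiber w.proj) (C.base w.proj)
          (A.base w.proj)
      + skewPairing nablaM D gM gV α v Xf w.proj (B.fiber w.proj) (A.fiber w.proj) (C.base w.proj)
          (B'.base w.proj) := by
  have hα := h.smooth_morphism
  have hhor : ∀ (P Q : ParallelLift nablaM D W) (p : TangentSpace 𝓘(𝕜, E) w.proj),
      2 * totalMetric D gM gV α w (nabla Q.field w (P.field w)) (horLift D w p) =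
        alphaSkew nablaM D gM α w.proj (Q.fiber w.proj) (P.base w.proj) p
          + alphaSkew nablaM D gM α w.proj (P.fiber w.proj) (Q.base w.proj) p := by
    intro P Q p
    have := h.two_mul_totalMetric_nabla_lift hW hval hw hLC P Q p 0
    rwa [map_zero, add_zero, alphaSym, alphaForm_zero hα, alphaForm_zero hα, add_zero,
      add_zero] at this
  have hver : ∀ (P Q : ParallelLift nablaM D W) (a : V w.proj),
      2 * totalMetric D gM gV α w (nabla Q.field w (P.field w))
        (horLift D w (-α w.proj a) + vertLift D w a) =
        alphaSym nablaM D gM α w.proj a (P.base w.proj) (Q.base w.proj)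
          - alphaSkew nablaM D gM α w.proj (Q.fiber w.proj) (P.base w.proj) (α w.proj a)
          - alphaSkew nablaM D gM α w.proj (P.fiber w.proj) (Q.base w.proj) (α w.proj a) := by
    intro P Q a
    rw [h.two_mul_totalMetric_nabla_lift hW hval hw hLC P Q, alphaSkew_neg_right,
      alphaSkew_neg_right]
    ring
  rw [totalMetric_eq_sum h.symm_base h.symm hv hX hwU, mul_add, Finset.mul_sum, Finset.mul_sum]
  have hj : ∀ j, 4 * (gM w.proj (Xf j w.proj) (Xf j w.proj) *
      (totalMetric D gM gV α w (nabla C.field w (B.field w)) (horLift D w (Xf j w.proj)) *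
        totalMetric D gM gV α w (nabla B'.field w (A.field w)) (horLift D w (Xf j w.proj)))) =
      gM w.proj (Xf j w.proj) (Xf j w.proj) *
      ((2 * totalMetric D gM gV α w (nabla C.field w (B.field w)) (horLift D w (Xf j w.proj))) *
        (2 * totalMetric D gM gV α w (nabla B'.field w (A.field w))
          (horLift D w (Xf j w.proj)))) := fun j ↦ by ring
  have hi : ∀ i, 4 * (reducedMetric gM gV α w.proj (v i w.proj) (v i w.proj) *
      (totalMetric D gM gV α w (nabla C.field w (B.field w))
            (horLift D w (-α w.proj (v i w.proj)) + vertLift D w (v i w.proj)) *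
        totalMetric D gM gV α w (nabla B'.field w (A.field w))
            (horLift D w (-α w.proj (v i w.proj)) + vertLift D w (v i w.proj)))) =
      reducedMetric gM gV α w.proj (v i w.proj) (v i w.proj) *
      ((2 * totalMetric D gM gV α w (nabla C.field w (B.field w))
            (horLift D w (-α w.proj (v i w.proj)) + vertLift D w (v i w.proj))) *
        (2 * totalMetric D gM gV α w (nabla B'.field w (A.field w))
          (horLift D w (-α w.proj (v i w.proj)) + vertLift D w (v i w.proj)))) := fun i ↦ by ring
  simp only [hj, hi]
  simp only [hhor, hver]
  simp only [symPairing, mixedPairing, skewPairing, alphaSkew_swap _ _ (α w.proj _)]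
  have hsum : ∀ S₁ S₂ S₃ S₄ S₅ J₁ J₂ J₃ J₄ I₁ I₂ I₃ I₄ : 𝕜, S₁ + S₂ + S₃ + S₄ + S₅ + (J₁ + I₁)
      + (J₂ + I₂) + (J₃ + I₃) + (J₄ + I₄) = (J₁ + J₂ + J₃ + J₄) + (S₁ + S₂ + S₃ + S₄ + S₅ + I₁ + I₂
      + I₃ + I₄) := fun _ _ _ _ _ _ _ _ _ _ _ _ _ ↦ by ring
  rw [hsum]
  simp only [← Finset.sum_add_distrib]
  congr 1
  · refine Finset.sum_congr rfl fun j _ ↦ ?_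
    ring
  · refine Finset.sum_congr rfl fun i _ ↦ ?_
    ring

theorem four_mul_curvature
    (hv : IsOrthonormalFrameOn (E := E) F (reducedMetric gM gV α) v U)
    (hX : IsOrthonormalFrameOn (E := E) E (fun x a b ↦ gM x a b) Xf U) (hwU : w.proj ∈ U)
    (A B C B' : ParallelLift nablaM D W) :
    4 * totalMetric D gM gV α w (curvature (𝓘(𝕜, E).prod 𝓘(𝕜, F)) (E × F) nabla A.field B.field C.field w) (B'.field w) =
      symPairing nablaM D gM gV α v w.proj (A.base w.proj) (C.base w.proj) (B.base w.proj)
          (B'.base w.proj)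
      - symPairing nablaM D gM gV α v w.proj (B.base w.proj) (C.base w.proj) (A.base w.proj)
          (B'.base w.proj)
      + mixedDefect nablaM D gM gV α v A.base B.base C.base B'.fiber w.proj
      + mixedDefect nablaM D gM gV α v B.base A.base B'.base C.fiber w.proj
      + mixedDefect nablaM D gM gV α v C.base B'.base A.base B.fiber w.proj
      + mixedDefect nablaM D gM gV α v B'.base C.base B.base A.fiber w.proj
      - skewPairing nablaM D gM gV α v Xf w.proj (C.fiber w.proj) (B'.fiber w.proj) (B.base w.proj)
          (A.base w.proj)
      - skewPairing nablaM D gM gV α v Xf w.proj (C.fiber w.proj) (A.fiber w.proj) (B.base w.proj)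
          (B'.base w.proj)
      - skewPairing nablaM D gM gV α v Xf w.proj (B.fiber w.proj) (B'.fiber w.proj) (C.base w.proj)
          (A.base w.proj)
      - skewPairing nablaM D gM gV α v Xf w.proj (B.fiber w.proj) (A.fiber w.proj) (C.base w.proj)
          (B'.base w.proj)
      + skewPairing nablaM D gM gV α v Xf w.proj (C.fiber w.proj) (B'.fiber w.proj) (A.base w.proj)
          (B.base w.proj)
      + skewPairing nablaM D gM gV α v Xf w.proj (C.fiber w.proj) (B.fiber w.proj) (A.base w.proj)
          (B'.base w.proj)
      + skewPairing nablaM D gM gV α v Xf w.proj (A.fiber w.proj) (B'.fiber w.proj) (C.base w.proj)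
          (B.base w.proj)
      + skewPairing nablaM D gM gV α v Xf w.proj (A.fiber w.proj) (B.fiber w.proj) (C.base w.proj)
          (B'.base w.proj) := by
  have h1 := h.four_mul_curvature_eq_hess hW A B C B' hw hLC
  have h2 := h.four_mul_totalMetric_nabla_nabla hW hval hw hLC hv hX hwU A B C B'
  have h3 := h.four_mul_totalMetric_nabla_nabla hW hval hw hLC hv hX hwU B A C B'
  have hsym : ∀ S P Q R : ParallelLift nablaM D W,
      alphaHess nablaM gM α S.fiber P.base Q.base R.base w.proj =
        alphaHess nablaM gM α S.fiber Q.base P.base R.base w.proj := fun S P Q R ↦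
    h.mvfderiv_alphaDeriv_symm hW S.smooth_fiber R.smooth_base R.parallel_base Q.smooth_base
      Q.parallel_base P.smooth_base P.parallel_base hw
  simp only [mixedDefect]
  rw [mixedPairing_symm w.proj (C.base w.proj), mixedPairing_symm w.proj (C.base w.proj),
    mixedPairing_symm w.proj (B'.base w.proj), mixedPairing_symm w.proj (B'.base w.proj),
    hsym B B' A C, hsym B C A B', hsym A C B B', hsym A B' B C]
  linear_combination 2 * h1 - h2 + h3

end FlatMetricPair

end OrthonormalCurvature

section FlatnessCriterion

set_option maxSynthPendingDepth 3

variable {𝕜 : Type*} [RCLike 𝕜]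
  {E : Type*} [NormedAddCommGroup E] [NormedSpace 𝕜 E] [FiniteDimensional 𝕜 E]
  {M : Type*} [TopologicalSpace M] [ChartedSpace E M] [IsManifold 𝓘(𝕜, E) ∞ M]
  {F : Type*} [NormedAddCommGroup F] [NormedSpace 𝕜 F] [FiniteDimensional 𝕜 F]
  {V : M → Type*} [TopologicalSpace (TotalSpace F V)]
  [∀ x, AddCommGroup (V x)] [∀ x, Module 𝕜 (V x)] [∀ x, TopologicalSpace (V x)]
  [∀ x, IsTopologicalAddGroup (V x)] [∀ x, ContinuousSMul 𝕜 (V x)]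
  [FiberBundle F V] [VectorBundle 𝕜 F V] [ContMDiffVectorBundle ∞ F V 𝓘(𝕜, E)]

variable {nablaM : CovariantDerivative 𝓘(𝕜, E) E (TangentSpace 𝓘(𝕜, E) : M → Type _)}
  {D : CovariantDerivative 𝓘(𝕜, E) F V}
  {gM : ∀ x : M, TangentSpace 𝓘(𝕜, E) x →L[𝕜] TangentSpace 𝓘(𝕜, E) x →L[𝕜] 𝕜}
  {gV : ∀ x : M, V x →L[𝕜] V x →L[𝕜] 𝕜}
  {α : ∀ x : M, V x →L[𝕜] TangentSpace 𝓘(𝕜, E) x}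
  {W U : Set M}
  {ι κ : Type*} [Fintype ι] [Fintype κ] {v : ι → Π x : M, V x}
  {Xf : κ → Π x : M, TangentSpace 𝓘(𝕜, E) x}

theorem isParallelOn_zero (nabla : CovariantDerivative 𝓘(𝕜, E) F V) (W : Set M) :
    IsParallelOn 𝓘(𝕜, E) F nabla (fun _ ↦ 0) W := fun x _ ↦
  ContinuousLinearMap.ext fun u ↦ nabla_zero_apply nabla x u

theorem exists_parallel_of_frame (hW : IsOpen W) {S : ι → Π x : M, V x}
    (hS : IsLocalFrameOn 𝓘(𝕜, E) F ∞ S W) (hp : ∀ k, IsParallelOn 𝓘(𝕜, E) F D (S k) W) {x : M}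
    (hx : x ∈ W) (a : V x) :
    ∃ s : Π x : M, V x, s x = a ∧ SmoothSectionOn 𝓘(𝕜, E) F s W ∧
      IsParallelOn 𝓘(𝕜, E) F D s W := by
  obtain ⟨c, hc⟩ := (Submodule.mem_span_range_iff_exists_fun 𝕜).1
    (hS.generating hx (Submodule.mem_top (x := a)))
  refine ⟨fun y ↦ ∑ k, c k • S k y, hc, ?_, fun y hy ↦ ContinuousLinearMap.ext fun u ↦ ?_⟩
  · exact ContMDiffOn.sum_section fun k _ ↦
      (contMDiffOn_const (c := c k)).smul_section (hS.contMDiffOn k)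
  · have := nabla_sum_smul_apply D Finset.univ (c := fun k _ ↦ c k) (s := S) (x := y)
      (fun k ↦ mdifferentiableAt_const)
      (fun k ↦ SmoothSectionOn.mdiffAt (hS.contMDiffOn k) hW hy) u
    refine this.trans (Finset.sum_eq_zero fun k _ ↦ ?_)
    rw [hp k y hy, mvfderiv_const_apply]
    simp

/-- A parallel vector field on the base, with the zero section. -/
def ParallelLift.horizontal (D : CovariantDerivative 𝓘(𝕜, E) F V)
    {X : Π x : M, TangentSpace 𝓘(𝕜, E) x} (hX : SmoothSectionOn 𝓘(𝕜, E) E X W)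
    (hp : IsParallelOn 𝓘(𝕜, E) E nablaM X W) : ParallelLift nablaM D W where
  base := X
  fiber := fun _ ↦ 0
  smooth_base := hX
  parallel_base := hp
  smooth_fiber := smoothSectionOn_zero
  parallel_fiber := isParallelOn_zero D W

/-- A parallel section, with the zero vector field on the base. -/
def ParallelLift.vertical (nablaM : CovariantDerivative 𝓘(𝕜, E) E (TangentSpace 𝓘(𝕜, E) : M → Type _))
    {s : Π x : M, V x} (hs : SmoothSectionOn 𝓘(𝕜, E) F s W)
    (hp : IsParallelOn 𝓘(𝕜, E) F D s W) : ParallelLift nablaM D W where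
  base := fun _ ↦ 0
  fiber := s
  smooth_base := smoothSectionOn_zero
  parallel_base := isParallelOn_zero nablaM W
  smooth_fiber := hs
  parallel_fiber := hp

theorem S₁_eq_symPairing (hα : IsSmoothMorphism (F := F) α) {x : M}
    (hv : ∀ i, MDiffAt (T% (v i)) x) (X Y Z T : Π x : M, TangentSpace 𝓘(𝕜, E) x) :
    S₁ nablaM D gM gV α v X Y Z T x =
      symPairing nablaM D gM gV α v x (Y x) (Z x) (X x) (T x) :=
  Finset.sum_congr rfl fun i _ ↦ by rw [symNablaAlpha_eq hα (hv i), symNablaAlpha_eq hα (hv i)]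

theorem S₂_eq_mixedPairing (hα : IsSmoothMorphism (F := F) α)
    (hLC : IsLeviCivita 𝓘(𝕜, E) gM nablaM) {x : M}
    (hv : ∀ i, MDiffAt (T% (v i)) x) (X : Π x : M, TangentSpace 𝓘(𝕜, E) x)
    {Y : Π x : M, TangentSpace 𝓘(𝕜, E) x} (Z : Π x : M, TangentSpace 𝓘(𝕜, E) x)
    (hY : MDiffAt (T% Y) x) {s : Π x : M, V x} (hs : MDiffAt (T% s) x) (hp : D s x = 0) :
    S₂ nablaM D gM gV α v X Y Z s x =
      mixedPairing nablaM D gM gV α v x (X x) (Y x) (Z x) (s x) :=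
  Finset.sum_congr rfl fun i _ ↦ by
    rw [symNablaAlpha_eq hα (hv i), dOneForm_alphaFlat_eq hα hLC hs hp (hα.mdiffAt (hv i)) hY]

theorem sum_dOneForm_eq_skewPairing (hα : IsSmoothMorphism (F := F) α)
    (hLC : IsLeviCivita 𝓘(𝕜, E) gM nablaM) {x : M}
    (hv : ∀ i, MDiffAt (T% (v i)) x) (hXf : ∀ j, MDiffAt (T% (Xf j)) x)
    {X Y : Π x : M, TangentSpace 𝓘(𝕜, E) x} (hX : MDiffAt (T% X) x) (hY : MDiffAt (T% Y) x)
    {s t : Π x : M, V x} (hs : MDiffAt (T% s) x) (hsp : D s x = 0) (ht : MDiffAt (T% t) x)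
    (htp : D t x = 0) :
    ∑ j, gM x (Xf j x) (Xf j x) *
        (dOneForm 𝓘(𝕜, E) (alphaFlat gM α s) Y (Xf j) x *
          dOneForm 𝓘(𝕜, E) (alphaFlat gM α t) X (Xf j) x)
      + ∑ i, reducedMetric gM gV α x (v i x) (v i x) *
        (dOneForm 𝓘(𝕜, E) (alphaFlat gM α s) Y (fun y ↦ α y (v i y)) x *
          dOneForm 𝓘(𝕜, E) (alphaFlat gM α t) X (fun y ↦ α y (v i y)) x) =
      skewPairing nablaM D gM gV α v Xf x (s x) (t x) (Y x) (X x) := by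
  rw [skewPairing]
  congr 1
  · refine Finset.sum_congr rfl fun j _ ↦ ?_
    rw [dOneForm_alphaFlat_eq hα hLC hs hsp hY (hXf j),
      dOneForm_alphaFlat_eq hα hLC ht htp hX (hXf j)]
  · refine Finset.sum_congr rfl fun i _ ↦ ?_
    rw [dOneForm_alphaFlat_eq hα hLC hs hsp hY (hα.mdiffAt (hv i)),
      dOneForm_alphaFlat_eq hα hLC ht htp hX (hα.mdiffAt (hv i))]

theorem alphaHess_zero (x : M) (U Y X : Π x : M, TangentSpace 𝓘(𝕜, E) x) :
    alphaHess nablaM gM α (fun _ ↦ 0) U Y X x = 0 := by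
  have : alphaDeriv nablaM gM α (fun _ ↦ 0) Y X = fun _ ↦ 0 := by
    funext y
    rw [alphaDeriv]
    simp [nabla_zero_apply]
  rw [alphaHess, this, mvfderiv_const_apply]

theorem alphaHess_zero_left (s : Π x : M, V x) (x : M) (Y X : Π x : M, TangentSpace 𝓘(𝕜, E) x) :
    alphaHess nablaM gM α s (fun _ ↦ 0) Y X x = 0 := by
  rw [alphaHess, map_zero]

theorem alphaHess_zero_right (s : Π x : M, V x) (x : M) (U Y : Π x : M, TangentSpace 𝓘(𝕜, E) x) :
    alphaHess nablaM gM α s U Y (fun _ ↦ 0) x = 0 := by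
  have : alphaDeriv nablaM gM α s Y (fun _ ↦ 0) = fun _ ↦ 0 := by
    funext y
    rw [alphaDeriv, map_zero]
  rw [alphaHess, this, mvfderiv_const_apply]

theorem mixedDefect_zero (hα : IsSmoothMorphism (F := F) α) (x : M)
    (X Y Z : Π x : M, TangentSpace 𝓘(𝕜, E) x) :
    mixedDefect nablaM D gM gV α v X Y Z (fun _ ↦ 0) x = 0 := by
  simp [mixedDefect, mixedPairing, alphaSkew_zero hα, alphaHess_zero]

theorem mixedDefect_zero_middle (x : M) (X Z : Π x : M, TangentSpace 𝓘(𝕜, E) x) (s : Π x : M, V x) :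
    mixedDefect nablaM D gM gV α v X (fun _ ↦ 0) Z s x = 0 := by
  simp [mixedDefect, mixedPairing, alphaSkew_zero_right, alphaSym_zero_left, alphaHess_zero_left,
    alphaHess_zero_right]

namespace FlatMetricPair

theorem exists_parallelLift (h : FlatMetricPair nablaM D gM gV α) (hU : IsOpen U) {x : M}
    (hx : x ∈ U) :
    ∃ W, IsOpen W ∧ x ∈ W ∧ W ⊆ U ∧
      (∃ (A : Fin (Module.finrank 𝕜 E) → Π x : M, TangentSpace 𝓘(𝕜, E) x)
        (S : Fin (Module.finrank 𝕜 F) → Π x : M, V x), IsLocalFrameOn 𝓘(𝕜, E) E ∞ A W ∧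
        IsLocalFrameOn 𝓘(𝕜, E) F ∞ S W ∧ (∀ k, IsParallelOn 𝓘(𝕜, E) E nablaM (A k) W) ∧
        ∀ k, IsParallelOn 𝓘(𝕜, E) F D (S k) W) ∧
      ∀ y ∈ W, ∀ (p : TangentSpace 𝓘(𝕜, E) y) (a : V y),
        ∃ L : ParallelLift nablaM D W, L.base y = p ∧ L.fiber y = a := by
  obtain ⟨W₁, hW₁, hx₁, -, A, hA, hAp⟩ :=
    exists_parallel_frame h.preservesSmooth_base isOpen_univ h.flat_base (mem_univ x)
  obtain ⟨W₂, hW₂, hx₂, -, S, hS, hSp⟩ :=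
    exists_parallel_frame h.preservesSmooth isOpen_univ h.flat (mem_univ x)
  have hW := (hU.inter hW₁).inter hW₂
  have h1 : U ∩ W₁ ∩ W₂ ⊆ W₁ := fun y hy ↦ hy.1.2
  have h2 : U ∩ W₁ ∩ W₂ ⊆ W₂ := fun y hy ↦ hy.2
  have hA' := hA.mono h1
  have hS' := hS.mono h2
  have hAp' : ∀ k, IsParallelOn 𝓘(𝕜, E) E nablaM (A k) (U ∩ W₁ ∩ W₂) :=
    fun k y hy ↦ hAp k y (h1 hy)
  have hSp' : ∀ k, IsParallelOn 𝓘(𝕜, E) F D (S k) (U ∩ W₁ ∩ W₂) := fun k y hy ↦ hSp k y (h2 hy)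
  refine ⟨U ∩ W₁ ∩ W₂, hW, ⟨⟨hx, hx₁⟩, hx₂⟩, fun y hy ↦ hy.1.1, ⟨A, S, hA', hS', hAp', hSp'⟩,
    fun y hy p a ↦ ?_⟩
  obtain ⟨X, hX, hXs, hXp⟩ := exists_parallel_of_frame hW hA' hAp' hy p
  obtain ⟨s, hs, hss, hsp⟩ := exists_parallel_of_frame hW hS' hSp' hy a
  exact ⟨⟨X, s, hXs, hXp, hss, hsp⟩, hX, hs⟩

theorem preservesSmooth_total (h : FlatMetricPair nablaM D gM gV α)
    {nabla : CovariantDerivative (𝓘(𝕜, E).prod 𝓘(𝕜, F)) (E × F)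
      (TangentSpace (𝓘(𝕜, E).prod 𝓘(𝕜, F)) : TotalSpace F V → Type _)}
    (hLC : IsLeviCivita (𝓘(𝕜, E).prod 𝓘(𝕜, F)) (totalMetric D gM gV α) nabla) :
    PreservesSmooth nabla := fun _ _ _ hO hX hY _ hx ↦
  (hLC.contMDiffAt h.symm_total h.nondegenerate h.smoothPairing_total hO hX hY hx).contMDiffWithinAt

theorem mixedDefect_eq (h : FlatMetricPair nablaM D gM gV α) (hW : IsOpen W)
    {X Y Z : Π x : M, TangentSpace 𝓘(𝕜, E) x} {s : Π x : M, V x}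
    (hX : SmoothSectionOn 𝓘(𝕜, E) E X W) (hXp : IsParallelOn 𝓘(𝕜, E) E nablaM X W)
    (hY : SmoothSectionOn 𝓘(𝕜, E) E Y W) (hYp : IsParallelOn 𝓘(𝕜, E) E nablaM Y W)
    (hZ : SmoothSectionOn 𝓘(𝕜, E) E Z W)
    (hs : SmoothSectionOn 𝓘(𝕜, E) F s W) (hsp : IsParallelOn 𝓘(𝕜, E) F D s W) {x : M} (hx : x ∈ W)
    (hv : ∀ i, MDiffAt (T% (v i)) x) :
    mixedDefect nablaM D gM gV α v X Y Z s x =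
      S₂ nablaM D gM gV α v X Y Z s x - S₂ nablaM D gM gV α v Y X Z s x -
      2 * (gM x (nablaM (fun y ↦ nablaM (fun z ↦ α z (s z)) y (Z y)) x (Y x)) (X x)
        - gM x (nablaM (fun y ↦ nablaM (fun z ↦ α z (s z)) y (Z y)) x (X x)) (Y x)) := by
  have hα := h.smooth_morphism
  rw [mixedDefect, alphaHess, alphaHess, h.mvfderiv_alphaDeriv hW hs hX hXp hZ hx,
    h.mvfderiv_alphaDeriv hW hs hY hYp hZ hx,
    S₂_eq_mixedPairing hα h.leviCivita hv X Z (hY.mdiffAt hW hx) (hs.mdiffAt hW hx) (hsp x hx),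
    S₂_eq_mixedPairing hα h.leviCivita hv Y Z (hX.mdiffAt hW hx) (hs.mdiffAt hW hx) (hsp x hx)]

theorem isFlatConnectionOn_of_conditions (h : FlatMetricPair nablaM D gM gV α) (hU : IsOpen U)
    (hv : IsOrthonormalFrameOn (E := E) F (reducedMetric gM gV α) v U)
    (hX : IsOrthonormalFrameOn (E := E) E (fun x a b ↦ gM x a b) Xf U)
    (hc : FlatnessConditionsOn nablaM D gM gV α v Xf U)
    {nabla : CovariantDerivative (𝓘(𝕜, E).prod 𝓘(𝕜, F)) (E × F)
      (TangentSpace (𝓘(𝕜, E).prod 𝓘(𝕜, F)) : TotalSpace F V → Type _)}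
    (hLC : IsLeviCivita (𝓘(𝕜, E).prod 𝓘(𝕜, F)) (totalMetric D gM gV α) nabla) :
    IsFlatConnectionOn (𝓘(𝕜, E).prod 𝓘(𝕜, F)) (E × F) nabla
      (TotalSpace.proj ⁻¹' U : Set (TotalSpace F V)) := by
  intro O hO hOU X Y s hXs hYs hss w hw
  obtain ⟨W, hW, hwW, hWU, ⟨A, S, hA, hS, hAp, hSp⟩, hval⟩ :=
    h.exists_parallelLift hU (x := w.proj) (hOU hw)
  have hL := isLocalFrameOn_liftFrame h.preservesSmooth hW hA hS
  have hlift : ∀ m, ∃ P : ParallelLift nablaM D W, liftFrame D A S m = P.field := by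
    rintro (k | k)
    · exact ⟨.horizontal D (hA.contMDiffOn k) (hAp k), rfl⟩
    · exact ⟨.vertical nablaM (hS.contMDiffOn k) (hSp k), rfl⟩
  refine curvature_eq_zero_of_frame (h.preservesSmooth_total hLC) (isOpen_proj_preimage hW) hL hL ?_
    hO hXs hYs hss hw hwW
  intro a b i w' hw'
  obtain ⟨PA, ha⟩ := hlift a
  obtain ⟨PB, hb⟩ := hlift b
  obtain ⟨PC, hc'⟩ := hlift i
  rw [ha, hb, hc']
  refine h.nondegenerate w' _ fun T ↦ ?_
  obtain ⟨PD, h1, h2⟩ := hval w'.proj hw' (projDeriv w' T) (connectionMap D w' T)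
  have hT : PD.field w' = T := totalTangent_ext D
    ((projDeriv_liftField PD.base PD.fiber w').trans h1)
    ((connectionMap_liftField PD.base PD.fiber w').trans h2)
  have hwU := hWU hw'
  have hvm : ∀ i, MDiffAt (T% (v i)) w'.proj := fun i ↦
    SmoothSectionOn.mdiffAt (hv.frame.contMDiffOn i) hU hwU
  have hXm : ∀ i, MDiffAt (T% (Xf i)) w'.proj := fun i ↦
    SmoothSectionOn.mdiffAt (hX.frame.contMDiffOn i) hU hwU
  have hdef : ∀ P Q R T : ParallelLift nablaM D W,
      mixedDefect nablaM D gM gV α v P.base Q.base R.base T.fiber w'.proj = 0 := fun P Q R T ↦ by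
    rw [h.mixedDefect_eq hW P.smooth_base P.parallel_base Q.smooth_base Q.parallel_base R.smooth_base
      T.smooth_fiber T.parallel_fiber hw' hvm, sub_eq_zero]
    exact hc.skew_S₂ W hW hWU _ _ _ _ P.smooth_base P.parallel_base Q.smooth_base Q.parallel_base
      R.smooth_base R.parallel_base T.smooth_fiber T.parallel_fiber _ hw'
  have hskew : ∀ P Q R T : ParallelLift nablaM D W, skewPairing nablaM D gM gV α v Xf w'.proj
      (P.fiber w'.proj) (Q.fiber w'.proj) (R.base w'.proj) (T.base w'.proj) = 0 := fun P Q R T ↦ by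
    rw [← sum_dOneForm_eq_skewPairing h.smooth_morphism h.leviCivita hvm hXm
      (T.smooth_base.mdiffAt hW hw') (R.smooth_base.mdiffAt hW hw') (P.smooth_fiber.mdiffAt hW hw')
      (P.parallel_fiber _ hw') (Q.smooth_fiber.mdiffAt hW hw') (Q.parallel_fiber _ hw')]
    exact hc.quadratic W hW hWU _ _ _ _ T.smooth_base R.smooth_base P.smooth_fiber P.parallel_fiber
      Q.smooth_fiber Q.parallel_fiber _ hw'
  have hsym : symPairing nablaM D gM gV α v w'.proj (PA.base w'.proj) (PC.base w'.proj)
      (PB.base w'.proj) (PD.base w'.proj) = symPairing nablaM D gM gV α v w'.proj (PB.base w'.proj)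
      (PC.base w'.proj) (PA.base w'.proj) (PD.base w'.proj) := by
    rw [← S₁_eq_symPairing h.smooth_morphism hvm, ← S₁_eq_symPairing h.smooth_morphism hvm]
    exact hc.symm_S₁ W hW hWU _ _ _ _ PB.smooth_base PA.smooth_base PC.smooth_base PD.smooth_base _
      hw'
  have key := h.four_mul_curvature hW hval hw' hLC hv hX hwU PA PB PC PD
  simp only [hdef, hskew, hsym, hT, sub_self, add_zero, sub_zero] at key
  exact (mul_eq_zero.1 key).resolve_left (by norm_num)

theorem conditions_of_isFlatConnectionOn (h : FlatMetricPair nablaM D gM gV α) (hU : IsOpen U)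
    (hv : IsOrthonormalFrameOn (E := E) F (reducedMetric gM gV α) v U)
    (hX : IsOrthonormalFrameOn (E := E) E (fun x a b ↦ gM x a b) Xf U)
    {nabla : CovariantDerivative (𝓘(𝕜, E).prod 𝓘(𝕜, F)) (E × F)
      (TangentSpace (𝓘(𝕜, E).prod 𝓘(𝕜, F)) : TotalSpace F V → Type _)}
    (hLC : IsLeviCivita (𝓘(𝕜, E).prod 𝓘(𝕜, F)) (totalMetric D gM gV α) nabla)
    (hflat : IsFlatConnectionOn (𝓘(𝕜, E).prod 𝓘(𝕜, F)) (E × F) nabla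
      (TotalSpace.proj ⁻¹' U : Set (TotalSpace F V))) :
    FlatnessConditionsOn nablaM D gM gV α v Xf U := by
  have hα := h.smooth_morphism
  have hvm : ∀ x ∈ U, ∀ i, MDiffAt (T% (v i)) x := fun x hx i ↦
    SmoothSectionOn.mdiffAt (hv.frame.contMDiffOn i) hU hx
  have hXm : ∀ x ∈ U, ∀ i, MDiffAt (T% (Xf i)) x := fun x hx i ↦
    SmoothSectionOn.mdiffAt (hX.frame.contMDiffOn i) hU hx
  have hcurv : ∀ {W : Set M}, IsOpen W → W ⊆ U → ∀ (A B C B' : ParallelLift nablaM D W)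
      (w : TotalSpace F V), w.proj ∈ W → 4 * totalMetric D gM gV α w
        (curvature (𝓘(𝕜, E).prod 𝓘(𝕜, F)) (E × F) nabla A.field B.field C.field w)
        (B'.field w) = 0 := by
    intro W hW hWU A B C B' w hw
    have hsm : ∀ P : ParallelLift nablaM D W, SmoothSectionOn (𝓘(𝕜, E).prod 𝓘(𝕜, F)) (E × F) P.field
        (TotalSpace.proj ⁻¹' W : Set (TotalSpace F V)) := fun P ↦
      smoothSectionOn_liftField h.preservesSmooth hW P.smooth_base P.smooth_fiber
    rw [hflat _ (isOpen_proj_preimage hW) (preimage_mono hWU) _ _ _ (hsm A) (hsm B) (hsm C) w hw,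
      map_zero, zero_apply, mul_zero]
  refine ⟨fun W₀ hW₀ hWU X Y Z T hXs hYs hZs hTs x hx ↦ ?_,
    fun W₀ hW₀ hWU X Y Z s hXs hXp hYs hYp hZs hZp hss hsp x hx ↦ ?_,
    fun W₀ hW₀ hWU X Y s t hXs hYs hss hsp hts htp x hx ↦ ?_⟩
  · obtain ⟨W, hW, hxW, hWW, -, hval⟩ := h.exists_parallelLift hW₀ hx
    have hor : ∀ p : TangentSpace 𝓘(𝕜, E) x, ∃ L : ParallelLift nablaM D W, L.base x = p ∧
        L.fiber = fun _ ↦ 0 := fun p ↦ by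
      obtain ⟨L, hL, -⟩ := hval x hxW p 0
      exact ⟨.horizontal D L.smooth_base L.parallel_base, hL, rfl⟩
    obtain ⟨A, hA, hA0⟩ := hor (Y x)
    obtain ⟨B, hB, hB0⟩ := hor (X x)
    obtain ⟨C, hC, hC0⟩ := hor (Z x)
    obtain ⟨B', hB', hB'0⟩ := hor (T x)
    have key := h.four_mul_curvature (w := ⟨x, 0⟩) hW hval hxW hLC hv hX (hWU hx) A B C B'
    rw [hcurv hW (hWW.trans hWU) _ _ _ _ _ hxW] at key
    simp only [hA, hB, hC, hB', hA0, hB0, hC0, hB'0, mixedDefect_zero hα, skewPairing,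
      alphaSkew_zero hα, zero_mul, mul_zero, Finset.sum_const_zero, add_zero, sub_zero] at key
    rw [S₁_eq_symPairing hα (hvm x (hWU hx)), S₁_eq_symPairing hα (hvm x (hWU hx))]
    exact (sub_eq_zero.1 key.symm)
  · obtain ⟨W, hW, hxW, hWW, -, hval⟩ := h.exists_parallelLift hW₀ hx
    have hor : ∀ X : Π x : M, TangentSpace 𝓘(𝕜, E) x, SmoothSectionOn 𝓘(𝕜, E) E X W₀ →
        IsParallelOn 𝓘(𝕜, E) E nablaM X W₀ → ∃ L : ParallelLift nablaM D W, L.base = X ∧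
        L.fiber = fun _ ↦ 0 := fun X hXs hXp ↦
      ⟨.horizontal D (hXs.mono' hWW) (fun y hy ↦ hXp y (hWW hy)), rfl, rfl⟩
    obtain ⟨A, hA, hA0⟩ := hor X hXs hXp
    obtain ⟨B, hB, hB0⟩ := hor Y hYs hYp
    obtain ⟨C, hC, hC0⟩ := hor Z hZs hZp
    obtain ⟨B', hB', hB'0⟩ : ∃ L : ParallelLift nablaM D W, L.base = (fun _ ↦ 0) ∧ L.fiber = s :=
      ⟨.vertical nablaM (hss.mono' hWW) (fun y hy ↦ hsp y (hWW hy)), rfl, rfl⟩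
    have key := h.four_mul_curvature (w := ⟨x, 0⟩) hW hval hxW hLC hv hX (hWU hx) A B C B'
    rw [hcurv hW (hWW.trans hWU) _ _ _ _ _ hxW] at key
    simp only [hA, hB, hC, hB', hA0, hB0, hC0, hB'0, mixedDefect_zero hα, skewPairing, symPairing,
      alphaSkew_zero hα, alphaSym_zero_right, zero_mul, mul_zero, Finset.sum_const_zero, add_zero,
      sub_zero, zero_add] at key
    rw [h.mixedDefect_eq hW₀ hXs hXp hYs hYp hZs hss hsp hx (hvm x (hWU hx))] at key
    exact (sub_eq_zero.1 key.symm)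
  · obtain ⟨W, hW, hxW, hWW, -, hval⟩ := h.exists_parallelLift hW₀ hx
    have hor : ∀ p : TangentSpace 𝓘(𝕜, E) x, ∃ L : ParallelLift nablaM D W, L.base x = p ∧
        L.fiber = fun _ ↦ 0 := fun p ↦ by
      obtain ⟨L, hL, -⟩ := hval x hxW p 0
      exact ⟨.horizontal D L.smooth_base L.parallel_base, hL, rfl⟩
    have ver : ∀ s : Π x : M, V x, SmoothSectionOn 𝓘(𝕜, E) F s W₀ →
        IsParallelOn 𝓘(𝕜, E) F D s W₀ → ∃ L : ParallelLift nablaM D W, L.base = (fun _ ↦ 0) ∧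
        L.fiber = s := fun s hs hp ↦
      ⟨.vertical nablaM (hs.mono' hWW) (fun y hy ↦ hp y (hWW hy)), rfl, rfl⟩
    obtain ⟨A, hA, hA0⟩ := hor (X x)
    obtain ⟨B, hB0, hB⟩ := ver s hss hsp
    obtain ⟨C, hC, hC0⟩ := hor (Y x)
    obtain ⟨B', hB'0, hB'⟩ := ver t hts htp
    have key := h.four_mul_curvature (w := ⟨x, 0⟩) hW hval hxW hLC hv hX (hWU hx) A B C B'
    rw [hcurv hW (hWW.trans hWU) _ _ _ _ _ hxW] at key
    have hs0 : ∀ (b : V x) (p q : TangentSpace 𝓘(𝕜, E) x),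
        skewPairing nablaM D gM gV α v Xf x 0 b p q = 0 := fun b p q ↦ by
      simp [skewPairing, alphaSkew_zero hα]
    have hs1 : ∀ (a : V x) (p q : TangentSpace 𝓘(𝕜, E) x),
        skewPairing nablaM D gM gV α v Xf x a 0 p q = 0 := fun b p q ↦ by
      simp [skewPairing, alphaSkew_zero hα]
    simp only [hA, hB, hC, hB', hA0, hB0, hC0, hB'0, mixedDefect_zero hα, mixedDefect_zero_middle,
      symPairing, hs0, hs1, alphaSym_zero_right, zero_mul, mul_zero, Finset.sum_const_zero, add_zero,
      sub_zero, zero_add, zero_sub] at key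
    rw [sum_dOneForm_eq_skewPairing hα h.leviCivita (hvm x (hWU hx)) (hXm x (hWU hx))
      (hXs.mdiffAt hW₀ hx) (hYs.mdiffAt hW₀ hx) (hss.mdiffAt hW₀ hx) (hsp x hx) (hts.mdiffAt hW₀ hx)
      (htp x hx)]
    exact neg_eq_zero.1 key.symm

end FlatMetricPair

end FlatnessCriterion

section BilinearSmooth

set_option maxSynthPendingDepth 3

variable {𝕜 : Type*} [RCLike 𝕜]
  {E : Type*} [NormedAddCommGroup E] [NormedSpace 𝕜 E]
  {H : Type*} [TopologicalSpace H] {I : ModelWithCorners 𝕜 E H} [I.Boundaryless]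
  {N : Type*} [TopologicalSpace N] [ChartedSpace H N] [IsManifold I ∞ N]
  {F : Type*} [NormedAddCommGroup F] [NormedSpace 𝕜 F] [FiniteDimensional 𝕜 F]

theorem contMDiffAt_clm_of_apply {G : Type*} [NormedAddCommGroup G] [NormedSpace 𝕜 G]
    {L : N → F →L[𝕜] G} {x : N} (h : ∀ a, ContMDiffAt I 𝓘(𝕜, G) ∞ (fun y ↦ L y a) x) :
    ContMDiffAt I 𝓘(𝕜, F →L[𝕜] G) ∞ L x := by
  let b := Module.finBasis 𝕜 F
  let c : Fin (Module.finrank 𝕜 F) → F →L[𝕜] 𝕜 := fun k ↦ LinearMap.toContinuousLinearMap (b.coord k)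
  have hL : L = fun y ↦ ∑ k, ContinuousLinearMap.smulRightL 𝕜 F G (c k) (L y (b k)) := by
    funext y
    refine ContinuousLinearMap.ext fun a ↦ ?_
    conv_lhs => rw [← b.sum_repr a, map_sum]
    rw [sum_apply]
    refine Finset.sum_congr rfl fun k _ ↦ ?_
    rw [map_smul]
    rfl
  rw [hL]
  exact ContMDiffAt.sum fun k _ ↦
    (ContinuousLinearMap.smulRightL 𝕜 F G (c k)).contMDiff.contMDiffAt.comp
      (I' := 𝓘(𝕜, G)) x (h (b k))

variable {V : N → Type*} [TopologicalSpace (TotalSpace F V)]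
  [∀ x, AddCommGroup (V x)] [∀ x, Module 𝕜 (V x)] [∀ x, TopologicalSpace (V x)]
  [∀ x, IsTopologicalAddGroup (V x)] [∀ x, ContinuousSMul 𝕜 (V x)]
  [FiberBundle F V] [VectorBundle 𝕜 F V] [ContMDiffVectorBundle ∞ F V I]

theorem contMDiff_bilinear_of_apply {g : ∀ x : N, V x →L[𝕜] V x →L[𝕜] 𝕜}
    (h : ∀ (s t : Π x, V x) (x : N), CMDiffAt ∞ (T% s) x → CMDiffAt ∞ (T% t) x →
      ContMDiffAt I 𝓘(𝕜, 𝕜) ∞ (fun y ↦ g y (s y) (t y)) x) :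
    ContMDiff I (I.prod 𝓘(𝕜, F →L[𝕜] F →L[𝕜] 𝕜)) ∞
      (fun x ↦ TotalSpace.mk' (F →L[𝕜] F →L[𝕜] 𝕜) (E := fun x : N ↦ V x →L[𝕜] V x →L[𝕜] 𝕜)
        x (g x)) := by
  intro x
  refine (contMDiffAt_hom_bundle (F₁ := F) (E₁ := V) (F₂ := F →L[𝕜] 𝕜)
    (E₂ := fun x ↦ V x →L[𝕜] Bundle.Trivial N 𝕜 x) _).2 ⟨contMDiffAt_id, ?_⟩
  refine contMDiffAt_clm_of_apply fun a ↦ contMDiffAt_clm_of_apply fun b ↦ ?_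
  set e := trivializationAt F V x
  have hx : x ∈ e.baseSet := FiberBundle.mem_baseSet_trivializationAt' x
  refine (h (fun y ↦ e.symm y a) (fun y ↦ e.symm y b) x
    ((smoothSectionOn_symm e a).contMDiffAt e.open_baseSet hx)
    ((smoothSectionOn_symm e b).contMDiffAt e.open_baseSet hx)).congr_of_eventuallyEq ?_
  filter_upwards [e.open_baseSet.mem_nhds hx] with y hy
  refine (inCoordinates_apply_eq₂ (E₃ := Bundle.Trivial N 𝕜) hy hy (mem_univ _)).trans ?_
  simp
  rfl

end BilinearSmooth

section FrobeniusTotal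

set_option maxSynthPendingDepth 3

variable {𝕜 : Type*} [RCLike 𝕜]
  {E : Type*} [NormedAddCommGroup E] [NormedSpace 𝕜 E] [FiniteDimensional 𝕜 E]
  {M : Type*} [TopologicalSpace M] [ChartedSpace E M] [IsManifold 𝓘(𝕜, E) ∞ M]
  {F : Type*} [NormedAddCommGroup F] [NormedSpace 𝕜 F] [FiniteDimensional 𝕜 F]
  {V : M → Type*} [TopologicalSpace (TotalSpace F V)]
  [∀ x, AddCommGroup (V x)] [∀ x, Module 𝕜 (V x)] [∀ x, TopologicalSpace (V x)]
  [∀ x, IsTopologicalAddGroup (V x)] [∀ x, ContinuousSMul 𝕜 (V x)]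
  [FiberBundle F V] [VectorBundle 𝕜 F V] [ContMDiffVectorBundle ∞ F V 𝓘(𝕜, E)]

variable {D : CovariantDerivative 𝓘(𝕜, E) F V}
  {nablaM : CovariantDerivative 𝓘(𝕜, E) E (TangentSpace 𝓘(𝕜, E) : M → Type _)}
  {mulM : ∀ x : M,
    TangentSpace 𝓘(𝕜, E) x →L[𝕜] TangentSpace 𝓘(𝕜, E) x →L[𝕜] TangentSpace 𝓘(𝕜, E) x}
  {mulV : ∀ x : M, V x →L[𝕜] V x →L[𝕜] V x}
  {gM : ∀ x : M, TangentSpace 𝓘(𝕜, E) x →L[𝕜] TangentSpace 𝓘(𝕜, E) x →L[𝕜] 𝕜}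
  {gV : ∀ x : M, V x →L[𝕜] V x →L[𝕜] 𝕜}
  {α : ∀ x : M, V x →L[𝕜] TangentSpace 𝓘(𝕜, E) x}
  {eM : Π x : M, TangentSpace 𝓘(𝕜, E) x} {eV : Π x : M, V x}

theorem flatMetricPair_of_isFManifold (hM : IsFrobenius 𝓘(𝕜, E) mulM eM gM)
    (hnablaM : IsLeviCivita 𝓘(𝕜, E) gM nablaM)
    (hV : IsCommAlgebraBundle 𝓘(𝕜, E) F mulV eV) (hgV : IsInvariantMetric 𝓘(𝕜, E) F mulV gV)
    (hD : IsSmoothConnection (F := F) D) (hα : IsSmoothMorphism (F := F) α)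
    (hg : ∀ (v : TotalSpace F V) (W : TotalTangent 𝕜 (E := E) v),
      (∀ W', totalMetric D gM gV α v W W' = 0) → W = 0)
    (hF : IsFManifold (𝓘(𝕜, E).prod 𝓘(𝕜, F)) (totalMul D mulM mulV α) (totalUnit D eV))
    (hadm : IsAdmissible (𝓘(𝕜, E).prod 𝓘(𝕜, F)) (totalMetric D gM gV α) (totalUnit D eV)) :
    FlatMetricPair nablaM D gM gV α := by
  have hsM : SmoothPairing 𝓘(𝕜, E) gM := fun _ _ _ hX hY ↦ hM.metric.contMDiffAt hX hY
  have hps : ∀ {nabla : CovariantDerivative 𝓘(𝕜, E) E (TangentSpace 𝓘(𝕜, E) : M → Type _)},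
      IsLeviCivita 𝓘(𝕜, E) gM nabla → PreservesSmooth nabla := fun h _ _ _ hO hX hY _ hx ↦
    (h.contMDiffAt hM.metric.symm hM.metric.nondegenerate hsM hO hX hY hx).contMDiffWithinAt
  refine
    { preservesSmooth_base := hps hnablaM
      preservesSmooth := hD.preservesSmooth
      flat_base := ?_
      flat := isFlatConnectionOn_of_isFManifold hM.fManifold.algebra hD.preservesSmooth hF
      leviCivita := hnablaM
      symm_base := hM.metric.symm
      symm := hgV.symm
      smooth_base := hsM
      smooth := fun _ _ _ hs ht ↦ hgV.contMDiffAt hs ht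
      smooth_morphism := hα
      metric := fun U s t hU hs ht x hx u ↦ connection_metric hM.fManifold.algebra hV hM.metric hgV
        hD.preservesSmooth hα hF hadm hU hs ht hx u
      nondegenerate := hg }
  obtain ⟨nabla, hLC, hflat⟩ := hM.flat
  exact hflat.congr (hps hLC) fun s x hs ↦
    hLC.unique hM.metric.symm hM.metric.nondegenerate hnablaM hs

theorem totalMetric_eq (v : TotalSpace F V) (W W' : TotalTangent 𝕜 (E := E) v) :
    totalMetric D gM gV α v W W' =
      gM v.proj (projDeriv v W + α v.proj (connectionMap D v W))
          (projDeriv v W' + α v.proj (connectionMap D v W'))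
        - gM v.proj (α v.proj (connectionMap D v W)) (α v.proj (connectionMap D v W'))
        + gV v.proj (connectionMap D v W) (connectionMap D v W') := by
  rw [totalMetric_apply]
  simp only [map_add, add_apply]
  ring

theorem isInvariantMetric_totalMetric (h : FlatMetricPair nablaM D gM gV α)
    (hgM : IsInvariantMetric 𝓘(𝕜, E) E mulM gM) (hgV : IsInvariantMetric 𝓘(𝕜, E) F mulV gV)
    (hα_mul : ∀ x (a b : V x), α x (mulV x a b) = mulM x (α x a) (α x b)) :
    IsInvariantMetric (𝓘(𝕜, E).prod 𝓘(𝕜, F)) (E × F) (totalMul D mulM mulV α)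
      (totalMetric D gM gV α) where
  smooth := contMDiff_bilinear_of_apply h.smoothPairing_total
  symm := h.symm_total
  nondegenerate := h.nondegenerate
  invariant := by
    intro v W₁ W₂ W₃
    have key : ∀ W W' : TotalTangent 𝕜 (E := E) v,
        projDeriv v (totalMul D mulM mulV α v W W')
          + α v.proj (connectionMap D v (totalMul D mulM mulV α v W W')) =
        mulM v.proj (projDeriv v W + α v.proj (connectionMap D v W))
          (projDeriv v W' + α v.proj (connectionMap D v W')) := by
      intro W W'
      rw [projDeriv_totalMul, connectionMap_totalMul, hα_mul]
      simp only [map_add, add_apply]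
      abel
    rw [totalMetric_eq, totalMetric_eq, key, key, connectionMap_totalMul, connectionMap_totalMul,
      hα_mul, hα_mul, hgM.invariant, hgM.invariant, hgV.invariant]

theorem isFrobenius_iff_isFlatMetricOn (h : FlatMetricPair nablaM D gM gV α)
    (hgM : IsInvariantMetric 𝓘(𝕜, E) E mulM gM) (hgV : IsInvariantMetric 𝓘(𝕜, E) F mulV gV)
    (hα_mul : ∀ x (a b : V x), α x (mulV x a b) = mulM x (α x a) (α x b))
    (hF : IsFManifold (𝓘(𝕜, E).prod 𝓘(𝕜, F)) (totalMul D mulM mulV α) (totalUnit D eV))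
    (hadm : IsAdmissible (𝓘(𝕜, E).prod 𝓘(𝕜, F)) (totalMetric D gM gV α) (totalUnit D eV)) :
    IsFrobenius (𝓘(𝕜, E).prod 𝓘(𝕜, F)) (totalMul D mulM mulV α) (totalUnit D eV)
        (totalMetric D gM gV α) ↔
      IsFlatMetricOn (𝓘(𝕜, E).prod 𝓘(𝕜, F)) (totalMetric D gM gV α)
        (univ : Set (TotalSpace F V)) :=
  ⟨fun hfrob ↦ hfrob.flat, fun hflat ↦
    ⟨hF, isInvariantMetric_totalMetric h hgM hgV hα_mul, hadm, hflat⟩⟩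

theorem isFlatMetricOn_iff_conditions (h : FlatMetricPair nablaM D gM gV α)
    (hadm : IsAdmissible (𝓘(𝕜, E).prod 𝓘(𝕜, F)) (totalMetric D gM gV α) (totalUnit D eV))
    {ι κ : Type*} [Fintype ι] [Fintype κ] {v : ι → Π x : M, V x}
    {Xf : κ → Π x : M, TangentSpace 𝓘(𝕜, E) x} {U : Set M} (hU : IsOpen U)
    (hv : IsOrthonormalFrameOn (E := E) F (reducedMetric gM gV α) v U)
    (hX : IsOrthonormalFrameOn (E := E) E (fun x a b ↦ gM x a b) Xf U) :
    IsFlatMetricOn (𝓘(𝕜, E).prod 𝓘(𝕜, F)) (totalMetric D gM gV α)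
        (TotalSpace.proj ⁻¹' U : Set (TotalSpace F V)) ↔
      FlatnessConditionsOn nablaM D gM gV α v Xf U := by
  constructor
  · rintro ⟨nabla, hLC, hflat⟩
    exact h.conditions_of_isFlatConnectionOn hU hv hX hLC hflat
  · intro hc
    obtain ⟨nabla, hLC, -⟩ := hadm
    exact ⟨nabla, hLC, h.isFlatConnectionOn_of_conditions hU hv hX hc hLC⟩

end FrobeniusTotal

section LocalSquareRoot

variable {𝕜 : Type*} [RCLike 𝕜]

theorem exists_sq_eq_or_eq_neg (z : 𝕜) : ∃ c : 𝕜, c ^ 2 = z ∨ c ^ 2 = -z := by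
  rcases RCLike.I_eq_zero_or_im_I_eq_one (K := 𝕜) with h | h
  · let φ := RCLike.realRingEquiv h
    refine ⟨φ.symm (Real.sqrt |φ z|), ?_⟩
    rw [← map_pow, Real.sq_sqrt (abs_nonneg _)]
    rcases abs_choice (φ z) with h1 | h1
    · left; rw [h1, φ.symm_apply_apply]
    · right; rw [h1, map_neg, φ.symm_apply_apply]
  · let φ := RCLike.complexRingEquiv h
    obtain ⟨c, hc⟩ := IsAlgClosed.exists_pow_nat_eq (φ z) (n := 2) (by norm_num)
    refine ⟨φ.symm c, Or.inl ?_⟩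
    rw [← map_pow, hc, φ.symm_apply_apply]

theorem exists_contDiffOn_sqrt {c : 𝕜} (hc : c ≠ 0) :
    ∃ (T : Set 𝕜) (q : 𝕜 → 𝕜), IsOpen T ∧ c ^ 2 ∈ T ∧ ContDiffOn 𝕜 ∞ q T ∧
      ∀ z ∈ T, q z ≠ 0 ∧ q z ^ 2 = z := by
  have hder : ∀ a : 𝕜, ∀ ha : a ≠ 0, HasFDerivAt (fun z : 𝕜 ↦ z ^ 2)
      ((ContinuousLinearEquiv.unitsEquivAut 𝕜 (Units.mk0 (2 * a) (mul_ne_zero two_ne_zero ha)) :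
        𝕜 ≃L[𝕜] 𝕜) : 𝕜 →L[𝕜] 𝕜) a := by
    intro a ha
    have h1 := (hasDerivAt_pow 2 a).hasFDerivAt
    refine h1.congr_fderiv (ContinuousLinearMap.ext_ring ?_)
    simp
  have hcd : ∀ a : 𝕜, ContDiffAt 𝕜 ∞ (fun z : 𝕜 ↦ z ^ 2) a := fun a ↦ contDiffAt_id.pow 2
  let φ := (hcd c).toOpenPartialHomeomorph _ (hder c hc) (by simp)
  have hφ : ∀ z, φ z = z ^ 2 := fun z ↦ rfl
  have hsq : ∀ z ∈ φ.target, φ.symm z ^ 2 = z := fun z hz ↦ by rw [← hφ, φ.right_inv hz]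
  refine ⟨φ.target ∩ {0}ᶜ, φ.symm, φ.open_target.inter isOpen_compl_singleton,
    ⟨(hcd c).image_mem_toOpenPartialHomeomorph_target (hder c hc) (by simp),
      pow_ne_zero 2 hc⟩, fun z hz ↦ ?_, fun z hz ↦ ?_⟩
  · have hne : φ.symm z ≠ 0 := fun h0 ↦ hz.2 (by
      have := hsq z hz.1
      rw [h0] at this
      simpa using this.symm)
    exact (φ.contDiffAt_symm hz.1 (hder _ hne) (hcd _)).contDiffWithinAt
  · refine ⟨fun h0 ↦ hz.2 ?_, hsq z hz.1⟩
    have := hsq z hz.1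
    rw [h0] at this
    simpa using this.symm

theorem exists_contDiffOn_normalizer {z₀ : 𝕜} (hz₀ : z₀ ≠ 0) :
    ∃ (T : Set 𝕜) (q : 𝕜 → 𝕜), IsOpen T ∧ z₀ ∈ T ∧ ContDiffOn 𝕜 ∞ q T ∧
      ∀ z ∈ T, q z ≠ 0 ∧ (q z ^ 2 * z = 1 ∨ q z ^ 2 * z = -1) := by
  obtain ⟨c, hc⟩ := exists_sq_eq_or_eq_neg z₀
  have hc0 : c ≠ 0 := by
    rintro rfl
    rcases hc with h | h
    · exact hz₀ (by simpa using h.symm)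
    · exact hz₀ (by simpa using h.symm)
  obtain ⟨T, q, hT, hcT, hq, h⟩ := exists_contDiffOn_sqrt hc0
  rcases hc with hc | hc
  · refine ⟨T, fun z ↦ (q z)⁻¹, hT, hc ▸ hcT, hq.inv fun z hz ↦ (h z hz).1, fun z hz ↦
      ⟨inv_ne_zero (h z hz).1, Or.inl ?_⟩⟩
    obtain ⟨h1, h2⟩ := h z hz
    rw [inv_pow]
    nth_rw 2 [← h2]
    exact inv_mul_cancel₀ (pow_ne_zero 2 h1)
  · refine ⟨(fun z ↦ -z) ⁻¹' T, fun z ↦ (q (-z))⁻¹, hT.preimage continuous_neg,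
      by rw [mem_preimage, ← hc]; exact hcT,
      (hq.comp contDiff_neg.contDiffOn fun z hz ↦ hz).inv fun z hz ↦ (h _ hz).1, fun z hz ↦
      ⟨inv_ne_zero (h _ hz).1, Or.inr ?_⟩⟩
    obtain ⟨h1, h2⟩ := h _ hz
    rw [inv_pow, inv_mul_eq_iff_eq_mul₀ (pow_ne_zero 2 h1), h2]
    ring

end LocalSquareRoot

section OrthonormalFrame

set_option maxSynthPendingDepth 3

variable {𝕜 : Type*} [RCLike 𝕜]
  {E : Type*} [NormedAddCommGroup E] [NormedSpace 𝕜 E] [FiniteDimensional 𝕜 E]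
  {M : Type*} [TopologicalSpace M] [ChartedSpace E M] [IsManifold 𝓘(𝕜, E) ∞ M]
  {F : Type*} [NormedAddCommGroup F] [NormedSpace 𝕜 F] [FiniteDimensional 𝕜 F]
  {V : M → Type*} [TopologicalSpace (TotalSpace F V)]
  [∀ x, AddCommGroup (V x)] [∀ x, Module 𝕜 (V x)] [∀ x, TopologicalSpace (V x)]
  [∀ x, IsTopologicalAddGroup (V x)] [∀ x, ContinuousSMul 𝕜 (V x)]
  [FiberBundle F V] [VectorBundle 𝕜 F V] [ContMDiffVectorBundle ∞ F V 𝓘(𝕜, E)]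

/-- One step of the Gram–Schmidt process: the family `t` is normalized at `k` and made orthogonal to
the result. -/
theorem exists_gramSchmidt_step {ι : Type*} [DecidableEq ι] (b : ∀ x : M, V x →ₗ[𝕜] V x →ₗ[𝕜] 𝕜)
    (hsymm : ∀ x (a a' : V x), b x a a' = b x a' a)
    (hsm : ∀ (s t : Π x : M, V x) (x : M), CMDiffAt ∞ (T% s) x → CMDiffAt ∞ (T% t) x →
      ContMDiffAt 𝓘(𝕜, E) 𝓘(𝕜, 𝕜) ∞ (fun y ↦ b y (s y) (t y)) x)
    {p : M} {A : Finset ι} {k : ι} (hk : k ∉ A) {U : Set M} (hU : IsOpen U) (hp : p ∈ U)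
    {t : ι → Π x : M, V x} (ht : ∀ i, SmoothSectionOn 𝓘(𝕜, E) F (t i) U)
    (ho : ∀ i ∈ A, ∀ j, i ≠ j → ∀ x ∈ U, b x (t i x) (t j x) = 0)
    (hn : ∀ i ∈ A, ∀ x ∈ U, b x (t i x) (t i x) = 1 ∨ b x (t i x) (t i x) = -1)
    (hop : ∀ i j, i ≠ j → b p (t i p) (t j p) = 0) (hnp : ∀ i, b p (t i p) (t i p) ≠ 0) :
    ∃ (U' : Set M) (t' : ι → Π x : M, V x), IsOpen U' ∧ p ∈ U' ∧
      (∀ i, SmoothSectionOn 𝓘(𝕜, E) F (t' i) U') ∧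
      (∀ i ∈ insert k A, ∀ j, i ≠ j → ∀ x ∈ U', b x (t' i x) (t' j x) = 0) ∧
      (∀ i ∈ insert k A, ∀ x ∈ U', b x (t' i x) (t' i x) = 1 ∨ b x (t' i x) (t' i x) = -1) ∧
      (∀ i j, i ≠ j → b p (t' i p) (t' j p) = 0) ∧ ∀ i, b p (t' i p) (t' i p) ≠ 0 := by
  obtain ⟨T, q, hT, hpT, hq, hqT⟩ := exists_contDiffOn_normalizer (hnp k)
  set f : M → 𝕜 := fun x ↦ b x (t k x) (t k x) with hf
  have hfs : ContMDiffOn 𝓘(𝕜, E) 𝓘(𝕜, 𝕜) ∞ f U := fun x hx ↦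
    (hsm _ _ x ((ht k).contMDiffAt hU hx) ((ht k).contMDiffAt hU hx)).contMDiffWithinAt
  have hU' : IsOpen (U ∩ f ⁻¹' T) := hfs.continuousOn.isOpen_inter_preimage hU hT
  set r : M → 𝕜 := fun x ↦ q (f x) with hr
  have hrs : ContMDiffOn 𝓘(𝕜, E) 𝓘(𝕜, 𝕜) ∞ r (U ∩ f ⁻¹' T) :=
    hq.contMDiffOn.comp (I' := 𝓘(𝕜, 𝕜)) (hfs.mono inter_subset_left) fun x hx ↦ hx.2
  have hrf : ∀ x ∈ U ∩ f ⁻¹' T, r x ≠ 0 ∧ (r x ^ 2 * f x = 1 ∨ r x ^ 2 * f x = -1) :=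
    fun x hx ↦ hqT (f x) hx.2
  let u : Π x : M, V x := fun x ↦ r x • t k x
  have hu : SmoothSectionOn 𝓘(𝕜, E) F u (U ∩ f ⁻¹' T) :=
    hrs.smul_section ((ht k).mono' inter_subset_left)
  have huu : ∀ x, b x (u x) (u x) = r x ^ 2 * f x := fun x ↦ by
    simp only [u, hf, map_smul, LinearMap.smul_apply, smul_eq_mul]; ring
  have hue : ∀ x ∈ U ∩ f ⁻¹' T, b x (u x) (u x) = 1 ∨ b x (u x) (u x) = -1 := fun x hx ↦ by
    rw [huu]; exact (hrf x hx).2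
  have hus : ∀ x ∈ U ∩ f ⁻¹' T, b x (u x) (u x) * b x (u x) (u x) = 1 := fun x hx ↦ by
    rcases hue x hx with h | h <;> rw [h] <;> ring
  let t' : ι → Π x : M, V x := fun j x ↦ if j = k then u x else
    t j x - (b x (u x) (u x) * b x (t j x) (u x)) • u x
  have hk' : t' k = u := by funext x; simp [t']
  have hj' : ∀ j, j ≠ k → ∀ x, t' j x = t j x - (b x (u x) (u x) * b x (t j x) (u x)) • u x :=
    fun j hj x ↦ by simp [t', hj]
  have hA : ∀ i ∈ A, ∀ x ∈ U ∩ f ⁻¹' T, t' i x = t i x := fun i hi x hx ↦ by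
    have hik : i ≠ k := fun h ↦ hk (h ▸ hi)
    rw [hj' i hik]
    simp only [u, map_smul, smul_eq_mul, ho i hi k hik x hx.1, mul_zero, zero_smul, sub_zero]
  have hpU : p ∈ U ∩ f ⁻¹' T := ⟨hp, hpT⟩
  have hpj : ∀ j, j ≠ k → t' j p = t j p := fun j hj ↦ by
    rw [hj' j hj]
    simp only [u, map_smul, smul_eq_mul, hop j k hj, mul_zero, zero_smul, sub_zero]
  have hku : ∀ j, j ≠ k → ∀ x ∈ U ∩ f ⁻¹' T, b x (u x) (t' j x) = 0 := fun j hj x hx ↦ by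
    have gen : ∀ c a : V x, b x c c * b x c c = 1 → b x c (a - (b x c c * b x a c) • c) = 0 := by
      intro c a h
      rw [map_sub, map_smul, smul_eq_mul, hsymm x a]
      linear_combination (- b x c a) * h
    rw [hj' j hj]
    exact gen _ _ (hus x hx)
  refine ⟨U ∩ f ⁻¹' T, t', hU', hpU, fun j ↦ ?_, ?_, ?_, ?_, ?_⟩
  · by_cases hj : j = k
    · rw [hj, hk']; exact hu
    · have h1 : t' j = fun x ↦ t j x - (b x (u x) (u x) * b x (t j x) (u x)) • u x :=
        funext (hj' j hj)
      rw [h1]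
      intro x hx
      have hux := hu.contMDiffAt hU' hx
      have htx := (ht j).contMDiffAt hU hx.1
      exact (htx.sub_section (((hsm _ _ x hux hux).mul (hsm _ _ x htx hux)).smul_section
        hux)).contMDiffWithinAt
  · intro i hi j hij x hx
    rcases Finset.mem_insert.1 hi with rfl | hi
    · rw [hk']; exact hku j hij.symm x hx
    · by_cases hj : j = k
      · have hik : i ≠ k := fun h ↦ hk (h ▸ hi)
        rw [hj, hk', hsymm]; exact hku i hik x hx
      · rw [hA i hi x hx, hj' j hj, map_sub, map_smul, ho i hi j hij x hx.1]
        simp only [u, map_smul, ho i hi k (fun h ↦ hk (h ▸ hi)) x hx.1, smul_zero, sub_zero]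
  · intro i hi x hx
    rcases Finset.mem_insert.1 hi with rfl | hi
    · rw [hk']; exact hue x hx
    · rw [hA i hi x hx]; exact hn i hi x hx.1
  · intro i j hij
    by_cases hi : i = k
    · rw [hi, hk']; exact hku j (fun h ↦ hij (hi.trans h.symm)) p hpU
    · by_cases hj : j = k
      · rw [hj, hk', hsymm]; exact hku i hi p hpU
      · rw [hpj i hi, hpj j hj]; exact hop i j hij
  · intro i
    by_cases hi : i = k
    · rw [hi, hk']
      rcases hue p hpU with h | h <;> rw [h] <;> simp
    · rw [hpj i hi]; exact hnp i

/-- A smooth non-degenerate symmetric bilinear form on a vector bundle has local orthonormal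
frames. -/
theorem exists_isOrthonormalFrameOn (b : ∀ x : M, V x →ₗ[𝕜] V x →ₗ[𝕜] 𝕜)
    (hsymm : ∀ x (a a' : V x), b x a a' = b x a' a)
    (hsm : ∀ (s t : Π x : M, V x) (x : M), CMDiffAt ∞ (T% s) x → CMDiffAt ∞ (T% t) x →
      ContMDiffAt 𝓘(𝕜, E) 𝓘(𝕜, 𝕜) ∞ (fun y ↦ b y (s y) (t y)) x)
    (p : M) (hnd : ∀ a : V p, (∀ a', b p a a' = 0) → a = 0) :
    ∃ (U : Set M) (v : Fin (Module.finrank 𝕜 F) → Π x : M, V x), IsOpen U ∧ p ∈ U ∧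
      IsOrthonormalFrameOn (E := E) F (fun x a a' ↦ b x a a') v U := by
  classical
  have hdim : ∀ x, Module.finrank 𝕜 (V x) = Module.finrank 𝕜 F ∧ FiniteDimensional 𝕜 (V x) := by
    intro x
    let φ : V x ≃L[𝕜] F := (trivializationAt F V x).continuousLinearEquivAt 𝕜 x
      (FiberBundle.mem_baseSet_trivializationAt' x)
    exact ⟨φ.toLinearEquiv.finrank_eq, φ.symm.toLinearEquiv.finiteDimensional⟩
  have : FiniteDimensional 𝕜 (V p) := (hdim p).2
  have : Invertible (2 : 𝕜) := invertibleOfNonzero two_ne_zero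
  obtain ⟨β, hβ⟩ := LinearMap.BilinForm.exists_orthogonal_basis (B := b p)
    (LinearMap.isSymm_def.2 (hsymm p))
  have hsep : LinearMap.SeparatingLeft (b p) := fun a ha ↦ hnd a ha
  have hβn := hβ.not_isOrtho_basis_self_of_separatingLeft hsep
  let σ := finCongr (hdim p).1.symm
  set e := trivializationAt F V p
  have hpe : p ∈ e.baseSet := FiberBundle.mem_baseSet_trivializationAt' p
  choose s hs hss using fun i : Fin (Module.finrank 𝕜 F) ↦
    exists_smooth_extension (I := 𝓘(𝕜, E)) (F := F) p (β (σ i))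
  have key : ∀ A : Finset (Fin (Module.finrank 𝕜 F)), ∃ (U : Set M)
      (t : Fin (Module.finrank 𝕜 F) → Π x : M, V x), IsOpen U ∧ p ∈ U ∧
      (∀ i, SmoothSectionOn 𝓘(𝕜, E) F (t i) U) ∧
      (∀ i ∈ A, ∀ j, i ≠ j → ∀ x ∈ U, b x (t i x) (t j x) = 0) ∧
      (∀ i ∈ A, ∀ x ∈ U, b x (t i x) (t i x) = 1 ∨ b x (t i x) (t i x) = -1) ∧
      (∀ i j, i ≠ j → b p (t i p) (t j p) = 0) ∧ ∀ i, b p (t i p) (t i p) ≠ 0 := by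
    intro A
    induction A using Finset.induction_on with
    | empty =>
      refine ⟨e.baseSet, s, e.open_baseSet, hpe, hss, by simp, by simp, fun i j hij ↦ ?_, fun i ↦ ?_⟩
      · rw [hs, hs]; exact hβ (σ.injective.ne hij)
      · rw [hs]; exact hβn (σ i)
    | insert k A hk ih =>
      obtain ⟨U, t, hU, hp, ht, ho, hn, hop, hnp⟩ := ih
      exact exists_gramSchmidt_step b hsymm hsm hk hU hp ht ho hn hop hnp
  obtain ⟨U, t, hU, hp, ht, ho, hn, -, -⟩ := key Finset.univ
  have hli : ∀ x ∈ U, LinearIndependent 𝕜 (fun i ↦ t i x) := by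
    intro x hx
    refine Fintype.linearIndependent_iff.2 fun g hg i ↦ ?_
    have h1 := congrArg (b x (t i x)) hg
    rw [map_sum, map_zero, Finset.sum_eq_single i] at h1
    · rw [map_smul, smul_eq_mul] at h1
      refine (mul_eq_zero.1 h1).resolve_right ?_
      rcases hn i (Finset.mem_univ i) x hx with h | h <;> rw [h] <;> simp
    · intro j _ hj
      rw [map_smul, ho i (Finset.mem_univ i) j hj.symm x hx, smul_zero]
    · simp
  refine ⟨U, t, hU, hp, ⟨⟨fun {x} hx ↦ hli x hx, fun {x} hx ↦ ?_, ht⟩,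
    fun x hx i j hij ↦ ho i (Finset.mem_univ i) j hij x hx,
    fun x hx i ↦ hn i (Finset.mem_univ i) x hx⟩⟩
  have := (hdim x).2
  exact ((hli x hx).span_eq_top_of_card_eq_finrank' (by rw [Fintype.card_fin, (hdim x).1])).ge

end OrthonormalFrame

section GlobalCriterion

set_option maxSynthPendingDepth 3

variable {𝕜 : Type*} [RCLike 𝕜]
  {E : Type*} [NormedAddCommGroup E] [NormedSpace 𝕜 E] [FiniteDimensional 𝕜 E]
  {M : Type*} [TopologicalSpace M] [ChartedSpace E M] [IsManifold 𝓘(𝕜, E) ∞ M]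
  {F : Type*} [NormedAddCommGroup F] [NormedSpace 𝕜 F] [FiniteDimensional 𝕜 F]
  {V : M → Type*} [TopologicalSpace (TotalSpace F V)]
  [∀ x, AddCommGroup (V x)] [∀ x, Module 𝕜 (V x)] [∀ x, TopologicalSpace (V x)]
  [∀ x, IsTopologicalAddGroup (V x)] [∀ x, ContinuousSMul 𝕜 (V x)]
  [FiberBundle F V] [VectorBundle 𝕜 F V] [ContMDiffVectorBundle ∞ F V 𝓘(𝕜, E)]

variable {nablaM : CovariantDerivative 𝓘(𝕜, E) E (TangentSpace 𝓘(𝕜, E) : M → Type _)}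
  {D : CovariantDerivative 𝓘(𝕜, E) F V}
  {gM : ∀ x : M, TangentSpace 𝓘(𝕜, E) x →L[𝕜] TangentSpace 𝓘(𝕜, E) x →L[𝕜] 𝕜}
  {gV : ∀ x : M, V x →L[𝕜] V x →L[𝕜] 𝕜}
  {α : ∀ x : M, V x →L[𝕜] TangentSpace 𝓘(𝕜, E) x}
  {eV : Π x : M, V x}

theorem IsOrthonormalFrameOn.mono {ι : Type*} {b : ∀ x : M, V x → V x → 𝕜} {v : ι → Π x : M, V x}
    {U U' : Set M} (h : IsOrthonormalFrameOn (E := E) F b v U) (hU : U' ⊆ U) :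
    IsOrthonormalFrameOn (E := E) F b v U' :=
  ⟨h.frame.mono hU, fun x hx ↦ h.orthogonal x (hU hx), fun x hx ↦ h.normalized x (hU hx)⟩

namespace FlatMetricPair

theorem reducedMetric_nondegenerate (h : FlatMetricPair nablaM D gM gV α) {x : M} {a : V x}
    (ha : ∀ a', reducedMetric gM gV α x a a' = 0) : a = 0 := by
  let v : TotalSpace F V := ⟨x, 0⟩
  have h1 : projDeriv v (vertLift D v a - horLift D v (α x a)) = - α x a := by
    rw [map_sub, projDeriv_vertLift, projDeriv_horLift, zero_sub]
  have h2 : connectionMap D v (vertLift D v a - horLift D v (α x a)) = a := by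
    rw [map_sub, connectionMap_vertLift, connectionMap_horLift, sub_zero]
  have h3 : vertLift D v a - horLift D v (α x a) = 0 := by
    refine h.nondegenerate v _ fun W' ↦ ?_
    rw [totalMetric_eq, h1, h2, neg_add_cancel, map_zero, zero_apply]
    have := ha (connectionMap D v W')
    rw [reducedMetric] at this
    linear_combination this
  rw [← h2, h3, map_zero]

theorem exists_orthonormalFrames (h : FlatMetricPair nablaM D gM gV α)
    (hgM : ∀ x (a : TangentSpace 𝓘(𝕜, E) x), (∀ b, gM x a b = 0) → a = 0) (p : M) :
    ∃ (U : Set M) (v : Fin (Module.finrank 𝕜 F) → Π x : M, V x)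
      (Xf : Fin (Module.finrank 𝕜 E) → Π x : M, TangentSpace 𝓘(𝕜, E) x), IsOpen U ∧ p ∈ U ∧
      IsOrthonormalFrameOn (E := E) F (reducedMetric gM gV α) v U ∧
      IsOrthonormalFrameOn (E := E) E (fun x a b ↦ gM x a b) Xf U := by
  let b : ∀ x : M, V x →ₗ[𝕜] V x →ₗ[𝕜] 𝕜 := fun x ↦
    LinearMap.mk₂ 𝕜 (reducedMetric gM gV α x)
      (fun a a' c ↦ by simp only [reducedMetric, map_add, add_apply]; ring)
      (fun r a c ↦ by simp only [reducedMetric, map_smul, smul_apply, smul_eq_mul]; ring)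
      (fun a c c' ↦ by simp only [reducedMetric, map_add]; ring)
      (fun r a c ↦ by simp only [reducedMetric, map_smul, smul_eq_mul]; ring)
  let bM : ∀ x : M, TangentSpace 𝓘(𝕜, E) x →ₗ[𝕜] TangentSpace 𝓘(𝕜, E) x →ₗ[𝕜] 𝕜 := fun x ↦
    LinearMap.mk₂ 𝕜 (fun a c ↦ gM x a c) (fun a a' c ↦ by simp only [map_add, add_apply])
      (fun r a c ↦ by simp only [map_smul, smul_apply]) (fun a c c' ↦ by simp only [map_add])
      (fun r a c ↦ by simp only [map_smul])
  have hα := h.smooth_morphism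
  obtain ⟨U₁, v, hU₁, hp₁, hv⟩ := exists_isOrthonormalFrameOn (E := E) b
    (fun x a a' ↦ by
      change reducedMetric gM gV α x a a' = reducedMetric gM gV α x a' a
      rw [reducedMetric, reducedMetric, h.symm, h.symm_base])
    (fun s t x hs ht ↦ (h.smooth s t x hs ht).sub
      (h.smooth_base _ _ x (hα.contMDiffAt hs) (hα.contMDiffAt ht)))
    p (fun a ha ↦ h.reducedMetric_nondegenerate ha)
  obtain ⟨U₂, Xf, hU₂, hp₂, hX⟩ := exists_isOrthonormalFrameOn (E := E) bM h.symm_base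
    h.smooth_base p (hgM p)
  exact ⟨U₁ ∩ U₂, v, Xf, hU₁.inter hU₂, ⟨hp₁, hp₂⟩, IsOrthonormalFrameOn.mono hv inter_subset_left,
    IsOrthonormalFrameOn.mono hX inter_subset_right⟩

theorem isFlatMetricOn_univ_iff (h : FlatMetricPair nablaM D gM gV α)
    (hgM : ∀ x (a : TangentSpace 𝓘(𝕜, E) x), (∀ b, gM x a b = 0) → a = 0)
    (hadm : IsAdmissible (𝓘(𝕜, E).prod 𝓘(𝕜, F)) (totalMetric D gM gV α) (totalUnit D eV)) :
    IsFlatMetricOn (𝓘(𝕜, E).prod 𝓘(𝕜, F)) (totalMetric D gM gV α)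
        (univ : Set (TotalSpace F V)) ↔
      ∀ (U : Set M) (v : Fin (Module.finrank 𝕜 F) → Π x : M, V x)
        (Xf : Fin (Module.finrank 𝕜 E) → Π x : M, TangentSpace 𝓘(𝕜, E) x), IsOpen U →
        IsOrthonormalFrameOn (E := E) F (reducedMetric gM gV α) v U →
        IsOrthonormalFrameOn (E := E) E (fun x a b ↦ gM x a b) Xf U →
        FlatnessConditionsOn nablaM D gM gV α v Xf U := by
  constructor
  · rintro ⟨nabla, hLC, hflat⟩ U v Xf hU hv hX
    exact h.conditions_of_isFlatConnectionOn hU hv hX hLC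
      fun O hO _ ↦ hflat O hO (subset_univ _)
  · intro hc
    obtain ⟨nabla, hLC, -⟩ := hadm
    refine ⟨nabla, hLC, fun O hO _ X Y s hXs hYs hss w hw ↦ ?_⟩
    obtain ⟨U, v, Xf, hU, hwU, hv, hX⟩ := h.exists_orthonormalFrames hgM w.proj
    exact h.isFlatConnectionOn_of_conditions hU hv hX (hc U v Xf hU hv hX) hLC
      (O ∩ TotalSpace.proj ⁻¹' U) (hO.inter (isOpen_proj_preimage hU)) inter_subset_right X Y s
      (hXs.mono' inter_subset_left) (hYs.mono' inter_subset_left) (hss.mono' inter_subset_left) w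
      ⟨hw, hwU⟩

end FlatMetricPair

end GlobalCriterion

end Geometry

end BundleFrobenius

end

theorem proposition4p4 {𝕜 : Type*} [RCLike 𝕜]
    -- the base `M`, a `𝕜`-manifold
    {E : Type*} [NormedAddCommGroup E] [NormedSpace 𝕜 E] [FiniteDimensional 𝕜 E]
    {M : Type*} [TopologicalSpace M] [ChartedSpace E M] [IsManifold 𝓘(𝕜, E) ∞ M]
    -- the `𝕜`-vector bundle `V → M`
    {F : Type*} [NormedAddCommGroup F] [NormedSpace 𝕜 F] [FiniteDimensional 𝕜 F]
    {V : M → Type*} [TopologicalSpace (TotalSpace F V)]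
    [∀ x, AddCommGroup (V x)] [∀ x, Module 𝕜 (V x)] [∀ x, TopologicalSpace (V x)]
    [∀ x, IsTopologicalAddGroup (V x)] [∀ x, ContinuousSMul 𝕜 (V x)]
    [FiberBundle F V] [VectorBundle 𝕜 F V] [ContMDiffVectorBundle ∞ F V 𝓘(𝕜, E)]
    -- the base is a Frobenius manifold with Levi-Civita connection `nablaM`
    (mulM : ∀ x : M,
      TangentSpace 𝓘(𝕜, E) x →L[𝕜] TangentSpace 𝓘(𝕜, E) x →L[𝕜] TangentSpace 𝓘(𝕜, E) x)
    (eM : Π x : M, TangentSpace 𝓘(𝕜, E) x)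
    (gM : ∀ x : M, TangentSpace 𝓘(𝕜, E) x →L[𝕜] TangentSpace 𝓘(𝕜, E) x →L[𝕜] 𝕜)
    (hM : IsFrobenius 𝓘(𝕜, E) mulM eM gM)
    (nablaM : CovariantDerivative 𝓘(𝕜, E) E (TangentSpace 𝓘(𝕜, E) : M → Type _))
    (hnablaM : IsLeviCivita 𝓘(𝕜, E) gM nablaM)
    -- the fibres of `V` are Frobenius algebras
    (mulV : ∀ x : M, V x →L[𝕜] V x →L[𝕜] V x) (eV : Π x : M, V x)
    (gV : ∀ x : M, V x →L[𝕜] V x →L[𝕜] 𝕜)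
    (hV : IsCommAlgebraBundle 𝓘(𝕜, E) F mulV eV) (hgV : IsInvariantMetric 𝓘(𝕜, E) F mulV gV)
    -- the connection `D` and the morphism `α`
    (D : CovariantDerivative 𝓘(𝕜, E) F V) (hD : IsSmoothConnection (F := F) D)
    (α : ∀ x : M, V x →L[𝕜] TangentSpace 𝓘(𝕜, E) x) (hα : IsSmoothMorphism (F := F) α)
    (hα_mul : ∀ x (a b : V x), α x (mulV x a b) = mulM x (α x a) (α x b))
    (hα_one : ∀ x, α x (eV x) = eM x)
    -- `g` is non-degenerate and `(V, ∘, e_V, g)` is an `F`-manifold with admissible metric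
    (hg : ∀ (v : TotalSpace F V) (W : TotalTangent 𝕜 (E := E) v),
      (∀ W', totalMetric D gM gV α v W W' = 0) → W = 0)
    (hF : IsFManifold (𝓘(𝕜, E).prod 𝓘(𝕜, F)) (totalMul D mulM mulV α) (totalUnit D eV))
    (hadm : IsAdmissible (𝓘(𝕜, E).prod 𝓘(𝕜, F)) (totalMetric D gM gV α) (totalUnit D eV)) :
    -- over the domain of any local orthonormal frames, flatness is equivalent to the conditions
    (∀ (U : Set M) (v : Fin (Module.finrank 𝕜 F) → Π x : M, V x)
      (Xf : Fin (Module.finrank 𝕜 E) → Π x : M, TangentSpace 𝓘(𝕜, E) x), IsOpen U →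
      IsOrthonormalFrameOn (E := E) F (reducedMetric gM gV α) v U →
      IsOrthonormalFrameOn (E := E) E (fun x a b ↦ gM x a b) Xf U →
      (IsFlatMetricOn (𝓘(𝕜, E).prod 𝓘(𝕜, F)) (totalMetric D gM gV α)
          (TotalSpace.proj ⁻¹' U : Set (TotalSpace F V)) ↔
        FlatnessConditionsOn nablaM D gM gV α v Xf U)) ∧
    -- `g` is flat if and only if the conditions hold for all local orthonormal frames
    (IsFlatMetricOn (𝓘(𝕜, E).prod 𝓘(𝕜, F)) (totalMetric D gM gV α)
        (univ : Set (TotalSpace F V)) ↔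
      ∀ (U : Set M) (v : Fin (Module.finrank 𝕜 F) → Π x : M, V x)
        (Xf : Fin (Module.finrank 𝕜 E) → Π x : M, TangentSpace 𝓘(𝕜, E) x), IsOpen U →
        IsOrthonormalFrameOn (E := E) F (reducedMetric gM gV α) v U →
        IsOrthonormalFrameOn (E := E) E (fun x a b ↦ gM x a b) Xf U →
        FlatnessConditionsOn nablaM D gM gV α v Xf U) ∧
    -- `(V, ∘, e_V, g)` is Frobenius if and only if `g` is flat
    (IsFrobenius (𝓘(𝕜, E).prod 𝓘(𝕜, F)) (totalMul D mulM mulV α) (totalUnit D eV)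
        (totalMetric D gM gV α) ↔
      IsFlatMetricOn (𝓘(𝕜, E).prod 𝓘(𝕜, F)) (totalMetric D gM gV α)
        (univ : Set (TotalSpace F V))) := by
  have h := flatMetricPair_of_isFManifold hM hnablaM hV hgV hD hα hg hF hadm
  exact ⟨fun _ _ _ hU hv hX ↦ isFlatMetricOn_iff_conditions h hadm hU hv hX,
    h.isFlatMetricOn_univ_iff hM.metric.nondegenerate hadm,
    isFrobenius_iff_isFlatMetricOn h hM.metric hgV hα_mul hF hadm⟩
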